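/- Let $\mathbb F$ be a finite field, $m\ge 1$, and $\mathcal A=A_1\times\dots\times A_m\subseteq\mathbb F^m$ with every $A_i$ non-empty and $A_i=A_{m-i+1}$; let $\vec d\in\mathbb N^m$ satisfy $d_i\ge 2(|A_i|-1)$ for all $i$. Write $\mathbb F^{\le m}=\bigcup_{k=0}^m\mathbb F^k$, where $\bot$ is the vector of length $0$, and write $\bar{\mathcal A}=\bigcup_{k=0}^m A_1\times\dots\times A_k$. For $w\colon\mathbb F^m\to\mathbb F$ let $\Sigma_{\mathcal A}[w]\colon\mathbb F^{\le m}\to\mathbb F$ be $$\Sigma_{\mathcal A}[w](x_1,\dots,x_k)=\sum_{y\in A_{k+1}\times\dots\times A_m}w(x_1,\dots,x_k,y),$$ and for $w\colon\mathcal A\to\mathbb F$ define $\Sigma[w]\colon\bar{\mathcal A}\to\mathbb F$ by the same formula. The messages are the functions $f\colon\mathcal A\cup\{\bot\}\to\mathbb F$ with $f(\bot)=\sum_{a\in\mathcal A}f(a)$. The encoding $\mathsf{ENC}_{\Sigma\mathrm{AntiSym}}$ maps $f$ to $\Sigma[f|_{\mathcal A}+g]$, where $g$ is uniformly random among the functions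 $g\colon\mathcal A\to\mathbb F$ with $g(x_1,\dots,x_m)+g(x_m,\dots,x_1)=0$ for all $x\in\mathcal A$. The encoding $\mathsf{ENC}_{\Sigma\mathrm{RM}}$ maps $\Sigma[w]$, for $w\colon\mathcal A\to\mathbb F$, to a uniformly random element of the set of all words $\Sigma_{\mathcal A}[p]$, where $p$ runs over the polynomials in $m$ variables over $\mathbb F$ with degree at most $d_i$ in the $i$-th variable for each $i$ and with $p|_{\mathcal A}=w$. Let $\mathsf{ENC}_{\mathsf{PCP}}=\mathsf{ENC}_{\Sigma\mathrm{RM}}\circ\mathsf{ENC}_{\Sigma\mathrm{AntiSym}}$, with independent randomness in the two steps. **Corollary.** $\mathsf{ENC}_{\mathsf{PCP}}$ is $(t,\ell)$-locally simulatable for $$\ell(n)=\ell_{\Sigma\mathrm{RM}}(\ell_{\mathrm{AntiSym}}(n)),\qquad t(n)=\mathrm{poly}(\log|\mathbb F|,m,\max_i d_i,n),$$ where $\ell_{\Sigma\mathrm{RM}}(n)=nm(m(a+1)+1)^2$ with $a=\max_i|A_i|$, and $\ell_{\mathrm{AntiSym}}(n)=n^2m^2+1+O(n^4m^4/|\mathcal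 A|)$. That is, there are one probabilistic algorithm $\mathcal S$, one polynomial $t$ and one constant in the $O(\cdot)$, serving all $\mathbb F,m,\mathcal A,\vec d$, such that the following holds. The algorithm is given a description of $m$, $\vec d$ and the sets $A_i$ (each as a list of its elements), oracle access to a message $f$, a tuple $T\in(\mathbb F^{\le m}\times\mathbb F)^n$ and a point $\alpha\in\mathbb F^{\le m}$. For all inputs and all outcomes of its randomness it runs in time at most $t(n)$ and makes at most $\ell(n)$ queries to $f$. Moreover, if some word $c$ in the support of $\mathsf{ENC}_{\mathsf{PCP}}(f)$ satisfies $c_x=y$ for all $(x,y)\in T$, then for every $\beta\in\mathbb F$ $$\Pr[\mathcal S^f(T,\alpha)=\beta]=\Pr\bigl[\mathsf{ENC}_{\mathsf{PCP}}(f)_\alpha=\beta\;\big|\;\mathsf{ENC}_{\mathsf{PCP}}(f)_x=y\ \ \forall(x,y)\in T\bigr].$$ Algorithms are programs over binary trees whose leaves may hold field elements. They may perform field operations, test a field element for zero, and sample uniformly random field elements. A step on trees costs one unit, a field operation or a sample costs the square of the bit length of a field element, and a query costs moreover the length of the question in bits. -/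

import Mathlib

/-! ### A machine model: randomised oracle programs over a finite field

The data of a program are binary trees whose leaves are `nil` or an element of the field.  A program
is a finite piece of syntax that contains no field elements, so that one and the same program runs
over all finite fields.  Trees are handled by reference: pairing and projecting take one step. -/

inductive Data (F : Type*) where
  | nil : Data F
  | elt : F → Data F
  | node : Data F → Data F → Data F

namespace Data

variable {F : Type*}

def fst : Data F → Data F
  | node l _ => l
  | _ => nil

def snd : Data F → Data F
  | node _ r => r
  | _ => nil

/-- The entries along the right spine: `node a (node b (… nil))` is the list `[a, b, …]`. -/
def toList : Data F → List (Data F)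
  | node l r => l :: toList r
  | _ => []

def ofList : List (Data F) → Data F
  | [] => nil
  | a :: l => node a (ofList l)

/-- The number of vertices of the tree. -/
def size : Data F → ℕ
  | node l r => size l + size r + 1
  | _ => 1

/-- A natural number in unary. -/
def ofNat (k : ℕ) : Data F := ofList (List.replicate k nil)

/-- A list of field elements. -/
def ofElts (l : List F) : Data F := ofList (l.map elt)

/-- Truth values: `nil` is false, everything else is true. -/
def ofProp (p : Prop) [Decidable p] : Data F := if p then node nil nil else nil

def isNil : Data F → Bool
  | nil => true
  | _ => false

/-- A field operation, applied to the field elements in a pair (`nil` on other data). -/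
def map₂ (op : F → F → F) : Data F → Data F
  | node (elt a) (elt b) => elt (op a b)
  | _ => nil

def map₁ (op : F → F) : Data F → Data F
  | elt a => elt (op a)
  | _ => nil

open Classical in
/-- The test of a field element for being zero (false on other data). -/
noncomputable def isZero [Zero F] : Data F → Data F
  | elt a => ofProp (a = 0)
  | _ => nil

theorem toList_ofList (l : List (Data F)) : (ofList l).toList = l := by
  induction l with
  | nil => rfl
  | cons a l ih => simp [ofList, toList, ih]

theorem ofList_injective : Function.Injective (ofList : List (Data F) → Data F) :=
  Function.LeftInverse.injective toList_ofList

theorem ofElts_injective : Function.Injective (ofElts : List F → Data F) :=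
  ofList_injective.comp (List.map_injective_iff.2 fun _ _ h => by injection h)

end Data

/-- Programs.  A program is a (randomised) function of one tree; `comp g f` is "first `f`, then `g`",
`ite c f g` branches on the value of `c`, and `fold f`, given the pair of a list and an initial state,
updates the state by `f` (applied to the pair of entry and state) once for every entry of the list.
`query` asks the oracle about the argument and `sample` draws a uniformly random field element. -/
inductive Prog where
  | id | nil | fst | snd
  | pair (f g : Prog)
  | comp (g f : Prog)
  | ite (c f g : Prog)
  | fold (f : Prog)
  | zero | one | add | neg | mul | inv | isZero
  | query
  | sample

/-- What an execution leaves behind: the output, the running time, the number of oracle queries. -/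
structure Outcome (F : Type*) where
  output : Data F
  time : ℕ
  queries : ℕ

namespace Prog

variable {F : Type*}

/-- Return `d` after `t` time units. -/
noncomputable def ret (d : Data F) (t : ℕ) : PMF (Outcome F) := PMF.pure ⟨d, t, 0⟩

/-- Run `μ`, then `k` on its output; running times and numbers of queries add up. -/
noncomputable def andThen (μ : PMF (Outcome F)) (k : Data F → PMF (Outcome F)) : PMF (Outcome F) :=
  μ.bind fun r => (k r.output).map fun s => ⟨s.output, r.time + s.time, r.queries + s.queries⟩

/-- Run `μ` with `t` additional time units. -/
noncomputable def charge (t : ℕ) (μ : PMF (Outcome F)) : PMF (Outcome F) :=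
  andThen (ret Data.nil t) fun _ => μ

noncomputable def foldRun (body : Data F → PMF (Outcome F)) :
    List (Data F) → Data F → PMF (Outcome F)
  | [], s => ret s 1
  | e :: l, s => charge 1 (andThen (body (Data.node e s)) (foldRun body l))

/-- The number of bits of a field element. -/
def fieldBits (F : Type*) [Fintype F] : ℕ := Nat.log 2 (Fintype.card F) + 1

/-- The law of the outcome of a program with oracle `O`.  Every elementary step costs one time unit,
a field operation costs the square of the bit length of a field element, and a query costs moreover
the length of the question in bits. -/
noncomputable def run [Field F] [Fintype F] (O : Data F → Data F) :
    Prog → Data F → PMF (Outcome F)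
  | id, x => ret x 1
  | nil, _ => ret Data.nil 1
  | fst, x => ret x.fst 1
  | snd, x => ret x.snd 1
  | pair f g, x => charge 1 (andThen (run O f x) fun a =>
      andThen (run O g x) fun b => ret (Data.node a b) 0)
  | comp g f, x => charge 1 (andThen (run O f x) (run O g))
  | ite c f g, x => charge 1 (andThen (run O c x) fun b =>
      if b.isNil then run O g x else run O f x)
  | fold f, x => charge 1 (foldRun (run O f) x.fst.toList x.snd)
  | zero, _ => ret (Data.elt 0) (fieldBits F ^ 2)
  | one, _ => ret (Data.elt 1) (fieldBits F ^ 2)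
  | add, x => ret (x.map₂ (· + ·)) (fieldBits F ^ 2)
  | neg, x => ret (x.map₁ (- ·)) (fieldBits F ^ 2)
  | mul, x => ret (x.map₂ (· * ·)) (fieldBits F ^ 2)
  | inv, x => ret (x.map₁ (·⁻¹)) (fieldBits F ^ 2)
  | isZero, x => ret x.isZero (fieldBits F ^ 2)
  | query, x => PMF.pure ⟨O x, 1 + x.size * fieldBits F, 1⟩
  | sample, _ => (PMF.uniformOfFintype F).map fun a => ⟨Data.elt a, fieldBits F ^ 2, 0⟩

end Prog

/-! ### Locally simulatable encodings -/

open Classical in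
/-- Oracle access to a message `f : S → F`, where the positions are written down by `encS`: the
question `encS s` is answered by `f s`, and every other question by `nil`. -/
noncomputable def messageOracle {F S : Type*} (encS : S → Data F) (f : S → F) : Data F → Data F :=
  fun x => if h : ∃ s, encS s = x then Data.elt (f h.choose) else Data.nil

theorem messageOracle_apply {F S : Type*} {encS : S → Data F} (hinj : Function.Injective encS)
    (f : S → F) (s : S) : messageOracle encS f (encS s) = Data.elt (f s) := by
  have h : ∃ s', encS s' = encS s := ⟨s, rfl⟩
  rw [messageOracle, dif_pos h, hinj h.choose_spec]

/-- The explicit input of a simulator: a description `desc` of the encoding, the query-answer set `T`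
and the new query `α`. -/
def simInput {F D : Type*} (desc : Data F) (encD : D → Data F) {n : ℕ} (T : Fin n → D × F) (α : D) :
    Data F :=
  Data.node desc (Data.node
    (Data.ofList (List.ofFn fun i => Data.node (encD (T i).1) (Data.elt (T i).2))) (encD α))

/-- The words that agree with the query-answer set `T`. -/
def agreeing {F D : Type*} {n : ℕ} (T : Fin n → D × F) : Set (D → F) :=
  {c | ∀ i, c (T i).1 = (T i).2}

/-- The program `P`, given the description `desc`, is a `(t, ℓ)`-local simulator for the randomised
encoding `ENC` with message space `M ⊆ F ^ S`: for every message and every input it runs in time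
`t n` and makes at most `ℓ n` queries, whatever its coins are, and its output is distributed
as a symbol of the codeword, conditioned on the symbols that are known already. -/
def IsLocalSimulator {F S D : Type*} [Field F] [Fintype F] (P : Prog) (desc : Data F)
    (encS : S → Data F) (encD : D → Data F) (M : Set (S → F)) (ENC : M → PMF (D → F))
    (t : ℕ → ℕ) (ℓ : ℕ → ℝ) : Prop :=
  ∀ (f : M) (n : ℕ) (T : Fin n → D × F) (α : D),
    (∀ r ∈ (P.run (messageOracle encS f.1) (simInput desc encD T α)).support,
      r.time ≤ t n ∧ (r.queries : ℝ) ≤ ℓ n) ∧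
    ∀ (h : ∃ c ∈ agreeing T, c ∈ (ENC f).support) (β : F),
      (P.run (messageOracle encS f.1) (simInput desc encD T α)).map Outcome.output (Data.elt β) =
        ((ENC f).filter (agreeing T) h).map (fun c => c α) β

/-! ### Points, sum codes, low-degree extensions -/

/-- The uniform distribution on a nonempty finite set. -/
noncomputable def uniformOn {α : Type*} [Finite α] (s : Set α) (hs : s.Nonempty) : PMF α :=
  PMF.uniformOfFinset s.toFinite.toFinset (by simpa using hs)

section Encodings

variable {F : Type*} {m : ℕ}

/-- The set of all vectors over `F` of length at most `m`; the vector of length `0` is `⊥`. -/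
abbrev PartialPoint (F : Type*) (m : ℕ) : Type _ := Σ k : Fin (m + 1), (Fin k → F)

/-- The product set `A₁ × ⋯ × Aₘ`. -/
abbrev Points (A : Fin m → Finset F) : Type _ := {a : Fin m → F // a ∈ Fintype.piFinset A}

/-- The prefixes of points of `A₁ × ⋯ × Aₘ`, of all lengths from `0` to `m`. -/
abbrev Prefixes (A : Fin m → Finset F) : Type _ :=
  {x : PartialPoint F m // ∀ i : Fin x.1, x.2 i ∈ A (i.castLE x.1.is_le)}

/-- The subcube `{x} × A_{k+1} × ⋯ × Aₘ` of a vector `x` of length `k`. -/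
def subcube (A : Fin m → Finset F) (x : PartialPoint F m) : Finset (Fin m → F) :=
  Fintype.piFinset fun i => if h : (i : ℕ) < x.1 then {x.2 ⟨i, h⟩} else A i

/-- The word `Σ_A[w]` of all sums of `w` over subcubes, for `w : F ^ m → F`. -/
def sumWord [AddCommMonoid F] (A : Fin m → Finset F) (w : (Fin m → F) → F) : PartialPoint F m → F :=
  fun x => ∑ z ∈ subcube A x, w z

open Classical in
/-- The word `Σ[w]` of all sums of `w` over subcubes, for `w : A₁ × ⋯ × Aₘ → F`. -/
noncomputable def sumWordOn [AddCommMonoid F] (A : Fin m → Finset F) (w : Points A → F) :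
    Prefixes A → F :=
  fun x => ∑ z : Points A with z.1 ∈ subcube A x.1, w z

/-- The sum code of the code of all functions on `A₁ × ⋯ × Aₘ`. -/
abbrev SumCode [AddCommMonoid F] (A : Fin m → Finset F) : Type _ :=
  {c : Prefixes A → F // ∃ w, sumWordOn A w = c}

/-- The set of all extensions of `f` to a polynomial of degree at most `d i` in the `i`-th variable. -/
def LD [CommSemiring F] (A : Fin m → Finset F) (d : Fin m → ℕ) (f : Points A → F) :
    Set (MvPolynomial (Fin m) F) :=
  {p | (∀ i, p.degreeOf i ≤ d i) ∧ ∀ a : Points A, MvPolynomial.eval a.1 p = f a}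

theorem degreeOf_toMvPolynomial_le [CommSemiring F] (i j : Fin m) (p : Polynomial F) :
    (p.toMvPolynomial i).degreeOf j ≤ if i = j then p.natDegree else 0 := by
  rw [p.as_sum_range_C_mul_X_pow, map_sum]
  refine (MvPolynomial.degreeOf_sum_le _ _ _).trans (Finset.sup_le fun k hk => ?_)
  rw [map_mul, map_pow, Polynomial.toMvPolynomial_C, Polynomial.toMvPolynomial_X,
    ← p.as_sum_range_C_mul_X_pow]
  refine (MvPolynomial.degreeOf_C_mul_le _ _ _).trans ?_
  split_ifs with h
  · subst h
    refine (MvPolynomial.degreeOf_pow_le _ _ _).trans ?_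
    have h1 : (MvPolynomial.X i : MvPolynomial (Fin m) F).degreeOf i ≤ 1 := by
      rcases subsingleton_or_nontrivial F with hF | hF
      · rw [Subsingleton.elim (MvPolynomial.X i : MvPolynomial (Fin m) F) 0]; simp
      · simp
    have h2 := Finset.mem_range.1 hk
    nlinarith
  · rw [MvPolynomial.degreeOf_X_pow_of_ne _ (Ne.symm h)]

theorem LD_nonempty [Field F] (A : Fin m → Finset F) (d : Fin m → ℕ)
    (hd : ∀ i, (A i).card - 1 ≤ d i) (f : Points A → F) : (LD A d f).Nonempty := by
  classical
  have hmem : ∀ (w : Points A) i, w.1 i ∈ A i := fun w => Fintype.mem_piFinset.1 w.2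
  refine ⟨∑ w : Points A, MvPolynomial.C (f w) *
    ∏ i, (Lagrange.basis (A i) _root_.id (w.1 i)).toMvPolynomial i, fun j => ?_, fun a => ?_⟩
  · refine (MvPolynomial.degreeOf_sum_le _ _ _).trans (Finset.sup_le fun w _ => ?_)
    refine (MvPolynomial.degreeOf_C_mul_le _ _ _).trans ?_
    refine (MvPolynomial.degreeOf_prod_le _ _ _).trans ?_
    refine (Finset.sum_le_sum fun i _ => degreeOf_toMvPolynomial_le i j _).trans ?_
    rw [Finset.sum_ite_eq' Finset.univ j]
    simp only [Finset.mem_univ, if_true]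
    rw [Lagrange.natDegree_basis (Function.injective_id.injOn) (hmem w j)]
    exact hd j
  · simp only [map_sum, map_mul, MvPolynomial.eval_C, map_prod, MvPolynomial.eval_toMvPolynomial]
    rw [Finset.sum_eq_single a]
    · have : ∀ i, Polynomial.eval (a.1 i) (Lagrange.basis (A i) _root_.id (a.1 i)) = 1 := fun i =>
        Lagrange.eval_basis_self (v := _root_.id) (Function.injective_id.injOn) (hmem a i)
      simp [this]
    · intro w _ hw
      obtain ⟨i, hi⟩ : ∃ i, w.1 i ≠ a.1 i := by
        by_contra! h
        exact hw (Subtype.ext (funext h))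
      rw [Finset.prod_eq_zero (Finset.mem_univ i), mul_zero]
      exact Lagrange.eval_basis_of_ne (v := _root_.id) hi (hmem a i)
    · simp

/-! ### The encodings -/

/-- The random-extension encoding: `Σ[w]` is mapped to a uniformly random element of
`{Σ_A[p] : p ∈ LD[w]}`. -/
noncomputable def encSigmaRM [Field F] [Fintype F] (A : Fin m → Finset F) (d : Fin m → ℕ)
    (hd : ∀ i, (A i).card - 1 ≤ d i) (c : SumCode A) : PMF (PartialPoint F m → F) :=
  uniformOn {u | ∃ w, sumWordOn A w = c.1 ∧
      ∃ p ∈ LD A d w, u = sumWord A fun z => MvPolynomial.eval z p} <| by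
    obtain ⟨w, hw⟩ := c.2
    obtain ⟨p, hp⟩ := LD_nonempty A d hd w
    exact ⟨_, w, hw, p, hp, rfl⟩

/-- The functions on `A₁ × ⋯ × Aₘ` with `w (a₁, …, aₘ) = - w (aₘ, …, a₁)`. -/
def AntiSym [AddCommGroup F] (A : Fin m → Finset F) : Set (Points A → F) :=
  {w | ∀ x y : Points A, (∀ i, y.1 i = x.1 i.rev) → w x + w y = 0}

/-- The positions of a message: the points of `A₁ × ⋯ × Aₘ`, and `⊥` (which is `none`). -/
abbrev MessagePos (A : Fin m → Finset F) : Type _ := Option (Points A)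

/-- The messages: functions on `A₁ × ⋯ × Aₘ`, together with their total sum in position `⊥`. -/
def messages [AddCommMonoid F] (A : Fin m → Finset F) : Set (MessagePos A → F) :=
  {f | f none = ∑ a : Points A, f (some a)}

/-- The encoding `f ↦ Σ[f + g]` for a uniformly random antisymmetric `g`. -/
noncomputable def encSigmaAntiSym [Field F] [Fintype F] (A : Fin m → Finset F) (f : messages A) :
    PMF (SumCode A) :=
  (uniformOn (AntiSym A) ⟨0, fun _ _ _ => by simp⟩).map fun g =>
    ⟨sumWordOn A fun a => f.1 (some a) + g a, _, rfl⟩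

/-- The composed encoding, with independent randomness for the two encodings. -/
noncomputable def encPCP [Field F] [Fintype F] (A : Fin m → Finset F) (d : Fin m → ℕ)
    (hd : ∀ i, 2 * ((A i).card - 1) ≤ d i) (f : messages A) : PMF (PartialPoint F m → F) :=
  (encSigmaAntiSym A f).bind (encSigmaRM A d fun i => by have := hd i; omega)

/-! ### How inputs are written down, and the bounds -/

def encodePartialPoint (x : PartialPoint F m) : Data F := Data.ofElts (List.ofFn x.2)

/-- A point is written as the list of its coordinates, and `⊥` as the empty list. -/
def encodeMessagePos (A : Fin m → Finset F) : MessagePos A → Data F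
  | none => Data.ofElts []
  | some a => Data.ofElts (List.ofFn a.1)

theorem encodeMessagePos_injective (hm : 0 < m) (A : Fin m → Finset F) :
    Function.Injective (encodeMessagePos A) := by
  have hne : ∀ a : Points A, List.ofFn a.1 ≠ [] := fun a h => by
    have := congrArg List.length h
    simp at this
    omega
  rintro (_ | a) (_ | b) h
  · rfl
  · exact absurd (Data.ofElts_injective h).symm (hne b)
  · exact absurd (Data.ofElts_injective h) (hne a)
  · exact congrArg some (Subtype.ext (List.ofFn_injective (Data.ofElts_injective h)))

/-- The description of the parameters: the list, over the coordinates, of the pairs of (a list of the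
elements of) `A i` and (in unary) the degree `d i`. -/
def encodeParams (L : Fin m → List F) (d : Fin m → ℕ) : Data F :=
  Data.ofList (List.ofFn fun i => Data.node (Data.ofElts (L i)) (Data.ofNat (d i)))

/-- The largest of the cardinalities of the sets `A i`. -/
def maxCard (A : Fin m → Finset F) : ℕ := Finset.univ.sup fun i => (A i).card

/-- `ℓ_ΣRM(x) = x m (m (a + 1) + 1)²` with `a = max |A i|`. -/
def ellSigmaRM (A : Fin m → Finset F) (x : ℝ) : ℝ :=
  x * m * (m * ((maxCard A : ℝ) + 1) + 1) ^ 2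

/-- `ℓ_AntiSym(x) = x² m² + 1 + C x⁴ m⁴ / |A₁ × ⋯ × Aₘ|`. -/
noncomputable def ellAntiSym (C : ℝ) (A : Fin m → Finset F) (x : ℝ) : ℝ :=
  x ^ 2 * m ^ 2 + 1 + C * (x ^ 4 * m ^ 4 / (∏ i, (A i).card : ℕ))

end Encodings

/-! Consider the `n + 2` points `⊥`, `α` and those of `T`. Coefficients `c` on these points give a
functional `Λ p = ∑ c_j Σ_A[p](Z_j)` on low-degree functions; they form a relation if `Λ` vanishes
on every low-degree `p` that is antisymmetric on the product set. Only relations with coefficient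
`0` at `⊥` are used to determine the symbol at `α`.

If none of these involves `α`, then by duality (`exists_antiLowDeg`) some antisymmetric low-degree
function has a word that is `1` at `α` and `0` on `T`. The law of the encoding is invariant under
adding multiples of this word (`encPCP_add`), so the conditioned symbol is uniform, and one random
field element is a correct answer.

Otherwise normalise `c_α = 1`. Every word in the support comes from some `p` equal to `f + g` on the
product set with `g` antisymmetric, and then `Λ p = ∑ f(a) φ(a)` with `φ(a) = Λ (lagFun A a)`
(`Conditions.apply_add`). This determines the symbol. The sum is long, but `φ` is constant up to few
points. By `card_nonfreePrefixes_le` at most `n + 2` prefixes of each length leave `φ` undetermined;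
this is where the degree `2(|A_i| - 1)` is needed. As `φ` is invariant under reversal, a free first
half can be glued to a free second half, which forces one common value (`exists_const`). With this
constant `c₀` the sum is `c₀ f(⊥) + ∑ (φ(a) - c₀) f(a)`, and only the few `a` with `φ(a) ≠ c₀` and
`⊥` need to be asked. The number of questions is so small that the constant in the `O(·)` can be `0`
(`queries_le`).

It remains to compute all this in polynomial time. The conditions on a relation are exponentially
many, but each is a product of one factor per coordinate; adding one coordinate at a time and
dropping redundant rows keeps at most `2N + 1` of them, for `N` points (`dot_products_ofFn`). The
same device tells whether a partial point extends to a point of nonzero weight, so the exceptional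
points are enumerated with pruning (`enum_spec`). The constant is found by trying the values of `φ`
at more than the permitted number of points, or at all of them (`search_ne_nil`). The program is
assembled from closure properties of `Comp`, a notion of polynomial-time computability that is
uniform over a family of inputs. -/

/-! ### Polynomial-time computability of families of functions -/

namespace PolyComp

universe u v w w'

/-- A field, an oracle and a bound `B` in terms of which running times are measured. -/
structure Setting where
  F : Type u
  [field : Field F]
  [fintype : Fintype F]
  O : Data F → Data F
  B : ℕ
  le_B : 16 ≤ B
  bits_le : Prog.fieldBits F ^ 2 ≤ B

attribute [instance] Setting.field Setting.fintype

theorem Setting.pow_mono (S : Setting.{u}) {k l : ℕ} (h : k ≤ l) : S.B ^ k ≤ S.B ^ l :=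
  Nat.pow_le_pow_right (by have := S.le_B; omega) h

theorem Setting.mul_pow_le (S : Setting.{u}) (k : ℕ) : 16 * S.B ^ k ≤ S.B ^ (k + 1) := by
  rw [pow_succ, mul_comm]
  exact Nat.mul_le_mul_left _ S.le_B

/-- The ways in which mathematical objects are written down as data. -/
class Enc (F : Type u) (α : Type v) where
  enc : α → Data F

open Enc (enc)

section EncInstances

variable {F : Type u}

instance : Enc F F := ⟨Data.elt⟩
instance : Enc F ℕ := ⟨Data.ofNat⟩
instance {α : Type v} [Enc F α] : Enc F (List α) := ⟨fun l => Data.ofList (l.map enc)⟩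
instance {α : Type v} {β : Type w} [Enc F α] [Enc F β] : Enc F (α × β) :=
  ⟨fun p => Data.node (enc p.1) (enc p.2)⟩
instance {α : Type v} {n : ℕ} [Enc F α] : Enc F (Fin n → α) := ⟨fun x => enc (List.ofFn x)⟩
instance : Enc F PUnit.{v + 1} := ⟨fun _ => Data.nil⟩
open Classical in
noncomputable instance : Enc F Prop := ⟨fun p => Data.ofProp p⟩

end EncInstances

/-- The program `P` computes `y` from `x` in time `t`, deterministically and without queries. -/
def Runs (S : Setting.{u}) (P : Prog) (x y : Data S.F) (t : ℕ) : Prop :=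
  ∃ t' ≤ t, P.run S.O x = PMF.pure ⟨y, t', 0⟩

theorem Runs.mono {S : Setting.{u}} {P : Prog} {x y : Data S.F} {t t' : ℕ} (h : Runs S P x y t)
    (ht : t ≤ t') : Runs S P x y t' :=
  let ⟨s, hs, h⟩ := h
  ⟨s, hs.trans ht, h⟩

theorem andThen_pure {F : Type u} (y : Data F) (t q : ℕ) (k : Data F → PMF (Outcome F)) :
    Prog.andThen (PMF.pure ⟨y, t, q⟩) k =
      (k y).map fun s => ⟨s.output, t + s.time, q + s.queries⟩ := by
  rw [Prog.andThen, PMF.pure_bind]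

theorem charge_eq {F : Type u} (t : ℕ) (μ : PMF (Outcome F)) :
    Prog.charge t μ = μ.map fun s => ⟨s.output, t + s.time, s.queries⟩ := by
  rw [Prog.charge, Prog.ret, andThen_pure]
  simp

theorem Runs.pair {S : Setting.{u}} {P Q : Prog} {x y z : Data S.F} {s t : ℕ}
    (hP : Runs S P x y s) (hQ : Runs S Q x z t) :
    Runs S (.pair P Q) x (.node y z) (1 + s + t) := by
  obtain ⟨s', hs, hP⟩ := hP
  obtain ⟨t', ht, hQ⟩ := hQ
  refine ⟨1 + (s' + (t' + 0)), by omega, ?_⟩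
  simp [Prog.run, hP, hQ, andThen_pure, charge_eq, Prog.ret, PMF.pure_map]

theorem Runs.comp {S : Setting.{u}} {P Q : Prog} {x y z : Data S.F} {s t : ℕ}
    (hP : Runs S P x y s) (hQ : Runs S Q y z t) : Runs S (.comp Q P) x z (1 + s + t) := by
  obtain ⟨s', hs, hP⟩ := hP
  obtain ⟨t', ht, hQ⟩ := hQ
  refine ⟨1 + (s' + t'), by omega, ?_⟩
  simp [Prog.run, hP, hQ, andThen_pure, charge_eq, PMF.pure_map]

theorem Runs.ite {S : Setting.{u}} {C P Q : Prog} {x b y : Data S.F} {s t : ℕ}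
    (hC : Runs S C x b s) (hP : b.isNil = false → Runs S P x y t)
    (hQ : b.isNil = true → Runs S Q x y t) : Runs S (.ite C P Q) x y (1 + s + t) := by
  obtain ⟨s', hs, hC⟩ := hC
  cases hb : b.isNil
  · obtain ⟨t', ht, hP⟩ := hP hb
    refine ⟨1 + (s' + t'), by omega, ?_⟩
    simp [Prog.run, hC, hP, andThen_pure, charge_eq, PMF.pure_map, hb]
  · obtain ⟨t', ht, hQ⟩ := hQ hb
    refine ⟨1 + (s' + t'), by omega, ?_⟩
    simp [Prog.run, hC, hQ, andThen_pure, charge_eq, PMF.pure_map, hb]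

/-- The sequence of states is prescribed in advance, and each round makes the same number `q` of
queries: `q = 0` serves pure computations, `q = 1` the loop that asks the oracle. -/
theorem foldRun_pure {F : Type u} {body : Data F → PMF (Outcome F)} {t q : ℕ} :
    ∀ (l : List (Data F)) (st : ℕ → Data F),
      (∀ k (hk : k < l.length), ∃ t' ≤ t, body (.node l[k] (st k)) = PMF.pure ⟨st (k + 1), t', q⟩) →
      ∃ t' ≤ l.length * (t + 1) + 1,
        Prog.foldRun body l (st 0) = PMF.pure ⟨st l.length, t', q * l.length⟩
  | [], st, _ => ⟨1, by simp, by simp [Prog.foldRun, Prog.ret]⟩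
  | e :: l, st, h => by
    obtain ⟨s, hs, h0⟩ := h 0 (by simp)
    obtain ⟨s', hs', h1⟩ := foldRun_pure l (fun k => st (k + 1))
      fun k hk => h (k + 1) (by simpa using hk)
    refine ⟨1 + (s + s'), ?_, ?_⟩
    · simp only [List.length_cons]; linarith
    · simp only [List.getElem_cons_zero] at h0
      simp only [zero_add] at h1
      have hq : q * (l.length + 1) = q + q * l.length := by ring
      simp [Prog.foldRun, h0, h1, andThen_pure, charge_eq, PMF.pure_map, hq]

theorem Runs.fold {S : Setting.{u}} {P : Prog} {l : List (Data S.F)} {st : ℕ → Data S.F} {t : ℕ}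
    (h : ∀ k (hk : k < l.length), Runs S P (.node l[k] (st k)) (st (k + 1)) t) :
    Runs S (.fold P) (.node (.ofList l) (st 0)) (st l.length) (l.length * (t + 1) + 2) := by
  obtain ⟨s, hs, h⟩ := foldRun_pure (q := 0) l st h
  refine ⟨1 + s, by omega, ?_⟩
  simp [Prog.run, Data.fst, Data.snd, Data.toList_ofList, h, charge_eq, PMF.pure_map]

/-- A quantity that is bounded by a fixed power of `B`. -/
def PolyBdd {J : Type w} (S : J → Setting.{u}) (g : J → ℕ) : Prop := ∃ k, ∀ j, g j ≤ (S j).B ^ k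

/-- Some program computes `y j` from `x j` for all `j`, in time bounded by a fixed power of `B`. -/
def Comp {J : Type w} (S : J → Setting.{u}) {α : J → Type v} {β : J → Type w'}
    [∀ j, Enc (S j).F (α j)] [∀ j, Enc (S j).F (β j)] (x : ∀ j, α j) (y : ∀ j, β j) : Prop :=
  ∃ (P : Prog) (k : ℕ), ∀ j, Runs (S j) P (enc (x j)) (enc (y j)) ((S j).B ^ k)

section PolyBdd

variable {J : Type w} {S : J → Setting.{u}}

theorem PolyBdd.mono {f g : J → ℕ} (hg : PolyBdd S g) (h : ∀ j, f j ≤ g j) : PolyBdd S f :=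
  let ⟨k, hk⟩ := hg
  ⟨k, fun j => (h j).trans (hk j)⟩

theorem PolyBdd.const (n : ℕ) : PolyBdd S fun _ => n :=
  ⟨n, fun j => (Nat.lt_pow_self (by have := (S j).le_B; omega)).le⟩

theorem PolyBdd.mul {f g : J → ℕ} (hf : PolyBdd S f) (hg : PolyBdd S g) :
    PolyBdd S fun j => f j * g j := by
  obtain ⟨k, hk⟩ := hf
  obtain ⟨l, hl⟩ := hg
  exact ⟨k + l, fun j => by rw [pow_add]; exact Nat.mul_le_mul (hk j) (hl j)⟩

theorem PolyBdd.add {f g : J → ℕ} (hf : PolyBdd S f) (hg : PolyBdd S g) :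
    PolyBdd S fun j => f j + g j := by
  obtain ⟨k, hk⟩ := hf
  obtain ⟨l, hl⟩ := hg
  refine ⟨k + l + 1, fun j => ?_⟩
  have h1 := (S j).mul_pow_le (k + l)
  have h2 := (hk j).trans ((S j).pow_mono (Nat.le_add_right k l))
  have h3 := (hl j).trans ((S j).pow_mono (Nat.le_add_left l k))
  show f j + g j ≤ _
  omega

theorem PolyBdd.reindex {I : Type*} {f : J → ℕ} (hf : PolyBdd S f) (π : I → J) :
    PolyBdd (fun i => S (π i)) fun i => f (π i) :=
  let ⟨k, hk⟩ := hf
  ⟨k, fun i => hk (π i)⟩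

theorem PolyBdd.listSum {f : J → List ℕ} {b : J → ℕ}
    (h : PolyBdd S fun j => (f j).length) (hb : PolyBdd S b) (hf : ∀ j, ∀ x ∈ f j, x ≤ b j) :
    PolyBdd S fun j => (f j).sum :=
  (h.mul hb).mono fun j => by simpa using List.sum_le_card_nsmul (f j) (b j) (hf j)

end PolyBdd

/-! ### Closure properties of uniform polynomial-time computability -/

namespace Comp

variable {J : Type w} {S : J → Setting.{u}}
  {α β γ δ : J → Type*} [∀ j, Enc (S j).F (α j)] [∀ j, Enc (S j).F (β j)]
  [∀ j, Enc (S j).F (γ j)] [∀ j, Enc (S j).F (δ j)]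
  {x : ∀ j, α j} {y : ∀ j, β j} {z : ∀ j, γ j}

/-- Only encodings matter, so objects that are written down alike can be exchanged at no cost: a
vector and its list, a number and a list of units, a cons cell and a pair. -/
theorem congr_enc (h : Comp S x y) (hz : ∀ j, (enc (z j) : Data (S j).F) = enc (y j)) :
    Comp S x z := by
  obtain ⟨P, k, h⟩ := h
  exact ⟨P, k, fun j => hz j ▸ h j⟩

theorem congr {y' : ∀ j, β j} (h : Comp S x y) (hz : ∀ j, y' j = y j) : Comp S x y' :=
  h.congr_enc fun j => by rw [hz j]

theorem reindex {I : Type*} (h : Comp S x y) (π : I → J) :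
    Comp (fun i => S (π i)) (fun i => x (π i)) (fun i => y (π i)) :=
  let ⟨P, k, h⟩ := h
  ⟨P, k, fun i => h (π i)⟩

theorem of_runs {t : J → ℕ} (P : Prog) (ht : PolyBdd S t)
    (h : ∀ j, Runs (S j) P (enc (x j)) (enc (y j)) (t j)) : Comp S x y :=
  let ⟨k, hk⟩ := ht
  ⟨P, k, fun j => (h j).mono (hk j)⟩

theorem of_le_B (P : Prog)
    (h : ∀ j, Runs (S j) P (enc (x j)) (enc (y j)) (S j).B) : Comp S x y :=
  ⟨P, 1, fun j => by simpa using h j⟩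

theorem refl : Comp S x x :=
  of_le_B .id fun j => ⟨1, by have := (S j).le_B; omega, rfl⟩

theorem trans (h1 : Comp S x y) (h2 : Comp S y z) : Comp S x z := by
  obtain ⟨P, k, hP⟩ := h1
  obtain ⟨Q, l, hQ⟩ := h2
  exact of_runs (.comp Q P)
    (((PolyBdd.const 1).add (g := fun j => (S j).B ^ k) ⟨k, fun _ => le_rfl⟩).add
      (g := fun j => (S j).B ^ l) ⟨l, fun _ => le_rfl⟩) fun j => (hP j).comp (hQ j)

theorem pair (h1 : Comp S x y) (h2 : Comp S x z) : Comp S x fun j => (y j, z j) := by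
  obtain ⟨P, k, hP⟩ := h1
  obtain ⟨Q, l, hQ⟩ := h2
  exact of_runs (.pair P Q)
    (((PolyBdd.const 1).add (g := fun j => (S j).B ^ k) ⟨k, fun _ => le_rfl⟩).add
      (g := fun j => (S j).B ^ l) ⟨l, fun _ => le_rfl⟩) fun j => (hP j).pair (hQ j)

theorem fst {y : ∀ j, β j × γ j} (h : Comp S x y) : Comp S x fun j => (y j).1 :=
  h.trans (of_le_B .fst fun j => ⟨1, by have := (S j).le_B; omega, rfl⟩)

theorem snd {y : ∀ j, β j × γ j} (h : Comp S x y) : Comp S x fun j => (y j).2 :=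
  h.trans (of_le_B .snd fun j => ⟨1, by have := (S j).le_B; omega, rfl⟩)

/-- A computation remains possible when the input is the second component of a pair. -/
theorem lift {I : Type*} {π : I → J} {ε : I → Type*} [∀ i, Enc (S (π i)).F (ε i)]
    {e : ∀ i, ε i} (h : Comp S x y) :
    Comp (fun i => S (π i)) (fun i => (e i, x (π i))) (fun i => y (π i)) :=
  (refl (x := fun i => (e i, x (π i)))).snd.trans (h.reindex π)

theorem nil_data (hy : ∀ j, (enc (y j) : Data (S j).F) = .nil) : Comp S x y :=
  of_le_B .nil fun j => ⟨1, by have := (S j).le_B; omega, by rw [hy]; rfl⟩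

theorem unit : Comp S x fun _ => PUnit.unit.{1} := nil_data fun _ => rfl

theorem nil : Comp S x fun j => ([] : List (β j)) := nil_data fun _ => rfl

theorem cons {z : ∀ j, List (β j)} (h1 : Comp S x y) (h2 : Comp S x z) :
    Comp S x fun j => y j :: z j :=
  (h1.pair h2).congr_enc fun _ => rfl

theorem singleton (h1 : Comp S x y) : Comp S x fun j => [y j] := h1.cons nil

theorem zero_nat : Comp S x fun _ => 0 := nil_data fun _ => rfl

theorem succ {k : J → ℕ} (h : Comp S x k) : Comp S x fun j => k j + 1 :=
  (unit.pair h).congr_enc fun _ => rfl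

theorem elt_op {f : ∀ j, (S j).F} (P : Prog)
    (hP : ∀ j, P.run (S j).O (enc (x j)) =
      PMF.pure ⟨.elt (f j), Prog.fieldBits (S j).F ^ 2, 0⟩) : Comp S x f :=
  of_le_B P fun j => ⟨_, (S j).bits_le, hP j⟩

theorem zero : Comp S x fun j => (0 : (S j).F) := elt_op .zero fun _ => rfl

theorem one : Comp S x fun j => (1 : (S j).F) := elt_op .one fun _ => rfl

variable {f g : ∀ j, (S j).F}

theorem add (hf : Comp S x f) (hg : Comp S x g) : Comp S x fun j => f j + g j :=
  (hf.pair hg).trans (elt_op .add fun _ => rfl)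

theorem mul (hf : Comp S x f) (hg : Comp S x g) : Comp S x fun j => f j * g j :=
  (hf.pair hg).trans (elt_op .mul fun _ => rfl)

theorem neg (hf : Comp S x f) : Comp S x fun j => - f j := hf.trans (elt_op .neg fun _ => rfl)

theorem inv (hf : Comp S x f) : Comp S x fun j => (f j)⁻¹ := hf.trans (elt_op .inv fun _ => rfl)

theorem sub (hf : Comp S x f) (hg : Comp S x g) : Comp S x fun j => f j - g j :=
  (hf.add hg.neg).congr fun _ => sub_eq_add_neg _ _

theorem div (hf : Comp S x f) (hg : Comp S x g) : Comp S x fun j => f j / g j :=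
  (hf.mul hg.inv).congr fun _ => div_eq_mul_inv _ _

theorem eq_zero (hf : Comp S x f) : Comp S x fun j => f j = 0 :=
  hf.trans (of_le_B .isZero fun j => ⟨_, (S j).bits_le, rfl⟩)

/-- Each branch is a family over a subtype, so its computation may rely on the case it is in. -/
theorem cond {p : J → Prop} (hp : Comp S x p)
    (h1 : Comp (fun j : {j // p j} => S j) (fun j => x j) (fun j => y j))
    (h2 : Comp (fun j : {j // ¬ p j} => S j) (fun j => x j) (fun j => y j)) : Comp S x y := by
  obtain ⟨C, k, hC⟩ := hp
  obtain ⟨P, l, hP⟩ := h1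
  obtain ⟨Q, l', hQ⟩ := h2
  refine of_runs (.ite C P Q) (t := fun j => 1 + (S j).B ^ k + ((S j).B ^ (l + l')))
    (((PolyBdd.const 1).add (g := fun j => (S j).B ^ k) ⟨k, fun _ => le_rfl⟩).add
      (g := fun j => (S j).B ^ (l + l')) ⟨l + l', fun _ => le_rfl⟩) fun j => ?_
  refine (hC j).ite (fun h => ?_) (fun h => ?_)
  · have hpj : p j := by
      by_contra hpj
      simp [enc, Data.ofProp, hpj, Data.isNil] at h
    exact (hP ⟨j, hpj⟩).mono ((S j).pow_mono (Nat.le_add_right _ _))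
  · have hpj : ¬ p j := fun hpj => by
      simp [enc, Data.ofProp, hpj, Data.isNil] at h
    exact (hQ ⟨j, hpj⟩).mono ((S j).pow_mono (Nat.le_add_left _ _))

theorem ite {p : J → Prop} [∀ j, Decidable (p j)] {y' : ∀ j, β j} (hp : Comp S x p)
    (h1 : Comp S x y) (h2 : Comp S x y') : Comp S x fun j => if p j then y j else y' j :=
  cond hp ((h1.reindex Subtype.val).congr fun j => if_pos j.2)
    ((h2.reindex Subtype.val).congr fun j => if_neg j.2)

theorem prop_true : Comp S x fun _ => True :=
  (unit.pair unit).congr_enc (fun _ => by simp [enc, Data.ofProp])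

theorem prop_false : Comp S x fun _ => False := nil_data fun _ => by simp [enc, Data.ofProp]

theorem not {p : J → Prop} (hp : Comp S x p) : Comp S x fun j => ¬ p j :=
  cond hp (prop_false.congr fun j => by simp [j.2]) (prop_true.congr fun j => by simp [j.2])

/-- The length of a list does not matter for telling whether it is empty. -/
theorem eq_nil {l : ∀ j, List (β j)} (hl : Comp S x l) : Comp S x fun j => l j = [] := by
  obtain ⟨P, k, hP⟩ := hl.trans refl
  obtain ⟨Q, q, hQ⟩ := prop_true (S := S) (x := x)
  obtain ⟨R, r, hR⟩ := prop_false (S := S) (x := x)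
  refine of_runs (.ite P R Q) (t := fun j => 1 + (S j).B ^ k + ((S j).B ^ (q + r)))
    (((PolyBdd.const 1).add (g := fun j => (S j).B ^ k) ⟨k, fun _ => le_rfl⟩).add
      (g := fun j => (S j).B ^ (q + r)) ⟨q + r, fun _ => le_rfl⟩) fun j => ?_
  refine (hP j).ite (fun h => ?_) (fun h => ?_)
  · have : (l j = []) = False := by
      simp only [eq_iff_iff, iff_false]
      intro hl
      simp [enc, hl, Data.ofList, Data.isNil] at h
    rw [this]
    exact (hR j).mono ((S j).pow_mono (Nat.le_add_left _ _))
  · have : (l j = []) = True := by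
      simp only [eq_iff_iff, iff_true]
      rcases hl : l j with _ | ⟨a, t⟩
      · rfl
      · simp [enc, hl, Data.ofList, Data.isNil] at h
    rw [this]
    exact (hQ j).mono ((S j).pow_mono (Nat.le_add_right _ _))

theorem head {l : ∀ j, List (β j)} (hl : Comp S x l) (h : ∀ j, ∃ t, l j = y j :: t) :
    Comp S x y := by
  choose t ht using h
  exact ((hl.congr (y' := fun j => y j :: t j) fun j => (ht j).symm).congr_enc
    (z := fun j => (y j, t j)) fun _ => rfl).fst

theorem tail {l : ∀ j, List (β j)} (hl : Comp S x l) : Comp S x fun j => (l j).tail := by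
  refine cond hl.eq_nil (nil.congr fun j => by simp [j.2]) ?_
  have h : ∀ j : {j // ¬ l j = []}, ∃ a, l j = a :: (l j).tail := fun j =>
    ⟨(l j).head j.2, (List.cons_head_tail j.2).symm⟩
  choose a ha using h
  exact (((hl.reindex Subtype.val).congr (y' := fun j => a j :: (l j).tail)
    fun j => (ha j).symm).congr_enc (z := fun j => (a j, (l j).tail)) fun _ => rfl).snd

/-- Loops: the state after `k` steps is `st j k`. -/
theorem iterate {ε σ : J → Type*} [∀ j, Enc (S j).F (ε j)] [∀ j, Enc (S j).F (σ j)]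
    {l : ∀ j, List (ε j)} {s : ∀ j, σ j} (st : ∀ j, ℕ → σ j) (hl : Comp S x l) (hs : Comp S x s)
    (hlen : PolyBdd S fun j => (l j).length) (h0 : ∀ j, st j 0 = s j)
    (hstep : Comp (fun p : Σ j, Fin (l j).length => S p.1)
      (fun p => ((l p.1)[p.2], x p.1, st p.1 p.2)) (fun p => st p.1 (p.2 + 1))) :
    Comp S x fun j => st j (l j).length := by
  -- The body of a fold sees only the entry and the state; the state is therefore paired with the
  -- input `x`, which is handed on unchanged.
  obtain ⟨P, k, hP⟩ := ((refl (S := fun p : Σ j, Fin (l j).length => S p.1)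
    (x := fun p : Σ j, Fin (l j).length => ((l p.1)[p.2], x p.1, st p.1 p.2))).snd.fst).pair hstep
  have hfold : Comp S (fun j => (l j, x j, s j)) (fun j => (x j, st j (l j).length)) := by
    refine of_runs (.fold P) (t := fun j => (l j).length * ((S j).B ^ k + 1) + 2)
      ((hlen.mul (PolyBdd.add (f := fun j => (S j).B ^ k) ⟨k, fun _ => le_rfl⟩ (.const 1))).add
        (.const 2)) fun j => ?_
    have := Runs.fold (S := S j) (P := P) (l := (l j).map enc)
      (st := fun k => enc (x j, st j k)) (t := (S j).B ^ k) fun i hi => by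
        have := hP ⟨j, ⟨i, by simpa using hi⟩⟩
        simpa [enc] using this
    rw [h0 j] at this
    simpa [enc] using this
  exact ((hl.pair (refl.pair hs)).trans hfold).snd

/-! ### Lists and unary numbers -/

section Lists

variable {ε : J → Type*} [∀ j, Enc (S j).F (ε j)]

theorem take_succ_fin {ε : Type*} (l : List ε) (k : Fin l.length) :
    l.take (k + 1) = l.take k ++ [l[k]] := by
  rw [Fin.getElem_fin, List.take_append_getElem]

theorem reverse {l : ∀ j, List (ε j)} (hl : Comp S x l)
    (hlen : PolyBdd S fun j => (l j).length) : Comp S x fun j => (l j).reverse := by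
  refine (iterate (fun j k => ((l j).take k).reverse) hl nil hlen (fun _ => by simp) ?_).congr
    fun j => by simp
  refine (refl.fst.cons refl.snd.snd).congr fun p => ?_
  simp only [take_succ_fin, List.reverse_append, List.reverse_singleton, List.singleton_append]

/-- Vectors may be computed entry by entry. -/
theorem ofFn {n : J → ℕ} {v : ∀ j, Fin (n j) → ε j} {y : ∀ j, Fin (n j) → β j}
    (hv : Comp S x v) (hn : PolyBdd S n)
    (h : Comp (fun p : Σ j, Fin (n j) => S p.1) (fun p => (v p.1 p.2, x p.1))
      (fun p => y p.1 p.2)) : Comp S x y := by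
  have hl : Comp S x fun j => List.ofFn (v j) := hv.congr_enc fun _ => rfl
  -- Entries are added at the front one by one, so the loop yields the reversed vector.
  have h1 : Comp S x fun j => (List.ofFn (y j)).reverse := by
    refine (iterate (fun j k => ((List.ofFn (y j)).take k).reverse) hl nil (by simpa using hn)
      (fun _ => by simp) ?_).congr fun j => ?_
    · let π : (Σ j, Fin (List.ofFn (v j)).length) → Σ j, Fin (n j) := fun p =>
        ⟨p.1, ⟨p.2, by simpa using p.2.2⟩⟩
      refine (cons (((refl.fst.pair refl.snd.fst).congr fun p => ?_).trans (h.reindex π))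
        refl.snd.snd).congr fun p => ?_
      · simp [π]
      · have := (π p).2.2
        simp only [π] at this
        simp [List.take_add_one, π, this]
    · rw [List.take_of_length_le (by simp)]
  refine (h1.reverse (by simpa using hn)).congr_enc fun j => ?_
  simp only [List.reverse_reverse]
  rfl

/-- The body need only work on members of the list; this is how bounds on the entries reach it. -/
theorem map {l : ∀ j, List (ε j)} {f : ∀ j, ε j → β j} (hl : Comp S x l)
    (hlen : PolyBdd S fun j => (l j).length)
    (h : Comp (fun p : Σ j, {e // e ∈ l j} => S p.1) (fun p => (p.2.1, x p.1))
      (fun p => f p.1 p.2.1)) : Comp S x fun j => (l j).map (f j) := by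
  have hv : Comp S x fun j => fun i : Fin (l j).length => (l j)[i] :=
    hl.congr_enc fun j => by simp [enc]
  refine (ofFn hv hlen (y := fun j i => f j (l j)[i]) (h.reindex fun p : Σ j, Fin (l j).length =>
    ⟨p.1, (l p.1)[p.2], List.getElem_mem _⟩)).congr_enc fun j => ?_
  conv_rhs => simp only [enc]
  congr 2
  refine List.ext_getElem (by simp) fun i h1 h2 => by simp

theorem append {l l' : ∀ j, List (ε j)} (hl : Comp S x l) (hl' : Comp S x l')
    (hlen : PolyBdd S fun j => (l j).length) : Comp S x fun j => l j ++ l' j := by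
  refine (iterate (fun j k => ((l j).reverse.take k).reverse ++ l' j) (hl.reverse hlen) hl'
    (by simpa using hlen) (fun _ => by simp) ?_).congr fun j => by
      simp [List.take_of_length_le]
  refine (refl.fst.cons refl.snd.snd).congr fun p => ?_
  simp only [take_succ_fin, List.reverse_append, List.reverse_singleton, List.nil_append,
    List.cons_append]

theorem flatten {l : ∀ j, List (List (ε j))} (hl : Comp S x l)
    (hlen : PolyBdd S fun j => (l j).length) {b : J → ℕ} (hb : PolyBdd S b)
    (hlb : ∀ j, ∀ t ∈ l j, t.length ≤ b j) : Comp S x fun j => (l j).flatten := by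
  refine (iterate (fun j k => ((l j).reverse.take k).reverse.flatten) (hl.reverse hlen) nil
    (by simpa using hlen) (fun _ => by simp) ?_).congr fun j => by
      simp [List.take_of_length_le]
  refine (refl.fst.append refl.snd.snd ((hb.reindex Sigma.fst).mono fun p => ?_)).congr fun p => ?_
  · exact hlb _ _ (List.mem_reverse.1 (List.getElem_mem _))
  · simp only [take_succ_fin, List.reverse_append, List.reverse_singleton, List.singleton_append,
      List.flatten_cons]

theorem flatMap {l : ∀ j, List (ε j)} {f : ∀ j, ε j → List (β j)} (hl : Comp S x l)
    (hlen : PolyBdd S fun j => (l j).length) {b : J → ℕ} (hb : PolyBdd S b)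
    (hlb : ∀ j, ∀ e ∈ l j, (f j e).length ≤ b j)
    (h : Comp (fun p : Σ j, {e // e ∈ l j} => S p.1) (fun p => (p.2.1, x p.1))
      (fun p => f p.1 p.2.1)) : Comp S x fun j => (l j).flatMap (f j) := by
  refine ((hl.map hlen h).flatten (by simpa using hlen) hb ?_).congr fun j => ?_
  · simpa using hlb
  · simp [List.flatMap]

theorem filter {l : ∀ j, List (ε j)} {p : ∀ j, ε j → Prop} [∀ j, DecidablePred (p j)]
    (hl : Comp S x l) (hlen : PolyBdd S fun j => (l j).length)
    (h : Comp (fun q : Σ j, {e // e ∈ l j} => S q.1) (fun q => (q.2.1, x q.1))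
      (fun q => p q.1 q.2.1)) : Comp S x fun j => (l j).filter (p j ·) := by
  refine (hl.flatMap hlen (f := fun j e => if p j e then [e] else []) (.const 1)
    (fun j e _ => by split_ifs <;> simp) (ite h refl.fst.singleton nil)).congr fun j => ?_
  induction l j with
  | nil => rfl
  | cons a t ih => by_cases ha : p j a <;> simp [ha, ih]

/-- A unary number is a list of units and can control a loop; each round removes one entry. -/
theorem drop {l : ∀ j, List (ε j)} {k : J → ℕ} (hl : Comp S x l) (hk : Comp S x k)
    (hkb : PolyBdd S k) : Comp S x fun j => (l j).drop (k j) := by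
  have hk' : Comp S x fun j => List.replicate (k j) PUnit.unit.{1} := hk.congr_enc fun j => by
    simp [enc, Data.ofNat]
  refine (iterate (fun j i => (l j).drop i) hk' hl (by simpa using hkb) (fun _ => rfl) ?_).congr
    fun j => by simp
  exact refl.snd.snd.tail.congr fun p => by simp

theorem length {l : ∀ j, List (ε j)} (hl : Comp S x l)
    (hlen : PolyBdd S fun j => (l j).length) : Comp S x fun j => (l j).length :=
  iterate (fun _ k => k) hl zero_nat hlen (fun _ => rfl) refl.snd.snd.succ

theorem range {k : J → ℕ} (hk : Comp S x k) (hkb : PolyBdd S k) :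
    Comp S x fun j => List.range (k j) := by
  have hk' : Comp S x fun j => List.replicate (k j) PUnit.unit.{1} := hk.congr_enc fun j => by
    simp [enc, Data.ofNat]
  have := (iterate (fun j i => (i, (List.range i).reverse)) hk' (zero_nat.pair nil)
    (by simpa using hkb) (fun _ => rfl)
    ((refl.snd.snd.fst.succ.pair (refl.snd.snd.fst.cons refl.snd.snd.snd)).congr fun p => by
      simp [List.range_succ])).snd.reverse (by simpa using hkb)
  exact this.congr fun j => by simp

/-- In unary, `k ≤ k'` means that dropping `k'` entries from `k` leaves nothing. -/
theorem le_nat {k k' : J → ℕ} (hk : Comp S x k) (hk' : Comp S x k') (hb : PolyBdd S k') :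
    Comp S x fun j => k j ≤ k' j := by
  have h : Comp S x fun j => List.replicate (k j) PUnit.unit.{1} := hk.congr_enc fun j => by
    simp [enc, Data.ofNat]
  exact (h.drop hk' hb).eq_nil.congr fun j => by
    simp only [List.drop_eq_nil_iff, List.length_replicate]

theorem add_nat {k k' : J → ℕ} (hk : Comp S x k) (hk' : Comp S x k') (hb : PolyBdd S k) :
    Comp S x fun j => k j + k' j := by
  have h : Comp S x fun j => List.replicate (k j) PUnit.unit.{1} := hk.congr_enc fun j => by
    simp [enc, Data.ofNat]
  have h' : Comp S x fun j => List.replicate (k' j) PUnit.unit.{1} := hk'.congr_enc fun j => by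
    simp [enc, Data.ofNat]
  exact (h.append h' (by simpa using hb)).congr_enc fun j => by simp [enc, Data.ofNat]

theorem list_sum {l : ∀ j, List (S j).F} (hl : Comp S x l)
    (hlen : PolyBdd S fun j => (l j).length) : Comp S x fun j => (l j).sum := by
  refine (iterate (fun j k => ((l j).take k).sum) hl zero hlen (fun _ => by simp)
    ((refl.snd.snd.add refl.fst).congr fun p => ?_)).congr fun j => by simp
  simp only [take_succ_fin, List.sum_append, List.sum_singleton]

theorem list_prod {l : ∀ j, List (S j).F} (hl : Comp S x l)
    (hlen : PolyBdd S fun j => (l j).length) : Comp S x fun j => (l j).prod := by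
  refine (iterate (fun j k => ((l j).take k).prod) hl one hlen (fun _ => by simp)
    ((refl.snd.snd.mul refl.fst).congr fun p => ?_)).congr fun j => by simp
  simp only [take_succ_fin, List.prod_append, List.prod_singleton]

theorem list_sum_nat {l : J → List ℕ} {b : J → ℕ} (hl : Comp S x l)
    (hlen : PolyBdd S fun j => (l j).length) (hb : PolyBdd S b) (hlb : ∀ j, ∀ k ∈ l j, k ≤ b j) :
    Comp S x fun j => (l j).sum := by
  refine (iterate (fun j k => ((l j).take k).sum) hl zero_nat hlen (fun _ => by simp)
    ((refl.fst.add_nat refl.snd.snd ((hb.reindex Sigma.fst).mono fun p => ?_)).congr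
      fun p => ?_)).congr fun j => by simp
  · exact hlb _ _ (List.getElem_mem _)
  · simp only [take_succ_fin, List.sum_append, List.sum_singleton, add_comm]

theorem pow {k : J → ℕ} (hf : Comp S x f) (hk : Comp S x k) (hkb : PolyBdd S k) :
    Comp S x fun j => f j ^ k j := by
  have hk' : Comp S x fun j => List.replicate (k j) PUnit.unit.{1} := hk.congr_enc fun j => by
    simp [enc, Data.ofNat]
  refine (iterate (fun j i => f j ^ i) hk' one (by simpa using hkb) (fun _ => by simp)
    ((refl.snd.snd.mul (refl.snd.fst.trans (hf.reindex Sigma.fst))).congr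
      fun p => pow_succ _ _)).congr fun j => by simp

/-- Loops with an invariant. -/
theorem foldl {σ : J → Type*} [∀ j, Enc (S j).F (σ j)] {l : ∀ j, List (ε j)} {s : ∀ j, σ j}
    {step : ∀ j, σ j → ε j → σ j} (Inv : ∀ j, σ j → Prop) (hl : Comp S x l) (hs : Comp S x s)
    (hlen : PolyBdd S fun j => (l j).length) (h0 : ∀ j, Inv j (s j))
    (hInv : ∀ j a e, e ∈ l j → Inv j a → Inv j (step j a e))
    (h : Comp (fun p : Σ j, {e // e ∈ l j} × {a // Inv j a} => S p.1)
      (fun p => (p.2.1.1, x p.1, p.2.2.1)) (fun p => step p.1 p.2.2.1 p.2.1.1)) :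
    Comp S x fun j => (l j).foldl (step j) (s j) := by
  have key : ∀ j k, Inv j (((l j).take k).foldl (step j) (s j)) := fun j k => by
    have : ∀ t : List (ε j), (∀ e ∈ t, e ∈ l j) → ∀ a, Inv j a → Inv j (t.foldl (step j) a) := by
      intro t
      induction t with
      | nil => intro _ a ha; exact ha
      | cons e t ih =>
        intro ht a ha
        exact ih (fun e he => ht e (List.mem_cons_of_mem _ he)) _
          (hInv j a e (ht e List.mem_cons_self) ha)
    exact this _ (fun e he => List.mem_of_mem_take he) _ (h0 j)
  refine (iterate (fun j k => ((l j).take k).foldl (step j) (s j)) hl hs hlen (fun _ => by simp)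
    ((h.reindex fun p : Σ j, Fin (l j).length =>
      ⟨p.1, ⟨(l p.1)[p.2], List.getElem_mem _⟩, ⟨_, key p.1 p.2⟩⟩).congr fun p => ?_)).congr
      fun j => by simp
  simp only [take_succ_fin, List.foldl_append, List.foldl_cons, List.foldl_nil]

end Lists

/-! ### Vectors of varying length -/

section Vectors

variable {n : J → ℕ} {ε : J → Type*} [∀ j, Enc (S j).F (ε j)]

theorem toList {v : ∀ j, Fin (n j) → ε j} (h : Comp S x v) : Comp S x fun j => List.ofFn (v j) :=
  h.congr_enc fun _ => rfl

theorem toVec {v : ∀ j, Fin (n j) → ε j} (h : Comp S x fun j => List.ofFn (v j)) : Comp S x v :=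
  h.congr_enc fun _ => rfl

theorem vec_const {v : ∀ j, Fin (n j) → ε j} {y : ∀ j, β j} (hv : Comp S x v) (hn : PolyBdd S n)
    (hy : Comp S x y) : Comp S x fun j => fun _ : Fin (n j) => y j :=
  hv.ofFn hn hy.lift

theorem vec_zip {v : ∀ j, Fin (n j) → ε j} {y : ∀ j, Fin (n j) → β j} (hv : Comp S x v)
    (hy : Comp S x y) (hn : PolyBdd S n) : Comp S x fun j => fun i => (v j i, y j i) := by
  -- The loop runs over `v`; its state is the unread rest of `y` together with the pairs found so
  -- far, in reverse.
  have h : Comp S x fun j => ((List.ofFn (y j)).drop (List.ofFn (v j)).length,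
      ((List.ofFn fun i => (v j i, y j i)).take (List.ofFn (v j)).length).reverse) := by
    refine iterate (fun j k => ((List.ofFn (y j)).drop k,
      ((List.ofFn fun i => (v j i, y j i)).take k).reverse)) hv.toList (hy.toList.pair nil)
      (by simpa using hn) (fun _ => by simp) ?_
    have hp : ∀ p : Σ j, Fin (List.ofFn (v j)).length, (p.2 : ℕ) < n p.1 := fun p => by
      simpa using p.2.2
    have hd : Comp (fun p : Σ j, Fin (List.ofFn (v j)).length => S p.1)
        (fun p => ((List.ofFn (v p.1))[p.2], x p.1, (List.ofFn (y p.1)).drop p.2,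
          ((List.ofFn fun i => (v p.1 i, y p.1 i)).take p.2).reverse))
        fun p => (List.ofFn (y p.1)).drop p.2 := refl.snd.snd.fst
    refine (hd.tail.pair ((refl.fst.pair (hd.head (y := fun p => y p.1 ⟨p.2, hp p⟩)
      fun p => ?_)).cons refl.snd.snd.snd)).congr fun p => ?_
    · exact ⟨_, by rw [List.drop_eq_getElem_cons (by simpa using hp p)]; simp; rfl⟩
    · have := hp p
      simp [List.take_add_one, this]
  refine toVec ((h.snd.reverse (hn.mono fun j => by simp)).congr fun j => ?_)
  simp [List.take_of_length_le]

theorem vec_rev {v : ∀ j, Fin (n j) → ε j} (hv : Comp S x v) (hn : PolyBdd S n) :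
    Comp S x fun j => fun i : Fin (n j) => v j i.rev :=
  toVec ((hv.toList.reverse (by simpa using hn)).congr fun j => by
    refine List.ext_getElem (by simp) fun i h1 h2 => ?_
    simp [Fin.rev, Nat.sub_sub, Nat.add_comm])

theorem vec_card {v : ∀ j, Fin (n j) → ε j} (hv : Comp S x v) (hn : PolyBdd S n) : Comp S x n :=
  (hv.toList.length (by simpa using hn)).congr fun j => by simp

theorem vec_index {v : ∀ j, Fin (n j) → ε j} (hv : Comp S x v) (hn : PolyBdd S n) :
    Comp S x fun j => fun i : Fin (n j) => (i : ℕ) :=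
  toVec (((hv.vec_card hn).range hn).congr fun j => by
    refine List.ext_getElem (by simp) fun i h1 h2 => by simp)

theorem vec_cons {v : ∀ j, Fin (n j) → β j} (hy : Comp S x y) (hv : Comp S x v) :
    Comp S x fun j => (Fin.cons (y j) (v j) : Fin (n j + 1) → β j) :=
  toVec ((hy.cons hv.toList).congr fun _ => by simp [List.ofFn_succ])

theorem vec_head {v : ∀ j, Fin (n j + 1) → β j} (hv : Comp S x v) :
    Comp S x fun j => v j 0 :=
  hv.toList.head fun _ => ⟨_, List.ofFn_succ⟩

theorem vec_tail {v : ∀ j, Fin (n j + 1) → β j} (hv : Comp S x v) :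
    Comp S x fun j => fun i => v j (Fin.succ i) :=
  toVec (hv.toList.tail.congr fun _ => by simp [List.ofFn_succ])

theorem vec_sum {v : ∀ j, Fin (n j) → (S j).F} (hv : Comp S x v) (hn : PolyBdd S n) :
    Comp S x fun j => ∑ i, v j i :=
  (hv.toList.list_sum (by simpa using hn)).congr fun _ => by simp [List.sum_ofFn]

/-- Vectors may be computed from two vectors entry by entry. -/
theorem vec_map₂ {v : ∀ j, Fin (n j) → ε j} {y : ∀ j, Fin (n j) → β j} (hv : Comp S x v)
    (hy : Comp S x y) (hn : PolyBdd S n) {z : ∀ j, Fin (n j) → γ j}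
    (h : Comp (fun p : Σ j, Fin (n j) => S p.1) (fun p => ((v p.1 p.2, y p.1 p.2), x p.1))
      (fun p => z p.1 p.2)) : Comp S x z :=
  (hv.vec_zip hy hn).ofFn hn h

end Vectors

end Comp

end PolyComp

/-! ### The algorithm and its running time -/

namespace PolyComp

open Enc (enc)

universe u v w

section Algorithm

variable {K : Type u} [Field K] {N m n : ℕ}

/-- Pairs of vectors of length `N`. -/
abbrev VecPair (K : Type u) (N : ℕ) : Type u := (Fin N → K) × (Fin N → K)

/-- Two components are needed because the conditions compare two product vectors `u` and `v`. Their
difference is not a product, but pairing it with `c` is the same as pairing `(u, v)` with `(c, -c)`.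
-/
def dot (κ r : VecPair K N) : K := ∑ j, κ.1 j * r.1 j + ∑ j, κ.2 j * r.2 j

open Classical in
/-- Impose the linear condition `dot · r = 0` on the span of the list `st.2`; if the condition does
not follow from the previous ones, record it in the list `st.1`. -/
noncomputable def siftStep (st : List (VecPair K N) × List (VecPair K N)) (r : VecPair K N) :
    List (VecPair K N) × List (VecPair K N) :=
  match st.2.filter fun κ => ¬ dot κ r = 0 with
  | [] => st
  | p :: _ => (r :: st.1, st.2.map fun κ => κ - (dot κ r / dot p r) • p)

/-- Impose a list of linear conditions on the span of a list of vectors. -/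
noncomputable def sift (κs rs : List (VecPair K N)) : List (VecPair K N) × List (VecPair K N) :=
  rs.foldl siftStep ([], κs)

def leftBasis (K : Type u) [Field K] (N : ℕ) : List (VecPair K N) :=
  List.ofFn fun i => (Pi.single i 1, 0)

def rightBasis (K : Type u) [Field K] (N : ℕ) : List (VecPair K N) :=
  List.ofFn fun i => (0, Pi.single i 1)

def stdBasis (K : Type u) [Field K] (N : ℕ) : List (VecPair K N) :=
  leftBasis K N ++ rightBasis K N

/-- Add one level to a list of products, and drop redundant ones. -/
noncomputable def productStep (rows lev : List (VecPair K N)) : List (VecPair K N) :=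
  (sift (stdBasis K N) (rows.flatMap fun r => lev.map fun w => r * w)).1

/-- A small list of vectors with the same annihilator as the set of all products of `start` with one
element of each level. -/
noncomputable def products (start : VecPair K N) (levels : List (List (VecPair K N))) :
    List (VecPair K N) :=
  levels.foldr (fun lev rows => productStep rows lev) [start]

/-- The value at `x` of the Lagrange basis polynomial of `l` at the node `s`. -/
noncomputable def lag (l : List K) (s x : K) : K := by
  classical exact (l.map fun t => if s - t = 0 then 1 else (x - t) / (s - t)).prod

/-- The value of `f` at the `i`-th coordinate of `p`, and `c` if there is none. -/
def atCoord (p : List K) (i : ℕ) (f : K → K) (c : K) : K :=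
  match p.drop i with
  | [] => c
  | x :: _ => f x

/-- A coordinate that the point `z j` does not fix is summed over, and a Lagrange basis polynomial
has sum `1` over its nodes; hence the default value. -/
noncomputable def lagVec (z : Fin N → List K) (l : List K) (i : ℕ) (s : K) : Fin N → K :=
  fun j => atCoord (z j) i (lag l s) 1

def powVec (z : Fin N → List K) (l : List K) (i e : ℕ) : Fin N → K :=
  fun j => atCoord (z j) i (· ^ e) (l.map (· ^ e)).sum

/-- The values of the interpolation polynomial on `l` of the `e`-th power. -/
noncomputable def powLagVec (z : Fin N → List K) (l : List K) (i e : ℕ) : Fin N → K :=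
  fun j => (l.map fun s => s ^ e * lagVec z l i s j).sum

noncomputable def powLevel (z : Fin N → List K) (l : List K) (d i i' : ℕ) : List (VecPair K N) :=
  (List.range (d + 1)).map fun e => (powVec z l i e, powLagVec z l i' e)

/-- A palindrome is determined by its first half. The earlier of two mirror coordinates carries the
factors of both, the later one carries `1`, and a middle coordinate stands alone. -/
noncomputable def palLevel (z : Fin N → List K) (l : List K) (i i' : ℕ) : List (VecPair K N) :=
  if i' ≤ i then if i ≤ i' then l.map fun s => (lagVec z l i s, 1) else [(1, 1)]
  else l.map fun s => (lagVec z l i s * lagVec z l i' s, 1)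

noncomputable def powRows (z : Fin N → List K) (L : Fin m → List K) (d : Fin m → ℕ) :
    List (VecPair K N) :=
  products (1, 1) (List.ofFn fun i => powLevel z (L i) (d i) i i.rev)

noncomputable def palRows (z : Fin N → List K) (L : Fin m → List K) : List (VecPair K N) :=
  products (1, 0) (List.ofFn fun i => palLevel z (L i) i i.rev)

def unitVec (K : Type u) [Field K] (n : ℕ) : Fin (n + 1) → K := Fin.cons 1 fun _ => 0

open Classical in
/-- The linear conditions on the coefficients of a relation. -/
noncomputable def conditions (z : Fin (n + 1) → List K) (L : Fin m → List K) (d : Fin m → ℕ) :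
    List (VecPair K (n + 1)) :=
  ((powRows z L d).map fun w => (w.1 - w.2, 0)) ++
    -- In characteristic two an antisymmetric function is arbitrary at palindromes, which gives
    -- additional conditions. The final row forces the coefficient of `⊥` to vanish.
    ((if (1 + 1 : K) = 0 then (palRows z L).map fun w => (w.1, 0) else []) ++
      [(unitVec K n, 0)])

/-- Generators of the space of all relations. -/
noncomputable def relations (z : Fin (n + 1) → List K) (L : Fin m → List K) (d : Fin m → ℕ) :
    List (VecPair K (n + 1)) :=
  (sift (leftBasis K (n + 1)) (conditions z L d)).2

-- Position `1` is the new query; a relation helps only if it involves that symbol.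
open Classical in
noncomputable def usefulRelations (z : Fin (n + 2) → List K) (L : Fin m → List K) (d : Fin m → ℕ) :
    List (VecPair K (n + 2)) :=
  (relations z L d).filter fun κ => ¬ κ.1 (Fin.succ 0) = 0

/-- Partial points, together with the vectors of their weights. -/
abbrev Path (K : Type u) (N : ℕ) : Type u := List K × (Fin N → K)

abbrev Level (K : Type u) (N : ℕ) : Type u := List (K × (Fin N → K))

def expand (l : Level K N) (cur : List (Path K N)) : List (Path K N) :=
  cur.flatMap fun x => l.map fun s => (s.1 :: x.1, x.2 * s.2)

/-- Tests that decide from the weight vector of a partial path whether some completion has nonzero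
weight. The start `(1, 0)` switches off the second component. -/
noncomputable def suffixRows (ls : List (Level K N)) : List (VecPair K N) :=
  products (1, 0) (ls.map fun l => l.map fun s => (s.2, s.2))

open Classical in
noncomputable def prune (rows : List (VecPair K N)) (cur : List (Path K N)) : List (Path K N) :=
  cur.filter fun x => ¬ (rows.filter fun r => ¬ dot (x.2, 0) r = 0) = []

/-- One step of the enumeration of all paths of nonzero weight; it fails (with value `[]`) if there
are too many. -/
noncomputable def enumStep (bound : ℕ) (st : List (Level K N) × List (List (Path K N)))
    (l : Level K N) : List (Level K N) × List (List (Path K N)) :=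
  (st.1.tail, st.2.flatMap fun cur =>
    if (prune (suffixRows st.1.tail) (expand l cur)).length ≤ bound then
      [prune (suffixRows st.1.tail) (expand l cur)] else [])

noncomputable def enum (bound : ℕ) (ls : List (Level K N)) (μ : Fin N → K) :
    List (List (Path K N)) :=
  (ls.foldl (enumStep bound) (ls, [[([], μ)]])).2

/-- One step of the enumeration of either all or many paths. -/
def candStep (bound : ℕ) (cur : List (Path K N)) (l : Level K N) : List (Path K N) :=
  if cur.length ≤ bound then expand l cur else expand (l.take 1) cur

def cands (bound : ℕ) (ls : List (Level K N)) (μ : Fin N → K) : List (Path K N) :=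
  ls.foldl (candStep bound) [([], μ)]

/-- Paths grow at the front, so the last coordinate has to be chosen first. -/
noncomputable def lagLevels (z : Fin N → List K) (L : Fin m → List K) : List (Level K N) :=
  (List.ofFn fun i => (L i).map fun s => (s, lagVec z (L i) i s)).reverse

def weight (x : Path K N) : K := ∑ j, x.2 j

/-- The bound of `exists_const` on the number of exceptional points. -/
def searchBound (N : ℕ) (L : Fin m → List K) : ℕ := N * (N * (List.ofFn fun i => (L i).length).sum)

/-- A constant and the list of all points at which the weight is different from this constant. -/
noncomputable def search (z : Fin (n + 1) → List K) (L : Fin m → List K) (μ : Fin (n + 1) → K) :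
    List (K × List (Path K (n + 1))) :=
  (cands (searchBound (n + 1) L) (lagLevels z L) μ).flatMap fun x =>
    (enum (searchBound (n + 1) L) (lagLevels z L) fun j => μ j - weight x * unitVec K n j).map
      fun r => (weight x, r)

/-- The questions to the message, together with the coefficients of the answers. -/
def questions (r : K × List (Path K N)) : List (List K × K) :=
  ([], r.1) :: r.2.map fun x => (x.1, weight x)

end Algorithm

theorem siftStep_of_nil {K : Type u} [Field K] {N : ℕ}
    {st : List (VecPair K N) × List (VecPair K N)} {r : VecPair K N}
    (h : ∀ κ ∈ st.2, dot κ r = 0) : siftStep st r = st := by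
  classical
  have : (st.2.filter fun κ => ¬ dot κ r = 0) = [] := by simpa using h
  rw [siftStep]
  split
  · rfl
  · rename_i h'
    rw [this] at h'
    cases h'

open Classical in
theorem siftStep_of_cons {K : Type u} [Field K] {N : ℕ}
    {st : List (VecPair K N) × List (VecPair K N)} {r p : VecPair K N} {t : List (VecPair K N)}
    (h : (st.2.filter fun κ => ¬ dot κ r = 0) = p :: t) :
    siftStep st r = (r :: st.1, st.2.map fun κ => κ - (dot κ r / dot p r) • p) := by
  rw [siftStep]
  split
  · rename_i h'
    rw [h] at h'
    cases h'
  · rename_i h'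
    rw [h] at h'
    cases h'
    rfl

theorem siftStep_length {K : Type u} [Field K] {N : ℕ}
    (st : List (VecPair K N) × List (VecPair K N)) (r : VecPair K N) :
    (siftStep st r).1.length ≤ st.1.length + 1 ∧ (siftStep st r).2.length = st.2.length := by
  rw [siftStep]
  split <;> simp

theorem sift_length {K : Type u} [Field K] {N : ℕ} (κs rs : List (VecPair K N)) :
    (sift κs rs).2.length = κs.length := by
  rw [sift]
  have : ∀ st : List (VecPair K N) × List (VecPair K N),
      (rs.foldl siftStep st).2.length = st.2.length := by
    induction rs with
    | nil => intro st; rfl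
    | cons r rs ih => intro st; rw [List.foldl_cons, ih, (siftStep_length st r).2]
  exact this _

/-! ### Running time of the linear algebra -/

namespace Comp

variable {J : Type w} {S : J → Setting.{u}} {α : J → Type*} [∀ j, Enc (S j).F (α j)]
  {x : ∀ j, α j} {N : J → ℕ}

theorem lift₂ {I : Type*} {π : I → J} {β ε σ : _ → Type*} [∀ j, Enc (S j).F (β j)]
    [∀ i, Enc (S (π i)).F (ε i)] [∀ i, Enc (S (π i)).F (σ i)] {y : ∀ j, β j}
    {e : ∀ i, ε i} {s : ∀ i, σ i} (h : Comp S x y) :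
    Comp (fun i => S (π i)) (fun i => (e i, x (π i), s i)) (fun i => y (π i)) :=
  (refl (x := fun i => (e i, x (π i), s i))).snd.fst.trans (h.reindex π)

theorem foldr {ε σ : J → Type*} [∀ j, Enc (S j).F (ε j)] [∀ j, Enc (S j).F (σ j)]
    {l : ∀ j, List (ε j)} {s : ∀ j, σ j}
    {step : ∀ j, ε j → σ j → σ j} (Inv : ∀ j, σ j → Prop) (hl : Comp S x l) (hs : Comp S x s)
    (hlen : PolyBdd S fun j => (l j).length) (h0 : ∀ j, Inv j (s j))
    (hInv : ∀ j a e, e ∈ l j → Inv j a → Inv j (step j e a))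
    (h : Comp (fun p : Σ j, {e // e ∈ l j} × {a // Inv j a} => S p.1)
      (fun p => (p.2.1.1, x p.1, p.2.2.1)) (fun p => step p.1 p.2.1.1 p.2.2.1)) :
    Comp S x fun j => (l j).foldr (step j) (s j) := by
  refine (foldl (l := fun j => (l j).reverse) (step := fun j a e => step j e a) Inv
    (hl.reverse hlen) hs (by simpa using hlen) h0
    (fun j a e he => hInv j a e (List.mem_reverse.1 he)) ?_).congr fun j => by
      rw [List.foldl_reverse]
  exact h.reindex fun p : Σ j, {e // e ∈ (l j).reverse} × {a // Inv j a} =>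
    ⟨p.1, ⟨p.2.1.1, List.mem_reverse.1 p.2.1.2⟩, p.2.2⟩

theorem mul_nat {k k' : J → ℕ} (hk : Comp S x k) (hk' : Comp S x k') (hb : PolyBdd S k)
    (hb' : PolyBdd S k') : Comp S x fun j => k j * k' j := by
  refine ((((hk.range hb).map (f := fun j _ => k' j) (by simpa using hb)
    hk'.lift).list_sum_nat (by simpa using hb) hb' ?_)).congr fun j => by simp
  intro j i hi
  simp only [List.mem_map] at hi
  obtain ⟨_, _, rfl⟩ := hi
  exact le_rfl

theorem two : Comp S x fun j => (1 + 1 : (S j).F) := one.add one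

theorem vec_mul {a b : ∀ j, Fin (N j) → (S j).F} (ha : Comp S x a) (hb : Comp S x b)
    (hN : PolyBdd S N) : Comp S x fun j => a j * b j :=
  ha.vec_map₂ hb hN (refl.fst.fst.mul refl.fst.snd)

theorem vec_sub {a b : ∀ j, Fin (N j) → (S j).F} (ha : Comp S x a) (hb : Comp S x b)
    (hN : PolyBdd S N) : Comp S x fun j => a j - b j :=
  ha.vec_map₂ hb hN (refl.fst.fst.sub refl.fst.snd)

theorem vec_smul {c : ∀ j, (S j).F} {a : ∀ j, Fin (N j) → (S j).F} (hc : Comp S x c)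
    (ha : Comp S x a) (hN : PolyBdd S N) : Comp S x fun j => c j • a j :=
  ha.ofFn hN (hc.lift.mul refl.fst)

section Pairs

variable {a b : ∀ j, VecPair (S j).F (N j)}

theorem dot (ha : Comp S x a) (hb : Comp S x b) (hN : PolyBdd S N) :
    Comp S x fun j => dot (a j) (b j) :=
  ((ha.fst.vec_mul hb.fst hN).vec_sum hN).add ((ha.snd.vec_mul hb.snd hN).vec_sum hN)

theorem pair_mul (ha : Comp S x a) (hb : Comp S x b) (hN : PolyBdd S N) :
    Comp S x fun j => a j * b j :=
  (ha.fst.vec_mul hb.fst hN).pair (ha.snd.vec_mul hb.snd hN)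

theorem pair_sub (ha : Comp S x a) (hb : Comp S x b) (hN : PolyBdd S N) :
    Comp S x fun j => a j - b j :=
  (ha.fst.vec_sub hb.fst hN).pair (ha.snd.vec_sub hb.snd hN)

theorem pair_smul {c : ∀ j, (S j).F} (hc : Comp S x c) (ha : Comp S x a) (hN : PolyBdd S N) :
    Comp S x fun j => c j • a j :=
  (hc.vec_smul ha.fst hN).pair (hc.vec_smul ha.snd hN)

theorem siftStep {st : ∀ j, List (VecPair (S j).F (N j)) × List (VecPair (S j).F (N j))}
    {r : ∀ j, VecPair (S j).F (N j)} (hst : Comp S x st) (hr : Comp S x r) (hN : PolyBdd S N)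
    (hlen : PolyBdd S fun j => (st j).2.length) : Comp S x fun j => siftStep (st j) (r j) := by
  classical
  have hf : Comp S x fun j => (st j).2.filter fun κ => ¬ PolyComp.dot κ (r j) = 0 :=
    hst.snd.filter hlen ((refl.fst.dot hr.lift (hN.reindex _)).eq_zero.not)
  refine cond hf.eq_nil ((hst.reindex _).congr fun j => siftStep_of_nil (by simpa using j.2)) ?_
  choose p t hp using fun j : {j // ¬ ((st j).2.filter fun κ => ¬ PolyComp.dot κ (r j) = 0) = []} =>
    List.exists_cons_of_ne_nil j.2
  have hp' : Comp (fun j : {j // ¬ ((st j).2.filter fun κ => ¬ PolyComp.dot κ (r j) = 0) = []} =>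
      S j) (fun j => x j) p := (hf.reindex Subtype.val).head fun j => ⟨t j, hp j⟩
  have hr' := hr.reindex
    fun j : {j // ¬ ((st j).2.filter fun κ => ¬ PolyComp.dot κ (r j) = 0) = []} => j.1
  have hst' := hst.reindex
    fun j : {j // ¬ ((st j).2.filter fun κ => ¬ PolyComp.dot κ (r j) = 0) = []} => j.1
  refine ((hr'.cons hst'.fst).pair (hst'.snd.map (hlen.reindex _) ?_)).congr
    fun j => siftStep_of_cons (hp j)
  have hN' := hN.reindex
    fun p : Σ j : {j // ¬ ((st j).2.filter fun κ => ¬ PolyComp.dot κ (r j) = 0) = []},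
      {e // e ∈ (st j).2} => p.1.1
  exact refl.fst.pair_sub (((refl.fst.dot hr'.lift hN').div
    (hp'.lift.dot hr'.lift hN')).pair_smul hp'.lift hN') hN'

theorem sift {κs rs : ∀ j, List (VecPair (S j).F (N j))} (hκ : Comp S x κs) (hrs : Comp S x rs)
    (hN : PolyBdd S N) (hlen : PolyBdd S fun j => (κs j).length)
    (hlen' : PolyBdd S fun j => (rs j).length) : Comp S x fun j => sift (κs j) (rs j) :=
  foldl (fun j st => st.2.length = (κs j).length) hrs (nil.pair hκ) hlen' (fun _ => rfl)
    (fun j a e _ h => by rw [(siftStep_length a e).2, h])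
    (refl.snd.snd.siftStep refl.fst (hN.reindex _)
      ((hlen.reindex Sigma.fst).mono fun p => p.2.2.2.le))

end Pairs

end Comp

end PolyComp

/-! ### Correctness of the linear algebra -/

namespace PolyComp

open Enc (enc)

universe u v w

section Sift

variable {K : Type u} [Field K] {N : ℕ}

theorem dot_add_left (a b r : VecPair K N) : dot (a + b) r = dot a r + dot b r := by
  simp only [dot, Prod.fst_add, Prod.snd_add, Pi.add_apply, add_mul, Finset.sum_add_distrib]
  ring

theorem dot_smul_left (c : K) (a r : VecPair K N) : dot (c • a) r = c * dot a r := by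
  simp only [dot, Prod.smul_fst, Prod.smul_snd, Pi.smul_apply, smul_eq_mul, mul_add,
    Finset.mul_sum, mul_assoc]

theorem dot_mul (κ a b : VecPair K N) : dot κ (a * b) = dot (κ * a) b := by
  simp [dot, mul_assoc]

/-- The linear form `dot · r`. -/
def dotRight (r : VecPair K N) : VecPair K N →ₗ[K] K where
  toFun κ := dot κ r
  map_add' a b := dot_add_left a b r
  map_smul' c a := dot_smul_left c a r

theorem dotRight_apply (r κ : VecPair K N) : dotRight r κ = dot κ r := rfl

/-- What is known about the state after the conditions `l` have been imposed on the span of `κs`. -/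
structure Valid (κs l : List (VecPair K N)) (st : List (VecPair K N) × List (VecPair K N)) :
    Prop where
  subset : ∀ r ∈ st.1, r ∈ l
  mem_span : ∀ x, x ∈ Submodule.span K {y | y ∈ st.2} ↔
    x ∈ Submodule.span K {y | y ∈ κs} ∧ ∀ r ∈ l, dot x r = 0
  of_rows : ∀ x ∈ Submodule.span K {y | y ∈ κs}, (∀ r ∈ st.1, dot x r = 0) →
    x ∈ Submodule.span K {y | y ∈ st.2}
  rank : st.1.length + Module.finrank K (Submodule.span K {y | y ∈ st.2}) ≤
    Module.finrank K (Submodule.span K {y | y ∈ κs})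

/-- Projecting the generators along `p` cuts out the hyperplane `dot · r = 0`. -/
theorem mem_span_project {κs : List (VecPair K N)} {r p : VecPair K N} (hp : p ∈ κs)
    (hpr : dot p r ≠ 0) (x : VecPair K N) :
    x ∈ Submodule.span K {y | y ∈ κs.map fun κ => κ - (dot κ r / dot p r) • p} ↔
      x ∈ Submodule.span K {y | y ∈ κs} ∧ dot x r = 0 := by
  let T : VecPair K N →ₗ[K] VecPair K N :=
    LinearMap.id - ((dot p r)⁻¹ • dotRight r).smulRight p
  have hT : ∀ κ, T κ = κ - (dot κ r / dot p r) • p := fun κ => by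
    simp [T, dotRight_apply, div_eq_inv_mul]
  have himage : {y | y ∈ κs.map fun κ => κ - (dot κ r / dot p r) • p} = T '' {y | y ∈ κs} := by
    ext y
    simp [hT]
  rw [himage, ← Submodule.map_span]
  have hTr : ∀ κ, dot (T κ) r = 0 := fun κ => by
    rw [hT, sub_eq_add_neg, dot_add_left, ← neg_smul, dot_smul_left]
    field_simp
    ring
  constructor
  · rintro ⟨y, hy, rfl⟩
    refine ⟨?_, hTr y⟩
    rw [hT]
    exact Submodule.sub_mem _ hy (Submodule.smul_mem _ _ (Submodule.subset_span hp))
  · rintro ⟨hx, hxr⟩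
    exact ⟨x, hx, by rw [hT, hxr]; simp⟩

/-- If all generators satisfy the new condition, so does their span, and nothing changes. Otherwise
projecting along the pivot cuts out a hyperplane; the dimension that is lost pays for the recorded
row. -/
theorem Valid.step {κs l : List (VecPair K N)} {st : List (VecPair K N) × List (VecPair K N)}
    (h : Valid κs l st) (r : VecPair K N) : Valid κs (l ++ [r]) (siftStep st r) := by
  classical
  rcases hf : st.2.filter fun κ => ¬ dot κ r = 0 with _ | ⟨p, t⟩
  · have hf' : ∀ κ ∈ st.2, dot κ r = 0 := by simpa using hf
    rw [siftStep_of_nil hf']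
    have hspan : ∀ x ∈ Submodule.span K {y | y ∈ st.2}, dot x r = 0 := fun x hx =>
      (Submodule.span_le (p := LinearMap.ker (dotRight r))).2 hf' hx
    refine ⟨fun s hs => List.mem_append_left _ (h.subset s hs), fun x => ?_, h.of_rows, h.rank⟩
    constructor
    · intro hx
      refine ⟨((h.mem_span x).1 hx).1, fun s hs => ?_⟩
      rcases List.mem_append.1 hs with hs | hs
      · exact ((h.mem_span x).1 hx).2 s hs
      · rw [List.mem_singleton.1 hs]
        exact hspan x hx
    · rintro ⟨hx, hs⟩
      exact (h.mem_span x).2 ⟨hx, fun s hs' => hs s (List.mem_append_left _ hs')⟩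
  · have hp := List.mem_filter.1 (hf ▸ List.mem_cons_self : p ∈ st.2.filter fun κ => ¬ dot κ r = 0)
    have hpr : dot p r ≠ 0 := by simpa using hp.2
    rw [siftStep_of_cons hf]
    have key := mem_span_project (r := r) hp.1 hpr
    refine ⟨fun s hs => ?_, fun x => ?_, fun x hx hs => ?_, ?_⟩
    · rcases List.mem_cons.1 hs with rfl | hs
      · simp
      · exact List.mem_append_left _ (h.subset s hs)
    · refine (key x).trans ?_
      rw [h.mem_span x]
      constructor
      · rintro ⟨⟨h1, h2⟩, h3⟩
        refine ⟨h1, fun s hs => ?_⟩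
        rcases List.mem_append.1 hs with hs | hs
        · exact h2 s hs
        · rwa [List.mem_singleton.1 hs]
      · rintro ⟨h1, h2⟩
        exact ⟨⟨h1, fun s hs => h2 s (List.mem_append_left _ hs)⟩, h2 r (by simp)⟩
    · exact (key x).2 ⟨h.of_rows x hx fun s hs' => hs s (List.mem_cons_of_mem _ hs'),
        hs r List.mem_cons_self⟩
    · have hlt : Submodule.span K
          {y | y ∈ st.2.map fun κ => κ - (dot κ r / dot p r) • p} <
          Submodule.span K {y | y ∈ st.2} := by
        refine lt_of_le_of_ne (fun x hx => ((key x).1 hx).1) fun he => hpr ?_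
        exact ((key p).1 (he ▸ Submodule.subset_span hp.1)).2
      have h1 := Submodule.finrank_lt_finrank_of_lt hlt
      have h2 := h.rank
      simp only [List.length_cons]
      omega

theorem valid_sift (κs l : List (VecPair K N)) : Valid κs l (sift κs l) := by
  induction l using List.reverseRecOn with
  | nil =>
    exact ⟨fun r hr => hr, fun x => by simp [sift], fun x hx _ => hx,
      by simp only [sift, List.foldl_nil, List.length_nil, zero_add]; exact le_rfl⟩
  | append_singleton l r ih =>
    have := ih.step r
    rwa [sift, List.foldl_append]

theorem finrank_vecPair : Module.finrank K (VecPair K N) = N + N := by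
  simp [Module.finrank_prod]

theorem mem_span_leftBasis (x : VecPair K N) :
    x ∈ Submodule.span K {y | y ∈ leftBasis K N} ↔ x.2 = 0 := by
  constructor
  · intro hx
    have : Submodule.span K {y | y ∈ leftBasis K N} ≤ LinearMap.ker (LinearMap.snd K _ _) := by
      refine Submodule.span_le.2 fun y hy => ?_
      obtain ⟨i, rfl⟩ : ∃ i, (Pi.single i 1, 0) = y := by
        simpa [leftBasis, List.mem_ofFn] using hy
      simp
    exact this hx
  · intro hx
    have : x = ∑ i, x.1 i • ((Pi.single i 1, 0) : VecPair K N) := by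
      refine Prod.ext ?_ ?_
      · rw [Prod.fst_sum]
        ext j
        simp [Finset.sum_apply, Pi.single_apply]
      · rw [Prod.snd_sum]
        simp [hx]
    rw [this]
    refine Submodule.sum_mem _ fun i _ => Submodule.smul_mem _ _ (Submodule.subset_span ?_)
    simp [leftBasis, List.mem_ofFn]

theorem mem_span_rightBasis (x : VecPair K N) (hx : x.1 = 0) :
    x ∈ Submodule.span K {y | y ∈ rightBasis K N} := by
  have : x = ∑ i, x.2 i • ((0, Pi.single i 1) : VecPair K N) := by
    refine Prod.ext ?_ ?_
    · rw [Prod.fst_sum]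
      simp [hx]
    · rw [Prod.snd_sum]
      ext j
      simp [Finset.sum_apply, Pi.single_apply]
  rw [this]
  refine Submodule.sum_mem _ fun i _ => Submodule.smul_mem _ _ (Submodule.subset_span ?_)
  simp [rightBasis, List.mem_ofFn]

theorem span_stdBasis (x : VecPair K N) : x ∈ Submodule.span K {y | y ∈ stdBasis K N} := by
  have : x = (x.1, 0) + (0, x.2) := by simp
  rw [this]
  refine Submodule.add_mem _ (Submodule.span_mono ?_ ((mem_span_leftBasis _).2 rfl))
    (Submodule.span_mono ?_ (mem_span_rightBasis _ rfl))
  · intro y hy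
    exact List.mem_append_left _ hy
  · intro y hy
    exact List.mem_append_right _ hy

/-- Every recorded row costs one dimension of a space of dimension `N + N`. -/
theorem productStep_length (rows lev : List (VecPair K N)) :
    (productStep rows lev).length ≤ N + N := by
  have h := (valid_sift (stdBasis K N) (rows.flatMap fun r => lev.map fun w => r * w)).rank
  have h' := Submodule.finrank_le (Submodule.span K {y | y ∈ stdBasis K N})
  rw [finrank_vecPair] at h'
  exact (Nat.le_add_right _ _).trans (h.trans h')

/-- The recorded rows have the same annihilator as the full list of products, and a factor of a row
can be moved to the other argument of `dot`. -/
theorem dot_productStep (rows lev : List (VecPair K N)) (κ : VecPair K N) :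
    (∀ r ∈ productStep rows lev, dot κ r = 0) ↔
      ∀ w ∈ lev, ∀ r ∈ rows, dot (κ * w) r = 0 := by
  have h := valid_sift (stdBasis K N) (rows.flatMap fun r => lev.map fun w => r * w)
  have : (∀ r ∈ productStep rows lev, dot κ r = 0) ↔
      ∀ r ∈ rows.flatMap fun r => lev.map fun w => r * w, dot κ r = 0 :=
    ⟨fun hr => ((h.mem_span κ).1 (h.of_rows κ (span_stdBasis κ) hr)).2,
      fun hr r hr' => hr r (h.subset r hr')⟩
  rw [this]
  simp only [List.mem_flatMap, List.mem_map, forall_exists_index, and_imp]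
  constructor
  · intro h w hw r hr
    rw [← dot_mul, mul_comm]
    exact h _ r hr w hw rfl
  · rintro h _ r hr w hw rfl
    rw [mul_comm, dot_mul]
    exact h w hw r hr

/-- The summand `1` covers the case of no levels, where `start` itself remains. -/
theorem products_length (start : VecPair K N) (ls : List (List (VecPair K N))) :
    (products start ls).length ≤ N + N + 1 := by
  cases ls with
  | nil => simp [products]
  | cons l ls => exact (productStep_length _ _).trans (Nat.le_succ _)

theorem dot_products_cons (start : VecPair K N) (l : List (VecPair K N))
    (ls : List (List (VecPair K N))) (κ : VecPair K N) :
    (∀ r ∈ products start (l :: ls), dot κ r = 0) ↔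
      ∀ w ∈ l, ∀ r ∈ products start ls, dot (κ * w) r = 0 :=
  dot_productStep _ _ _

/-- This replaces exponentially many product conditions, one for each choice of `w`, by a short
list. -/
theorem dot_products_ofFn (start : VecPair K N) {m : ℕ} (lev : Fin m → List (VecPair K N))
    (κ : VecPair K N) :
    (∀ r ∈ products start (List.ofFn lev), dot κ r = 0) ↔
      ∀ w : Fin m → VecPair K N, (∀ i, w i ∈ lev i) → dot κ ((∏ i, w i) * start) = 0 := by
  induction m generalizing κ with
  | zero => simp [products]
  | succ m ih =>
    rw [List.ofFn_succ, dot_products_cons]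
    simp only [ih]
    constructor
    · intro h w hw
      rw [Fin.prod_univ_succ, mul_assoc, dot_mul]
      exact h (w 0) (hw 0) (fun i => w i.succ) fun i => hw i.succ
    · intro h w0 hw0 w hw
      have := h (Fin.cons w0 w) fun i => by
        refine Fin.cases ?_ (fun i => ?_) i
        · simpa using hw0
        · simpa using hw i
      rwa [Fin.prod_univ_succ, mul_assoc, dot_mul] at this

/-- The relations are the vectors that satisfy all conditions. -/
theorem mem_span_relations {m n : ℕ} (z : Fin (n + 1) → List K) (L : Fin m → List K)
    (d : Fin m → ℕ) (x : VecPair K (n + 1)) :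
    x ∈ Submodule.span K {y | y ∈ relations z L d} ↔
      x.2 = 0 ∧ ∀ r ∈ conditions z L d, dot x r = 0 := by
  rw [← mem_span_leftBasis]
  exact (valid_sift _ _).mem_span x

end Sift

end PolyComp

/-! ### Correctness of the enumeration -/

namespace PolyComp

open Enc (enc)

universe u v w

section Enumeration

variable {K : Type u} [Field K] {N : ℕ}

/-- All extensions of the paths `cur` by the levels `ls`. -/
def full (ls : List (Level K N)) (cur : List (Path K N)) : List (Path K N) :=
  ls.foldl (fun c l => expand l c) cur

theorem full_cons (l : Level K N) (ls : List (Level K N)) (cur : List (Path K N)) :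
    full (l :: ls) cur = full ls (expand l cur) := rfl

theorem full_eq_flatMap (ls : List (Level K N)) (cur : List (Path K N)) :
    full ls cur = cur.flatMap fun x => full ls [x] := by
  induction ls generalizing cur with
  | nil => simp [full]
  | cons l ls ih =>
    rw [full_cons, ih, expand, List.flatMap_assoc]
    refine List.flatMap_congr fun x _ => ?_
    rw [full_cons, ih (expand l [x])]
    simp [expand]

open Classical in
/-- The extensions with nonzero weight. -/
noncomputable def fullSupport (ls : List (Level K N)) (cur : List (Path K N)) : List (Path K N) :=
  (full ls cur).filter fun x => ¬ weight x = 0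

theorem fullSupport_eq_flatMap (ls : List (Level K N)) (cur : List (Path K N)) :
    fullSupport ls cur = cur.flatMap fun x => fullSupport ls [x] := by
  rw [fullSupport, full_eq_flatMap, List.filter_flatMap]
  rfl

/-- Extending a path multiplies its weight vector by one factor of the level, so the completions are
tested by exactly the products that `suffixRows` represents. The coordinates `b` chosen so far play
no role. -/
theorem dot_suffixRows (ls : List (Level K N)) (b : List K) (μ : Fin N → K) :
    (∀ r ∈ suffixRows ls, dot (μ, 0) r = 0) ↔ ∀ x ∈ full ls [(b, μ)], weight x = 0 := by
  induction ls generalizing b μ with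
  | nil => simp [suffixRows, products, full, dot, weight]
  | cons l ls ih =>
    rw [suffixRows, List.map_cons, dot_products_cons, full_cons, full_eq_flatMap]
    simp only [List.mem_map, forall_exists_index, and_imp, expand, List.flatMap_cons,
      List.flatMap_nil, List.append_nil, List.mem_flatMap]
    constructor
    · rintro h x _ s hs rfl hx
      refine (ih (s.1 :: b) (μ * s.2)).1 (fun r hr => ?_) x hx
      have := h _ s hs rfl r hr
      rwa [Prod.mk_mul_mk, zero_mul] at this
    · rintro h _ s hs rfl r hr
      rw [Prod.mk_mul_mk, zero_mul]
      exact (ih (s.1 :: b) (μ * s.2)).2 (fun x hx => h x _ s hs rfl hx) r hr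

theorem prune_eq (ls : List (Level K N)) (cur : List (Path K N)) :
    prune (suffixRows ls) cur = cur.filter fun x => fullSupport ls [x] ≠ [] := by
  classical
  rw [prune]
  refine List.filter_congr fun x _ => ?_
  rw [decide_eq_decide, not_iff_not, fullSupport]
  have := dot_suffixRows ls x.1 x.2
  simpa using this

theorem fullSupport_prune (ls : List (Level K N)) (cur : List (Path K N)) :
    fullSupport ls (prune (suffixRows ls) cur) = fullSupport ls cur := by
  rw [prune_eq, fullSupport_eq_flatMap, fullSupport_eq_flatMap ls cur]
  induction cur with
  | nil => rfl
  | cons x cur ih => by_cases h : fullSupport ls [x] = [] <;> simp_all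

/-- Every surviving path contributes at least one completion of nonzero weight. -/
theorem prune_length_le (ls : List (Level K N)) (cur : List (Path K N)) :
    (prune (suffixRows ls) cur).length ≤ (fullSupport ls cur).length := by
  rw [prune_eq, fullSupport_eq_flatMap]
  induction cur with
  | nil => simp
  | cons x cur ih =>
    by_cases h : fullSupport ls [x] = []
    · simpa [h] using ih
    · have := List.length_pos_of_ne_nil h
      simp only [ne_eq, h, not_false_eq_true, decide_true, List.filter_cons_of_pos,
        List.length_cons, List.flatMap_cons, List.length_append]
      simp only [ne_eq] at ih
      omega

theorem foldl_enumStep_nil (bound : ℕ) (ls rem : List (Level K N)) :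
    (ls.foldl (enumStep bound) (rem, [])).2 = [] := by
  induction ls generalizing rem with
  | nil => rfl
  | cons l ls ih => rw [List.foldl_cons, enumStep]; exact ih _

/-- Pruning does not alter the completions of nonzero weight and leaves at most as many paths as
there are such completions. Hence the loop can fail only if the support exceeds the bound. -/
theorem foldl_enumStep (bound : ℕ) (ls : List (Level K N)) (cur : List (Path K N)) :
    (∀ r ∈ (ls.foldl (enumStep bound) (ls, [cur])).2, fullSupport [] r = fullSupport ls cur ∧
        (cur.length ≤ bound → r.length ≤ bound)) ∧
      ((fullSupport ls cur).length ≤ bound →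
        (ls.foldl (enumStep bound) (ls, [cur])).2 ≠ []) := by
  induction ls generalizing cur with
  | nil => simp
  | cons l ls ih =>
    rw [List.foldl_cons]
    by_cases h : (prune (suffixRows ls) (expand l cur)).length ≤ bound
    · have hstep : enumStep bound (l :: ls, [cur]) l =
          (ls, [prune (suffixRows ls) (expand l cur)]) := by simp [enumStep, h]
      rw [hstep]
      obtain ⟨h1, h2⟩ := ih (prune (suffixRows ls) (expand l cur))
      rw [fullSupport_prune] at h1 h2
      exact ⟨fun r hr => ⟨(h1 r hr).1, fun _ => (h1 r hr).2 h⟩, h2⟩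
    · have hstep : enumStep bound (l :: ls, [cur]) l = (ls, []) := by simp [enumStep, h]
      rw [hstep]
      refine ⟨by simp [foldl_enumStep_nil], fun h' => absurd ?_ h⟩
      exact (prune_length_le _ _).trans h'

theorem enum_spec {bound : ℕ} (hb : 1 ≤ bound) (ls : List (Level K N)) (μ : Fin N → K) :
    (∀ r ∈ enum bound ls μ, fullSupport [] r = fullSupport ls [([], μ)] ∧ r.length ≤ bound) ∧
      ((fullSupport ls [([], μ)]).length ≤ bound → enum bound ls μ ≠ []) := by
  obtain ⟨h1, h2⟩ := foldl_enumStep bound ls [(([] : List K), μ)]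
  exact ⟨fun r hr => ⟨(h1 r hr).1, (h1 r hr).2 hb⟩, h2⟩

theorem expand_sublist {l l' : Level K N} {c c' : List (Path K N)} (hl : l.Sublist l')
    (hc : c.Sublist c') : (expand l c).Sublist (expand l' c') := by
  induction hc with
  | slnil => simp [expand]
  | cons a _ ih =>
    rw [expand, expand, List.flatMap_cons]
    exact ih.trans (List.sublist_append_right _ _)
  | cons_cons a _ ih =>
    rw [expand, expand, List.flatMap_cons, List.flatMap_cons]
    exact (hl.map _).append ih

theorem cands_sublist (bound : ℕ) (ls : List (Level K N)) {c c' : List (Path K N)}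
    (h : c.Sublist c') : (ls.foldl (candStep bound) c).Sublist (full ls c') := by
  induction ls generalizing c c' with
  | nil => exact h
  | cons l ls ih =>
    refine ih ?_
    rw [candStep]
    split_ifs
    · exact expand_sublist (List.Sublist.refl l) h
    · exact expand_sublist (List.take_sublist 1 l) h

theorem expand_length (l : Level K N) (c : List (Path K N)) :
    (expand l c).length = c.length * l.length := by
  simp [expand]

theorem length_le_candStep {bound : ℕ} {l : Level K N} (hl : l ≠ []) (c : List (Path K N)) :
    c.length ≤ (candStep bound c l).length := by
  have := List.length_pos_of_ne_nil hl
  rw [candStep]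
  split_ifs <;> rw [expand_length]
  · exact Nat.le_mul_of_pos_right _ this
  · exact Nat.le_mul_of_pos_right _ (by rw [List.length_take]; omega)

theorem length_le_cands (bound : ℕ) {ls : List (Level K N)} (hls : ∀ l ∈ ls, l ≠ [])
    (c : List (Path K N)) : c.length ≤ (ls.foldl (candStep bound) c).length := by
  induction ls generalizing c with
  | nil => rfl
  | cons l ls ih =>
    exact (length_le_candStep (hls l List.mem_cons_self) c).trans
      (ih (fun l hl => hls l (List.mem_cons_of_mem _ hl)) _)

/-- A short list is expanded completely; once it is longer than the bound, nonempty levels keep it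
so. -/
theorem cands_eq_or (bound : ℕ) {ls : List (Level K N)} (hls : ∀ l ∈ ls, l ≠ [])
    (c : List (Path K N)) : ls.foldl (candStep bound) c = full ls c ∨
      bound < (ls.foldl (candStep bound) c).length := by
  induction ls generalizing c with
  | nil => exact Or.inl rfl
  | cons l ls ih =>
    by_cases hc : c.length ≤ bound
    · have := ih (fun l hl => hls l (List.mem_cons_of_mem _ hl)) (expand l c)
      rwa [List.foldl_cons, candStep, if_pos hc, full_cons]
    · exact Or.inr ((not_le.1 hc).trans_le (length_le_cands bound hls c))

theorem full_reverse_cons (l : Level K N) (ls : List (Level K N)) (c : List (Path K N)) :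
    full (l :: ls).reverse c = expand l (full ls.reverse c) := by
  simp [full, List.foldl_append]

theorem sum_map_expand {M : Type*} [AddCommMonoid M] (G : Path K N → M) (l : Level K N)
    (c : List (Path K N)) : ((expand l c).map G).sum =
      (c.map fun x => (l.map fun s => G (s.1 :: x.1, x.2 * s.2)).sum).sum := by
  induction c with
  | nil => rfl
  | cons x c ih =>
    rw [expand, List.flatMap_cons, List.map_append, List.sum_append, List.map_cons, List.sum_cons,
      ← ih, List.map_map]
    rfl

/-- Sums over all paths are sums over a product set. -/
theorem sum_full {M : Type*} [AddCommMonoid M] {m : ℕ} {A : Fin m → Finset K} {L : Fin m → List K}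
    (hnodup : ∀ i, (L i).Nodup) (hL : ∀ i x, x ∈ L i ↔ x ∈ A i) (V : Fin m → K → Fin N → K)
    (μ : Fin N → K) (G : Path K N → M) :
    ((full (List.ofFn fun i => (L i).map fun s => (s, V i s)).reverse [([], μ)]).map G).sum =
      ∑ a ∈ Fintype.piFinset A, G (List.ofFn a, μ * ∏ i, V i (a i)) := by
  classical
  induction m generalizing G with
  | zero => simp [full]
  | succ m ih =>
    rw [List.ofFn_succ, full_reverse_cons, sum_map_expand,
      ih (A := fun i => A i.succ) (fun i => hnodup i.succ) (fun i => hL i.succ)]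
    have hA : (L 0).toFinset = A 0 := by ext x; simp [hL]
    have : ∀ x : Path K N, ((((L 0).map fun s => (s, V 0 s))).map fun s =>
        G (s.1 :: x.1, x.2 * s.2)).sum = ∑ s ∈ A 0, G (s :: x.1, x.2 * V 0 s) := fun x => by
      rw [← hA, List.sum_toFinset _ (hnodup 0), List.map_map]
      rfl
    refine (Finset.sum_congr rfl fun a _ => this (List.ofFn a, μ * ∏ i, V i.succ (a i))).trans ?_
    rw [← Finset.sum_product']
    refine Finset.sum_nbij' (fun p => Fin.cons p.2 p.1) (fun a => (fun i => a i.succ, a 0))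
      ?_ ?_ ?_ ?_ ?_
    · rintro ⟨a, s⟩ h
      simp only [Finset.mem_product, Fintype.mem_piFinset] at h
      rw [Fintype.mem_piFinset]
      intro i
      refine Fin.cases ?_ (fun i => ?_) i
      · simpa using h.2
      · simpa using h.1 i
    · intro a h
      rw [Fintype.mem_piFinset] at h
      simp only [Finset.mem_product, Fintype.mem_piFinset]
      exact ⟨fun i => h i.succ, h 0⟩
    · rintro ⟨a, s⟩ _
      simp
    · intro a _
      exact Fin.cons_self_tail a
    · rintro ⟨a, s⟩ _
      simp only [List.ofFn_succ, Fin.cons_zero, Fin.cons_succ, Fin.prod_univ_succ]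
      congr 2
      ring

end Enumeration

end PolyComp

/-! ### The running time of the algorithm -/

namespace PolyComp

open Enc (enc)

universe u v w

/-- The bound is `bound + 1` because the initial list has one path even if `bound` is `0`. -/
theorem enumStep_inv {K : Type u} [Field K] {N bound : ℕ} {ls : List (Level K N)}
    {st : List (Level K N) × List (List (Path K N))} (l : Level K N)
    (h : st.1 <:+ ls ∧ st.2.length ≤ 1 ∧ ∀ cur ∈ st.2, cur.length ≤ bound + 1) :
    (enumStep bound st l).1 <:+ ls ∧ (enumStep bound st l).2.length ≤ 1 ∧
      ∀ cur ∈ (enumStep bound st l).2, cur.length ≤ bound + 1 := by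
  obtain ⟨rem, o⟩ := st
  obtain ⟨h1, h2, h3⟩ := h
  refine ⟨(List.tail_suffix rem).trans h1, ?_, ?_⟩
  · rcases o with _ | ⟨c, _ | ⟨c', o⟩⟩
    · simp [enumStep]
    · simp only [enumStep, List.flatMap_cons, List.flatMap_nil, List.append_nil]
      split_ifs <;> simp
    · simp at h2
  · intro cur hcur
    simp only [enumStep, List.mem_flatMap] at hcur
    obtain ⟨c, _, hc⟩ := hcur
    split_ifs at hc with hb
    · rw [List.mem_singleton.1 hc]
      omega
    · simp at hc

theorem foldl_inv {α β : Type*} {f : β → α → β} {p : β → Prop} (l : List α)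
    (hf : ∀ b, ∀ a ∈ l, p b → p (f b a)) {b : β} (hb : p b) : p (l.foldl f b) := by
  induction l generalizing b with
  | nil => exact hb
  | cons a l ih =>
    exact ih (fun b c hc => hf b c (List.mem_cons_of_mem _ hc)) (hf b a List.mem_cons_self hb)

theorem enum_length {K : Type u} [Field K] {N : ℕ} (bound : ℕ) (ls : List (Level K N))
    (μ : Fin N → K) : (enum bound ls μ).length ≤ 1 ∧
      ∀ cur ∈ enum bound ls μ, cur.length ≤ bound + 1 :=
  (foldl_inv (p := fun st : List (Level K N) × List (List (Path K N)) =>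
      st.1 <:+ ls ∧ st.2.length ≤ 1 ∧ ∀ cur ∈ st.2, cur.length ≤ bound + 1)
    ls (fun _ l _ h => enumStep_inv l h) (b := (ls, [[([], μ)]]))
    ⟨List.suffix_refl _, le_rfl, by simp⟩).2

/-- At most `bound` paths are ever expanded in full, each at most `b` times; longer lists do not
grow. -/
theorem candStep_length {K : Type u} [Field K] {N bound b : ℕ} {l : Level K N}
    (hl : l.length ≤ b) {cur : List (Path K N)} (hc : cur.length ≤ (bound + 1) * (b + 1)) :
    (candStep bound cur l).length ≤ (bound + 1) * (b + 1) := by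
  rw [candStep]
  split_ifs with h
  · rw [expand_length]
    exact Nat.mul_le_mul (by omega) (by omega)
  · rw [expand_length, List.length_take]
    exact (Nat.mul_le_mul_left _ (min_le_left _ _)).trans (by omega)

theorem cands_length {K : Type u} [Field K] {N bound b : ℕ} {ls : List (Level K N)}
    (hls : ∀ l ∈ ls, l.length ≤ b) (μ : Fin N → K) :
    (cands bound ls μ).length ≤ (bound + 1) * (b + 1) :=
  foldl_inv (p := fun c : List (Path K N) => c.length ≤ (bound + 1) * (b + 1)) ls
    (fun _ l hl h => candStep_length (hls l hl) h)
    (by simp only [List.length_singleton]; exact Nat.succ_le_of_lt (by positivity))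

namespace Comp

variable {J : Type w} {S : J → Setting.{u}} {α : J → Type*} [∀ j, Enc (S j).F (α j)]
  {x : ∀ j, α j} {N m : J → ℕ}

theorem unit_vectors (hN : PolyBdd S N) (hidx : Comp S x fun j => fun i : Fin (N j) => (i : ℕ)) :
    Comp S x fun j => fun i : Fin (N j) => (Pi.single i 1 : Fin (N j) → (S j).F) := by
  classical
  -- Equality of two indices is tested by two comparisons.
  refine hidx.ofFn hN (toVec (toList (hidx.lift.ofFn (hN.reindex _)
    (y := fun p k => if (p.2 : ℕ) ≤ k then if (k : ℕ) ≤ p.2 then (1 : (S p.1).F) else 0 else 0)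
    ?_)) |>.congr fun p => ?_)
  · have h1 : PolyBdd (fun q : Σ p : (Σ j, Fin (N j)), Fin (N p.1) => S q.1.1)
        fun q => (q.1.2 : ℕ) := (hN.reindex _).mono fun q => q.1.2.2.le
    have h2 : PolyBdd (fun q : Σ p : (Σ j, Fin (N j)), Fin (N p.1) => S q.1.1)
        fun q => (q.2 : ℕ) := (hN.reindex fun q : Σ p : (Σ j, Fin (N j)), Fin (N p.1) => q.1.1).mono fun q => q.2.2.le
    exact ite (refl.snd.fst.le_nat refl.fst h2) (ite (refl.fst.le_nat refl.snd.fst h1) one zero)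
      zero
  · ext k
    rw [Pi.single_apply]
    by_cases hk : k = p.2
    · simp [hk]
    · have : (k : ℕ) ≠ p.2 := fun h => hk (Fin.ext h)
      rw [if_neg hk]
      split_ifs <;> first | rfl | omega

theorem zero_vec (hN : PolyBdd S N) (hidx : Comp S x fun j => fun i : Fin (N j) => (i : ℕ)) :
    Comp S x fun j => (0 : Fin (N j) → (S j).F) := hidx.vec_const hN zero

theorem one_vec (hN : PolyBdd S N) (hidx : Comp S x fun j => fun i : Fin (N j) => (i : ℕ)) :
    Comp S x fun j => (1 : Fin (N j) → (S j).F) := hidx.vec_const hN one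

theorem leftBasis (hN : PolyBdd S N) (hidx : Comp S x fun j => fun i : Fin (N j) => (i : ℕ)) :
    Comp S x fun j => leftBasis (S j).F (N j) :=
  ((unit_vectors hN hidx).vec_zip (hidx.vec_const hN (zero_vec hN hidx)) hN).toList

theorem stdBasis (hN : PolyBdd S N) (hidx : Comp S x fun j => fun i : Fin (N j) => (i : ℕ)) :
    Comp S x fun j => stdBasis (S j).F (N j) :=
  (leftBasis hN hidx).append
    (((hidx.vec_const hN (zero_vec hN hidx)).vec_zip (unit_vectors hN hidx) hN).toList)
    (hN.mono fun j => by simp [PolyComp.leftBasis])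

theorem productStep {rows lev : ∀ j, List (VecPair (S j).F (N j))} (hrows : Comp S x rows)
    (hlev : Comp S x lev) (hN : PolyBdd S N)
    (hidx : Comp S x fun j => fun i : Fin (N j) => (i : ℕ))
    (hb : PolyBdd S fun j => (rows j).length) (hb' : PolyBdd S fun j => (lev j).length) :
    Comp S x fun j => productStep (rows j) (lev j) := by
  refine ((stdBasis hN hidx).sift (hrows.flatMap hb hb' (fun j e _ => by simp)
    (hlev.lift.map (hb'.reindex _) (refl.snd.fst.pair_mul refl.fst (hN.reindex _)))) hN
    ((hN.add hN).mono fun j => ?_) ((hb.mul hb').mono fun j => by simp)).fst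
  simp [PolyComp.stdBasis, PolyComp.leftBasis, PolyComp.rightBasis]

/-- The invariant of the loop is `productStep_length`: no intermediate list is long, although the
number of products is exponential. -/
theorem products {start : ∀ j, VecPair (S j).F (N j)}
    {ls : ∀ j, List (List (VecPair (S j).F (N j)))} {b : J → ℕ} (hs : Comp S x start)
    (hls : Comp S x ls) (hN : PolyBdd S N)
    (hidx : Comp S x fun j => fun i : Fin (N j) => (i : ℕ))
    (hlen : PolyBdd S fun j => (ls j).length) (hb : PolyBdd S b)
    (hlb : ∀ j, ∀ l ∈ ls j, l.length ≤ b j) : Comp S x fun j => products (start j) (ls j) := by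
  refine foldr (fun j rows => rows.length ≤ N j + N j + 1) hls hs.singleton hlen (fun j => ?_)
    (fun j a e _ _ => (productStep_length _ _).trans (Nat.le_succ _)) ?_
  · simp
  · refine refl.snd.snd.productStep refl.fst (hN.reindex _) hidx.lift₂ ?_ ?_
    · exact (((hN.add hN).add (.const 1)).reindex Sigma.fst).mono fun p => p.2.2.2
    · exact (hb.reindex Sigma.fst).mono fun p => hlb _ _ p.2.1.2

theorem lag {l : ∀ j, List (S j).F} {s y : ∀ j, (S j).F} (hl : Comp S x l) (hs : Comp S x s)
    (hy : Comp S x y) (hb : PolyBdd S fun j => (l j).length) :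
    Comp S x fun j => lag (l j) (s j) (y j) := by
  classical
  refine ((hl.map hb (f := fun j t => if s j - t = 0 then 1 else (y j - t) / (s j - t))
    (ite (hs.lift.sub refl.fst).eq_zero one
      ((hy.lift.sub refl.fst).div (hs.lift.sub refl.fst)))).list_prod
    (by simpa using hb)).congr fun j => ?_
  simp only [PolyComp.lag]

theorem atCoord {p : ∀ j, List (S j).F} {i : J → ℕ} {f : ∀ j, (S j).F → (S j).F}
    {c : ∀ j, (S j).F} (hp : Comp S x p) (hi : Comp S x i) (hib : PolyBdd S i) (hc : Comp S x c)
    (hf : Comp (fun q : Σ j, (S j).F => S q.1) (fun q => (q.2, x q.1)) (fun q => f q.1 q.2)) :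
    Comp S x fun j => atCoord (p j) (i j) (f j) (c j) := by
  have hd := hp.drop hi hib
  refine cond hd.eq_nil ((hc.reindex _).congr fun j => by simp only [PolyComp.atCoord, j.2]) ?_
  choose a t ha using fun j : {j // ¬ (p j).drop (i j) = []} => List.exists_cons_of_ne_nil j.2
  have h := (((hd.reindex Subtype.val).head fun j => ⟨t j, ha j⟩).pair refl).trans
    (hf.reindex fun j : {j // ¬ (p j).drop (i j) = []} => ⟨j, a j⟩)
  exact h.congr fun j => by simp only [PolyComp.atCoord, ha j]

section Vectors

variable {z : ∀ j, Fin (N j) → List (S j).F} {l : ∀ j, List (S j).F} {i i' e d : J → ℕ}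
  {s : ∀ j, (S j).F}

theorem lagVec (hz : Comp S x z) (hl : Comp S x l) (hi : Comp S x i) (hs : Comp S x s)
    (hN : PolyBdd S N) (hb : PolyBdd S fun j => (l j).length) (hib : PolyBdd S i) :
    Comp S x fun j => lagVec (z j) (l j) (i j) (s j) :=
  hz.ofFn hN (refl.fst.atCoord hi.lift (hib.reindex _) one
    (hl.lift.lift.lag hs.lift.lift refl.fst (hb.reindex _)))

theorem powVec (hz : Comp S x z) (hl : Comp S x l) (hi : Comp S x i) (he : Comp S x e)
    (hN : PolyBdd S N) (hb : PolyBdd S fun j => (l j).length) (hib : PolyBdd S i)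
    (heb : PolyBdd S e) : Comp S x fun j => powVec (z j) (l j) (i j) (e j) := by
  have hsum : Comp S x fun j => ((l j).map (· ^ e j)).sum :=
    (hl.map hb (refl.fst.pow he.lift (heb.reindex _))).list_sum (by simpa using hb)
  exact hz.ofFn hN (refl.fst.atCoord hi.lift (hib.reindex _) hsum.lift
    (refl.fst.pow (refl.snd.snd.trans (he.reindex fun q : Σ p : (Σ j, Fin (N j)), (S p.1).F => q.1.1)) (heb.reindex _)))

theorem vec_apply_sum {ε : J → Type*} [∀ j, Enc (S j).F (ε j)] {l : ∀ j, List (ε j)}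
    {y : ∀ j, ε j → Fin (N j) → (S j).F} (hl : Comp S x l)
    (hb : PolyBdd S fun j => (l j).length) (hN : PolyBdd S N)
    (hidx : Comp S x fun j => fun i : Fin (N j) => (i : ℕ))
    (hy : Comp (fun q : Σ j, {t // t ∈ l j} => S q.1) (fun q => (q.2.1, x q.1))
      (fun q => y q.1 q.2.1)) :
    Comp S x fun j => fun k : Fin (N j) => ((l j).map fun t => y j t k).sum := by
  have := foldl (l := fun j => (l j).map (y j)) (s := fun j => (0 : Fin (N j) → (S j).F))
    (step := fun j a b => fun k => a k + b k) (fun _ _ => True) (hl.map hb hy) (zero_vec hN hidx)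
    (by simpa using hb) (fun _ => trivial) (fun _ _ _ _ _ => trivial)
    (refl.snd.snd.vec_map₂ refl.fst (hN.reindex _) (refl.fst.fst.add refl.fst.snd))
  refine this.congr fun j => ?_
  ext k
  have : ∀ (t : List (ε j)) (a : Fin (N j) → (S j).F),
      (t.map (y j)).foldl (fun a b => fun k => a k + b k) a k =
        a k + (t.map fun t => y j t k).sum := by
    intro t
    induction t with
    | nil => simp
    | cons t ts ih =>
      intro a
      rw [List.map_cons, List.foldl_cons, ih, List.map_cons, List.sum_cons, add_assoc]
  rw [this]
  simp

theorem powLagVec (hz : Comp S x z) (hl : Comp S x l) (hi : Comp S x i) (he : Comp S x e)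
    (hN : PolyBdd S N) (hb : PolyBdd S fun j => (l j).length) (hib : PolyBdd S i)
    (heb : PolyBdd S e) : Comp S x fun j => powLagVec (z j) (l j) (i j) (e j) := by
  refine hl.vec_apply_sum hb hN (hz.vec_index hN)
    (y := fun j s k => s ^ e j * PolyComp.lagVec (z j) (l j) (i j) s k) ?_
  exact (refl.fst.pow he.lift (heb.reindex _)).vec_smul
    (hz.lift.lagVec hl.lift hi.lift refl.fst (hN.reindex _) (hb.reindex _) (hib.reindex _))
    (hN.reindex _)

theorem powLevel (hz : Comp S x z) (hl : Comp S x l) (hd : Comp S x d) (hi : Comp S x i)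
    (hi' : Comp S x i') (hN : PolyBdd S N) (hb : PolyBdd S fun j => (l j).length)
    (hdb : PolyBdd S d) (hib : PolyBdd S i) (hib' : PolyBdd S i') :
    Comp S x fun j => powLevel (z j) (l j) (d j) (i j) (i' j) := by
  refine (hd.succ.range (hdb.add (.const 1))).map
    ((hdb.add (.const 1)).mono fun j => by simp) ?_
  have he : PolyBdd (fun q : Σ j, {e // e ∈ List.range (d j + 1)} => S q.1) fun q => q.2.1 :=
    ((hdb.add (.const 1)).reindex Sigma.fst).mono fun q => (List.mem_range.1 q.2.2).le
  exact (hz.lift.powVec hl.lift hi.lift refl.fst (hN.reindex _) (hb.reindex _) (hib.reindex _)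
    he).pair (hz.lift.powLagVec hl.lift hi'.lift refl.fst (hN.reindex _) (hb.reindex _)
      (hib'.reindex _) he)

theorem palLevel (hz : Comp S x z) (hl : Comp S x l) (hi : Comp S x i)
    (hi' : Comp S x i') (hN : PolyBdd S N) (hb : PolyBdd S fun j => (l j).length)
    (hib : PolyBdd S i) (hib' : PolyBdd S i') :
    Comp S x fun j => palLevel (z j) (l j) (i j) (i' j) := by
  have hidx := hz.vec_index hN
  have h1 := one_vec hN hidx
  have h := (hz.lift (e := fun q : Σ j, {s // s ∈ l j} => q.2.1)).lagVec hl.lift hi.lift refl.fst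
    (hN.reindex _) (hb.reindex _) (hib.reindex _)
  have h' := (hz.lift (e := fun q : Σ j, {s // s ∈ l j} => q.2.1)).lagVec hl.lift hi'.lift refl.fst
    (hN.reindex _) (hb.reindex _) (hib'.reindex _)
  exact ite (hi'.le_nat hi hib) (ite (hi.le_nat hi' hib') (hl.map hb (h.pair h1.lift))
    (h1.pair h1).singleton) (hl.map hb ((h.vec_mul h' (hN.reindex _)).pair h1.lift))

end Vectors

section Levels

variable {L : ∀ j, Fin (m j) → List (S j).F} {d : ∀ j, Fin (m j) → ℕ} {a b : J → ℕ}
  {z : ∀ j, Fin (N j) → List (S j).F}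

/-- The data for level `i`: its number, the number of its mirror image, its list of elements. -/
theorem level_data (hL : Comp S x L) (hm : PolyBdd S m) :
    Comp S x fun j => fun i : Fin (m j) => (((i : ℕ), (i.rev : ℕ)), L j i) :=
  ((hL.vec_index hm).vec_zip ((hL.vec_index hm).vec_rev hm) hm).vec_zip hL hm

theorem index_le (hm : PolyBdd S m) :
    PolyBdd (fun p : Σ j, Fin (m j) => S p.1) fun p => (p.2 : ℕ) :=
  (hm.reindex Sigma.fst).mono fun p => p.2.2.le

theorem index_rev_le (hm : PolyBdd S m) :
    PolyBdd (fun p : Σ j, Fin (m j) => S p.1) fun p => (p.2.rev : ℕ) :=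
  (hm.reindex Sigma.fst).mono fun p => p.2.rev.2.le

theorem powRows (hz : Comp S x z) (hL : Comp S x L) (hd : Comp S x d) (hN : PolyBdd S N)
    (hm : PolyBdd S m) (ha : PolyBdd S a) (hLa : ∀ j i, (L j i).length ≤ a j) (hb : PolyBdd S b)
    (hdb : ∀ j i, d j i ≤ b j) : Comp S x fun j => powRows (z j) (L j) (d j) := by
  have hidx := hz.vec_index hN
  refine ((one_vec hN hidx).pair (one_vec hN hidx)).products
    (toList (((level_data hL hm).vec_zip hd hm).ofFn hm ?_)) hN hidx (by simpa using hm)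
    (hb.add (.const 1)) ?_
  · exact (hz.lift).powLevel refl.fst.fst.snd refl.fst.snd refl.fst.fst.fst.fst
      refl.fst.fst.fst.snd (hN.reindex _) ((ha.reindex Sigma.fst).mono fun p => hLa _ _)
      ((hb.reindex Sigma.fst).mono fun p => hdb _ _) (index_le hm) (index_rev_le hm)
  · intro j l hl
    obtain ⟨i, rfl⟩ := (List.mem_ofFn).1 hl
    simpa [PolyComp.powLevel] using hdb j i

theorem palRows (hz : Comp S x z) (hL : Comp S x L) (hN : PolyBdd S N)
    (hm : PolyBdd S m) (ha : PolyBdd S a) (hLa : ∀ j i, (L j i).length ≤ a j) :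
    Comp S x fun j => palRows (z j) (L j) := by
  have hidx := hz.vec_index hN
  refine ((one_vec hN hidx).pair (zero_vec hN hidx)).products
    (toList ((level_data hL hm).ofFn hm ?_)) hN hidx (by simpa using hm)
    (ha.add (.const 1)) ?_
  · exact (hz.lift).palLevel refl.fst.snd refl.fst.fst.fst
      refl.fst.fst.snd (hN.reindex _) ((ha.reindex Sigma.fst).mono fun p => hLa _ _)
      (index_le hm) (index_rev_le hm)
  · intro j l hl
    obtain ⟨i, rfl⟩ := (List.mem_ofFn).1 hl
    have := hLa j i
    simp only [PolyComp.palLevel]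
    split_ifs <;> simp <;> omega

theorem lagLevels (hz : Comp S x z) (hL : Comp S x L) (hN : PolyBdd S N)
    (hm : PolyBdd S m) (ha : PolyBdd S a) (hLa : ∀ j i, (L j i).length ≤ a j) :
    Comp S x fun j => lagLevels (z j) (L j) := by
  refine (toList ((level_data hL hm).ofFn hm ?_)).reverse (by simpa using hm)
  have hb : PolyBdd (fun p : Σ j, Fin (m j) => S p.1) fun p => (L p.1 p.2).length :=
    (ha.reindex Sigma.fst).mono fun p => hLa _ _
  exact refl.fst.snd.map hb (refl.fst.pair ((hz.lift.lift).lagVec refl.snd.fst.snd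
    refl.snd.fst.fst.fst refl.fst (hN.reindex _) (hb.reindex _) ((index_le hm).reindex _)))

theorem searchBound {K : J → ℕ} (hL : Comp S x L) (hK : Comp S x K) (hKb : PolyBdd S K)
    (hm : PolyBdd S m) (ha : PolyBdd S a) (hLa : ∀ j i, (L j i).length ≤ a j) :
    Comp S x (fun j => searchBound (K j) (L j)) ∧ PolyBdd S fun j => searchBound (K j) (L j) := by
  have hs : Comp S x fun j => (List.ofFn fun i => (L j i).length).sum :=
    (toList (hL.ofFn hm (refl.fst.length ((ha.reindex Sigma.fst).mono fun p => hLa _ _)))).list_sum_nat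
      (by simpa using hm) ha fun j k hk => by
        obtain ⟨i, rfl⟩ := List.mem_ofFn.1 hk
        exact hLa j i
  have hsb : PolyBdd S fun j => (List.ofFn fun i => (L j i).length).sum :=
    PolyBdd.listSum (by simpa using hm) ha fun j k hk => by
        obtain ⟨i, rfl⟩ := List.mem_ofFn.1 hk
        exact hLa j i
  exact ⟨hK.mul_nat (hK.mul_nat hs hKb hsb) hKb (hKb.mul hsb), hKb.mul (hKb.mul hsb)⟩

end Levels

section Search

variable {ls : ∀ j, List (Level (S j).F (N j))} {cur : ∀ j, List (Path (S j).F (N j))}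
  {l : ∀ j, Level (S j).F (N j)} {bound a : J → ℕ} {μ : ∀ j, Fin (N j) → (S j).F}

theorem expand (hl : Comp S x l) (hcur : Comp S x cur) (hN : PolyBdd S N)
    (hb : PolyBdd S fun j => (l j).length) (hb' : PolyBdd S fun j => (cur j).length) :
    Comp S x fun j => expand (l j) (cur j) :=
  hcur.flatMap hb' hb (fun j e _ => by simp) (hl.lift.map (hb.reindex _)
    ((refl.fst.fst.cons refl.snd.fst.fst).pair
      (refl.snd.fst.snd.vec_mul refl.fst.snd (hN.reindex _))))

theorem suffixRows (hls : Comp S x ls) (hN : PolyBdd S N)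
    (hidx : Comp S x fun j => fun i : Fin (N j) => (i : ℕ))
    (hlen : PolyBdd S fun j => (ls j).length) (ha : PolyBdd S a)
    (hla : ∀ j, ∀ l ∈ ls j, l.length ≤ a j) : Comp S x fun j => suffixRows (ls j) := by
  refine ((one_vec hN hidx).pair (zero_vec hN hidx)).products (hls.map hlen (refl.fst.map
    ((ha.reindex Sigma.fst).mono fun p => hla _ _ p.2.2) (refl.fst.snd.pair refl.fst.snd)))
    hN hidx (by simpa using hlen) ha fun j l hl => ?_
  obtain ⟨l', hl', rfl⟩ := List.mem_map.1 hl
  simpa using hla j l' hl'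

theorem prune {rows : ∀ j, List (VecPair (S j).F (N j))} (hrows : Comp S x rows)
    (hcur : Comp S x cur) (hN : PolyBdd S N)
    (hidx : Comp S x fun j => fun i : Fin (N j) => (i : ℕ))
    (hb : PolyBdd S fun j => (rows j).length) (hb' : PolyBdd S fun j => (cur j).length) :
    Comp S x fun j => prune (rows j) (cur j) := by
  classical
  refine hcur.filter hb' (not (eq_nil (hrows.lift.filter (hb.reindex _) ?_)))
  exact ((refl.snd.fst.snd.pair (zero_vec (hN.reindex _) hidx.lift.lift)).dot refl.fst
    (hN.reindex _)).eq_zero.not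

theorem enum (hls : Comp S x ls) (hμ : Comp S x μ) (hbound : Comp S x bound) (hN : PolyBdd S N)
    (hbb : PolyBdd S bound) (hlen : PolyBdd S fun j => (ls j).length) (ha : PolyBdd S a)
    (hla : ∀ j, ∀ l ∈ ls j, l.length ≤ a j) :
    Comp S x fun j => enum (bound j) (ls j) (μ j) := by
  have hidx := hμ.vec_index hN
  refine snd (foldl (fun j st => st.1 <:+ ls j ∧ st.2.length ≤ 1 ∧
    ∀ cur ∈ st.2, cur.length ≤ bound j + 1) hls (hls.pair (nil.pair hμ).singleton.singleton) hlen
    (fun j => ⟨List.suffix_refl _, by simp, by simp⟩) (fun j st l _ h => enumStep_inv l h) ?_)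
  refine refl.snd.snd.fst.tail.pair (refl.snd.snd.snd.flatMap
    ((PolyBdd.const 1).mono fun p => p.2.2.2.2.1) (.const 1)
    (fun p e _ => by split_ifs <;> simp) ?_)
  -- The levels still to come form a suffix of `ls`, so they inherit the bounds on its length and
  -- entries.
  have hsuf : ∀ p : Σ j, {e // e ∈ ls j} × {st : List (Level (S j).F (N j)) ×
      List (List (Path (S j).F (N j))) // st.1 <:+ ls j ∧ st.2.length ≤ 1 ∧
        ∀ cur ∈ st.2, cur.length ≤ bound j + 1}, p.2.2.1.1.tail <:+ ls p.1 := fun p =>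
    (List.tail_suffix _).trans p.2.2.2.1
  have hrl : PolyBdd (fun p : Σ j, {e // e ∈ ls j} × {st : List (Level (S j).F (N j)) ×
      List (List (Path (S j).F (N j))) // st.1 <:+ ls j ∧ st.2.length ≤ 1 ∧
        ∀ cur ∈ st.2, cur.length ≤ bound j + 1} => S p.1) fun p =>
          (PolyComp.suffixRows p.2.2.1.1.tail).length :=
    (((hN.add hN).add (.const 1)).reindex Sigma.fst).mono fun p => products_length _ _
  have hrows := (refl (x := fun p : Σ j, {e // e ∈ ls j} × {st : List (Level (S j).F (N j)) ×
      List (List (Path (S j).F (N j))) // st.1 <:+ ls j ∧ st.2.length ≤ 1 ∧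
        ∀ cur ∈ st.2, cur.length ≤ bound j + 1} => (p.2.1.1, x p.1, p.2.2.1))
      (S := fun p => S p.1)).snd.snd.fst.tail.suffixRows (hN.reindex _) hidx.lift₂
      ((hlen.reindex Sigma.fst).mono fun p => (hsuf p).length_le) (ha.reindex _)
      fun p l hl => hla _ _ ((hsuf p).mem hl)
  have hcurb : PolyBdd (fun q : Σ p : (Σ j, {e // e ∈ ls j} × {st : List (Level (S j).F (N j)) ×
      List (List (Path (S j).F (N j))) // st.1 <:+ ls j ∧ st.2.length ≤ 1 ∧
        ∀ cur ∈ st.2, cur.length ≤ bound j + 1}), {c // c ∈ p.2.2.1.2} => S q.1.1)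
      fun q => q.2.1.length :=
    ((hbb.add (.const 1)).reindex fun q : Σ p : (Σ j, {e // e ∈ ls j} × {st : List (Level (S j).F (N j)) ×
      List (List (Path (S j).F (N j))) // st.1 <:+ ls j ∧ st.2.length ≤ 1 ∧
        ∀ cur ∈ st.2, cur.length ≤ bound j + 1}), {c // c ∈ p.2.2.1.2} => q.1.1).mono fun q => q.1.2.2.2.2.2 _ q.2.2
  have hlb : PolyBdd (fun q : Σ p : (Σ j, {e // e ∈ ls j} × {st : List (Level (S j).F (N j)) ×
      List (List (Path (S j).F (N j))) // st.1 <:+ ls j ∧ st.2.length ≤ 1 ∧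
        ∀ cur ∈ st.2, cur.length ≤ bound j + 1}), {c // c ∈ p.2.2.1.2} => S q.1.1)
      fun q => q.1.2.1.1.length :=
    (ha.reindex fun q : Σ p : (Σ j, {e // e ∈ ls j} × {st : List (Level (S j).F (N j)) ×
      List (List (Path (S j).F (N j))) // st.1 <:+ ls j ∧ st.2.length ≤ 1 ∧
        ∀ cur ∈ st.2, cur.length ≤ bound j + 1}), {c // c ∈ p.2.2.1.2} => q.1.1).mono fun q => hla _ _ q.1.2.1.2
  have hexb := (hcurb.mul hlb)
  have hp := hrows.lift.prune (refl.snd.fst.expand refl.fst (hN.reindex _) hlb hcurb)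
    (hN.reindex _)
    (refl.snd.snd.fst.trans (hidx.reindex fun q : Σ p : (Σ j, {e // e ∈ ls j} × {st : List (Level (S j).F (N j)) ×
      List (List (Path (S j).F (N j))) // st.1 <:+ ls j ∧ st.2.length ≤ 1 ∧
        ∀ cur ∈ st.2, cur.length ≤ bound j + 1}), {c // c ∈ p.2.2.1.2} => q.1.1)) (hrl.reindex _) (hexb.mono fun q => by rw [expand_length])
  have hpb := hexb.mono (f := fun q => (PolyComp.prune (PolyComp.suffixRows q.1.2.2.1.1.tail)
    (PolyComp.expand q.1.2.1.1 q.2.1)).length) fun q => by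
      rw [← expand_length]
      exact List.length_filter_le _ _
  exact ite ((hp.length hpb).le_nat (refl.snd.snd.fst.trans (hbound.reindex fun q : Σ p : (Σ j, {e // e ∈ ls j} × {st : List (Level (S j).F (N j)) ×
      List (List (Path (S j).F (N j))) // st.1 <:+ ls j ∧ st.2.length ≤ 1 ∧
        ∀ cur ∈ st.2, cur.length ≤ bound j + 1}), {c // c ∈ p.2.2.1.2} => q.1.1)) (hbb.reindex _)) hp.singleton nil

theorem cands (hls : Comp S x ls) (hμ : Comp S x μ) (hbound : Comp S x bound) (hN : PolyBdd S N)
    (hbb : PolyBdd S bound) (hlen : PolyBdd S fun j => (ls j).length) (ha : PolyBdd S a)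
    (hla : ∀ j, ∀ l ∈ ls j, l.length ≤ a j) :
    Comp S x fun j => cands (bound j) (ls j) (μ j) := by
  refine foldl (fun j c => c.length ≤ (bound j + 1) * (a j + 1)) hls (nil.pair hμ).singleton hlen
    (fun j => Nat.succ_le_of_lt (by positivity)) (fun j c l hl h => candStep_length (hla j l hl) h)
    ?_
  have hcb : PolyBdd (fun p : Σ j, {e // e ∈ ls j} × {c : List (Path (S j).F (N j)) //
      c.length ≤ (bound j + 1) * (a j + 1)} => S p.1) fun p => p.2.2.1.length :=
    (((hbb.add (.const 1)).mul (ha.add (.const 1))).reindex Sigma.fst).mono fun p => p.2.2.2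
  have hlb : PolyBdd (fun p : Σ j, {e // e ∈ ls j} × {c : List (Path (S j).F (N j)) //
      c.length ≤ (bound j + 1) * (a j + 1)} => S p.1) fun p => p.2.1.1.length :=
    (ha.reindex Sigma.fst).mono fun p => hla _ _ p.2.1.2
  have htake : Comp (fun p : Σ j, {e // e ∈ ls j} × {c : List (Path (S j).F (N j)) //
      c.length ≤ (bound j + 1) * (a j + 1)} => S p.1) (fun p => (p.2.1.1, x p.1, p.2.2.1))
      fun p => p.2.1.1.take 1 := by
    refine cond refl.fst.eq_nil (nil.congr fun p => by
      have hp := p.2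
      dsimp only at hp
      simp [hp]) ?_
    choose h t hh using fun p : {p : Σ j, {e // e ∈ ls j} × {c : List (Path (S j).F (N j)) //
      c.length ≤ (bound j + 1) * (a j + 1)} // ¬ p.2.1.1 = []} => List.exists_cons_of_ne_nil p.2
    exact (head (y := h) refl.fst fun p => ⟨t p, hh p⟩).singleton.congr fun p => by simp [hh p]
  exact ite ((refl.snd.snd.length hcb).le_nat hbound.lift₂ (hbb.reindex _))
    (refl.fst.expand refl.snd.snd (hN.reindex _) hlb hcb)
    (htake.expand refl.snd.snd (hN.reindex _) ((PolyBdd.const 1).mono fun p => by simp) hcb)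

theorem weight {y : ∀ j, Path (S j).F (N j)} (hy : Comp S x y) (hN : PolyBdd S N) :
    Comp S x fun j => weight (y j) := hy.snd.vec_sum hN

theorem questions {r : ∀ j, (S j).F × List (Path (S j).F (N j))} (hr : Comp S x r)
    (hN : PolyBdd S N) (hb : PolyBdd S fun j => (r j).2.length) :
    Comp S x fun j => questions (r j) :=
  (nil.pair hr.fst).cons (hr.snd.map hb (refl.fst.fst.pair (refl.fst.weight (hN.reindex _))))

end Search

section Main

variable {n : J → ℕ} {L : ∀ j, Fin (m j) → List (S j).F} {d : ∀ j, Fin (m j) → ℕ} {a b : J → ℕ}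

theorem unitVec (hn : PolyBdd S n) (hidx : Comp S x fun j => fun i : Fin (n j) => (i : ℕ)) :
    Comp S x fun j => unitVec (S j).F (n j) :=
  one.vec_cons (hidx.vec_const hn zero)

theorem relations {z : ∀ j, Fin (n j + 1) → List (S j).F} (hz : Comp S x z) (hL : Comp S x L)
    (hd : Comp S x d) (hn : PolyBdd S n) (hm : PolyBdd S m) (ha : PolyBdd S a)
    (hLa : ∀ j i, (L j i).length ≤ a j) (hb : PolyBdd S b) (hdb : ∀ j i, d j i ≤ b j) :
    Comp S x fun j => relations (z j) (L j) (d j) := by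
  classical
  have hN : PolyBdd S fun j => n j + 1 := hn.add (.const 1)
  have hidx := hz.vec_index hN
  have hpow := hz.powRows hL hd hN hm ha hLa hb hdb
  have hpal := hz.palRows hL hN hm ha hLa
  have hpowb : PolyBdd S fun j => (PolyComp.powRows (z j) (L j) (d j)).length :=
    ((hN.add hN).add (.const 1)).mono fun j => products_length _ _
  have hpalb : PolyBdd S fun j => (PolyComp.palRows (z j) (L j)).length :=
    ((hN.add hN).add (.const 1)).mono fun j => products_length _ _
  have h0 := zero_vec hN hidx
  refine ((leftBasis hN hidx).sift ((hpow.map hpowb ((refl.fst.fst.vec_sub refl.fst.snd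
    (hN.reindex _)).pair h0.lift)).append ((ite (two.eq_zero)
      (hpal.map hpalb (refl.fst.fst.pair h0.lift)) nil).append
        (((unitVec hn (hz.vec_tail.vec_index hn)).pair h0).singleton) ?_) ?_) hN
        (hN.mono fun j => by simp [PolyComp.leftBasis]) ?_).snd
  · exact hpalb.mono fun j => by split_ifs <;> simp
  · simpa using hpowb
  · refine (hpowb.add (hpalb.add (.const 1))).mono fun j => ?_
    simp only [List.length_append, List.length_map, List.length_singleton]
    split_ifs <;> simp

end Main

end Comp

end PolyComp

/-! ### The program -/

namespace PolyComp

open Enc (enc)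

universe u v w

theorem full_sublist {K : Type u} [Field K] {N : ℕ} (ls : List (Level K N))
    {c c' : List (Path K N)} (h : c.Sublist c') : (full ls c).Sublist (full ls c') := by
  induction ls generalizing c c' with
  | nil => exact h
  | cons l ls ih => exact ih (expand_sublist (List.Sublist.refl l) h)

/-- `foldl_enumStep` controls only paths of nonzero weight. The other entries may also be asked, so
they too must come from points of the product set. -/
theorem foldl_enumStep_sublist {K : Type u} [Field K] {N : ℕ} (bound : ℕ) (ls : List (Level K N))
    (rem : List (Level K N)) (o : List (List (Path K N))) :
    ∀ r ∈ (ls.foldl (enumStep bound) (rem, o)).2, ∃ cur ∈ o, r.Sublist (full ls cur) := by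
  induction ls generalizing rem o with
  | nil => exact fun r hr => ⟨r, hr, List.Sublist.refl _⟩
  | cons l ls ih =>
    intro r hr
    obtain ⟨c, hc, hrc⟩ := ih _ _ r hr
    obtain ⟨cur, hcur, hc⟩ := List.mem_flatMap.1 hc
    refine ⟨cur, hcur, ?_⟩
    split_ifs at hc
    · rw [List.mem_singleton.1 hc] at hrc
      exact hrc.trans (full_sublist ls List.filter_sublist)
    · simp at hc

theorem enum_sublist {K : Type u} [Field K] {N : ℕ} {bound : ℕ} {ls : List (Level K N)}
    {μ : Fin N → K} {r : List (Path K N)} (hr : r ∈ enum bound ls μ) :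
    r.Sublist (full ls [([], μ)]) := by
  obtain ⟨c, hc, h⟩ := foldl_enumStep_sublist bound ls ls [[([], μ)]] r hr
  rwa [List.mem_singleton.1 hc] at h

section Plan

variable {K : Type u} [Field K] {m n : ℕ}

/-- The coefficients of a relation, normalised at position `1`. -/
noncomputable def coeffs (z : Fin (n + 2) → List K) (L : Fin m → List K) (d : Fin m → ℕ) :
    Fin (n + 2) → K :=
  match usefulRelations z L d with
  | [] => 0
  | κ :: _ => fun i => κ.1 i / κ.1 (Fin.succ 0)

/-- The questions to be asked and the coefficients of the answers. -/
noncomputable def plan (z : Fin (n + 2) → List K) (L : Fin m → List K) (d : Fin m → ℕ) :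
    List (List K × K) :=
  match search z L (coeffs z L d) with
  | [] => []
  | r :: _ => questions r

end Plan

/-- The inputs of the simulator, in a setting in which their size is bounded. -/
structure Input where
  S : Setting.{u}
  m : ℕ
  n : ℕ
  L : Fin m → List S.F
  d : Fin m → ℕ
  T : Fin n → List S.F × S.F
  α : List S.F
  m_le : m ≤ S.B
  n_le : n ≤ S.B
  L_le : ∀ i, (L i).length ≤ S.B
  d_le : ∀ i, d i ≤ S.B

namespace Input

/-- The points: `⊥`, the new query, and the old queries. -/
def z (I : Input.{u}) : Fin (I.n + 2) → List I.S.F :=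
  Fin.cons [] (Fin.cons I.α fun i => (I.T i).1)

/-- The known values at the points. -/
def y (I : Input.{u}) : Fin (I.n + 2) → I.S.F := Fin.cons 0 (Fin.cons 0 fun i => (I.T i).2)

def raw (I : Input.{u}) :
    (Fin I.m → List I.S.F × ℕ) × (Fin I.n → List I.S.F × I.S.F) × List I.S.F :=
  (fun i => (I.L i, I.d i), I.T, I.α)

noncomputable def useful (I : Input.{u}) : List (VecPair I.S.F (I.n + 2)) :=
  usefulRelations I.z I.L I.d

/-- The contribution of the known symbols when the normalised relation is solved for the new one. -/
noncomputable def known (I : Input.{u}) : I.S.F := - ∑ i, coeffs I.z I.L I.d i * I.y i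

theorem bdd_B : PolyBdd (fun I : Input.{u} => I.S) fun I => I.S.B := ⟨1, fun I => by simp⟩

theorem bdd_m : PolyBdd (fun I : Input.{u} => I.S) fun I => I.m := bdd_B.mono fun I => I.m_le

theorem bdd_n : PolyBdd (fun I : Input.{u} => I.S) fun I => I.n := bdd_B.mono fun I => I.n_le

theorem bdd_N : PolyBdd (fun I : Input.{u} => I.S) fun I => I.n + 2 := bdd_n.add (.const 2)

theorem comp_L : Comp (fun I : Input.{u} => I.S) raw fun I => I.L :=
  Comp.refl.fst.ofFn bdd_m Comp.refl.fst.fst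

theorem comp_d : Comp (fun I : Input.{u} => I.S) raw fun I => I.d :=
  Comp.refl.fst.ofFn bdd_m Comp.refl.fst.snd

theorem comp_T : Comp (fun I : Input.{u} => I.S) raw fun I => I.T := Comp.refl.snd.fst

theorem comp_z : Comp (fun I : Input.{u} => I.S) raw z :=
  Comp.nil.vec_cons (Comp.vec_cons (n := fun I : Input.{u} => I.n) Comp.refl.snd.snd
    (comp_T.ofFn bdd_n Comp.refl.fst.fst))

theorem comp_y : Comp (fun I : Input.{u} => I.S) raw y :=
  Comp.zero.vec_cons (Comp.vec_cons (n := fun I : Input.{u} => I.n) Comp.zero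
    (comp_T.ofFn bdd_n Comp.refl.fst.snd))

theorem comp_useful : Comp (fun I : Input.{u} => I.S) raw useful := by
  classical
  refine (comp_z.relations (n := fun I => I.n + 1) comp_L comp_d (bdd_n.add (.const 1)) bdd_m bdd_B
    (fun I => I.L_le) bdd_B fun I => I.d_le).filter (bdd_N.mono fun I => ?_)
    (Comp.vec_head (n := fun p : Σ I : Input.{u}, {κ // κ ∈ relations I.z I.L I.d} => p.1.n)
      (Comp.vec_tail (n := fun p : Σ I : Input.{u}, {κ // κ ∈ relations I.z I.L I.d} => p.1.n + 1)
      Comp.refl.fst.fst)).eq_zero.not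
  rw [relations, sift_length]
  simp [leftBasis]

theorem comp_coeffs : Comp (fun I : {I : Input.{u} // ¬ I.useful = []} => I.1.S)
    (fun I => I.1.raw) fun I => coeffs I.1.z I.1.L I.1.d := by
  choose κ t h using fun I : {I : Input.{u} // ¬ I.useful = []} =>
    List.exists_cons_of_ne_nil I.2
  have hκ : Comp (fun I : {I : Input.{u} // ¬ I.useful = []} => I.1.S) (fun I => I.1.raw) κ :=
    (comp_useful.reindex Subtype.val).head fun I => ⟨t I, h I⟩
  have hpiv := Comp.vec_head (n := fun I : {I : Input.{u} // ¬ I.useful = []} => I.1.n)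
    (Comp.vec_tail (n := fun I : {I : Input.{u} // ¬ I.useful = []} => I.1.n + 1) hκ.fst)
  refine (hκ.fst.ofFn (y := fun I i => (κ I).1 i / (κ I).1 (Fin.succ 0)) (bdd_N.reindex _)
    (Comp.refl.fst.div hpiv.lift)).congr fun I => ?_
  have : usefulRelations I.1.z I.1.L I.1.d = κ I :: t I := h I
  rw [coeffs, this]

theorem lagLevels_length {K : Type u} [Field K] {N m a : ℕ} (z : Fin N → List K)
    {L : Fin m → List K} (hL : ∀ i, (L i).length ≤ a) :
    ∀ l ∈ lagLevels z L, l.length ≤ a := by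
  intro l hl
  obtain ⟨i, rfl⟩ := List.mem_ofFn.1 (List.mem_reverse.1 hl)
  simpa using hL i

theorem search_length {K : Type u} [Field K] {n m : ℕ} {z : Fin (n + 1) → List K}
    {L : Fin m → List K} {μ : Fin (n + 1) → K} {r : K × List (Path K (n + 1))}
    (hr : r ∈ search z L μ) : r.2.length ≤ searchBound (n + 1) L + 1 := by
  obtain ⟨x, _, hx⟩ := List.mem_flatMap.1 hr
  obtain ⟨r', hr', rfl⟩ := List.mem_map.1 hx
  exact (enum_length _ _ _).2 _ hr'

theorem comp_plan : Comp (fun I : {I : Input.{u} // ¬ I.useful = []} => I.1.S)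
    (fun I => I.1.raw) fun I => plan I.1.z I.1.L I.1.d := by
  have hN : PolyBdd (fun I : {I : Input.{u} // ¬ I.useful = []} => I.1.S) fun I => I.1.n + 2 :=
    bdd_N.reindex _
  have hB : PolyBdd (fun I : {I : Input.{u} // ¬ I.useful = []} => I.1.S) fun I => I.1.S.B :=
    bdd_B.reindex _
  have hm : PolyBdd (fun I : {I : Input.{u} // ¬ I.useful = []} => I.1.S) fun I => I.1.m :=
    bdd_m.reindex _
  have hz := comp_z.reindex (Subtype.val : {I : Input.{u} // ¬ I.useful = []} → _)
  have hL := comp_L.reindex (Subtype.val : {I : Input.{u} // ¬ I.useful = []} → _)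
  obtain ⟨hbound, hbb⟩ := hL.searchBound (hz.vec_card hN) hN hm hB fun I => I.1.L_le
  have hls := hz.lagLevels hL hN hm hB fun I => I.1.L_le
  have hlen : PolyBdd (fun I : {I : Input.{u} // ¬ I.useful = []} => I.1.S)
      fun I => (lagLevels I.1.z I.1.L).length := by simpa [lagLevels] using hm
  have hla : ∀ I : {I : Input.{u} // ¬ I.useful = []}, ∀ l ∈ lagLevels I.1.z I.1.L,
      l.length ≤ I.1.S.B := fun I => lagLevels_length _ I.1.L_le
  have hunit := Comp.unitVec (n := fun I : {I : Input.{u} // ¬ I.useful = []} => I.1.n + 1)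
    (hN.mono fun I => Nat.le_succ _)
    ((Comp.vec_tail (n := fun I : {I : Input.{u} // ¬ I.useful = []} => I.1.n + 1) hz).vec_index
      (hN.mono fun I => Nat.le_succ _))
  have hcl : PolyBdd (fun I : {I : Input.{u} // ¬ I.useful = []} => I.1.S) fun I =>
      (cands (searchBound (I.1.n + 2) I.1.L) (lagLevels I.1.z I.1.L)
        (coeffs I.1.z I.1.L I.1.d)).length :=
    ((hbb.add (.const 1)).mul (hB.add (.const 1))).mono fun I => cands_length (hla I) _
  have hsearch : Comp (fun I : {I : Input.{u} // ¬ I.useful = []} => I.1.S)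
      (fun I => I.1.raw) fun I => search I.1.z I.1.L (coeffs I.1.z I.1.L I.1.d) := by
    -- There are polynomially many candidates, and each enumeration returns at most one list.
    refine (hls.cands comp_coeffs hbound hN hbb hlen hB hla).flatMap hcl (.const 1) (fun I e _ => ?_)
      ?_
    · rw [List.length_map]
      exact (enum_length _ _ _).1
    · have hw := Comp.weight (N := fun p : Σ I : {I : Input.{u} // ¬ I.useful = []}, {x // x ∈
          cands (searchBound (I.1.n + 2) I.1.L) (lagLevels I.1.z I.1.L)
            (coeffs I.1.z I.1.L I.1.d)} => p.1.1.n + 2) (Comp.refl.fst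
        (x := fun p : Σ I : {I : Input.{u} // ¬ I.useful = []}, {x // x ∈
          cands (searchBound (I.1.n + 2) I.1.L) (lagLevels I.1.z I.1.L)
            (coeffs I.1.z I.1.L I.1.d)} => (p.2.1, p.1.1.raw)) (S := fun p => p.1.1.S))
          (hN.reindex _)
      have henum := hls.lift.enum (comp_coeffs.lift.vec_sub
        ((hw.vec_smul hunit.lift (hN.reindex _))) (hN.reindex _)) hbound.lift (hN.reindex _)
        (hbb.reindex _) (hlen.reindex _) (hB.reindex _) fun p => hla p.1
      exact henum.map ((PolyBdd.const 1).mono fun p => (enum_length _ _ _).1)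
        (hw.lift.pair Comp.refl.fst)
  refine Comp.cond hsearch.eq_nil (Comp.nil.congr fun I => by simp only [plan, I.2]) ?_
  choose r t h using fun I : {I : {I : Input.{u} // ¬ I.useful = []} //
    ¬ search I.1.z I.1.L (coeffs I.1.z I.1.L I.1.d) = []} => List.exists_cons_of_ne_nil I.2
  refine (((hsearch.reindex Subtype.val).head fun I => ⟨t I, h I⟩).questions
    (hN.reindex _) (((hbb.add (.const 1)).reindex _).mono fun I =>
      search_length (by rw [h I]; exact List.mem_cons_self))).congr fun I => ?_
  rw [plan, h I]

theorem comp_known : Comp (fun I : {I : Input.{u} // ¬ I.useful = []} => I.1.S)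
    (fun I => I.1.raw) fun I => I.1.known :=
  ((comp_coeffs.vec_mul (comp_y.reindex _) (bdd_N.reindex _)).vec_sum (bdd_N.reindex _)).neg

end Input

/-- Ask a question, and add the answer times a coefficient to the state. -/
def askBody : Prog :=
  .comp .add (.pair .snd (.comp .mul (.pair (.comp .snd .fst) (.comp .query (.comp .fst .fst)))))

theorem size_ofElts {F : Type u} (l : List F) : (Data.ofElts l).size = 2 * l.length + 1 := by
  rw [Data.ofElts]
  induction l with
  | nil => rfl
  | cons a l ih =>
    simp only [List.map_cons, Data.ofList, Data.size, ih, List.length_cons]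
    ring

theorem run_askBody (S : Setting.{u}) {b c s v : _} {q : List S.F}
    (hq : S.O (enc q) = Data.elt v) (hb : q.length ≤ b) :
    ∃ t ≤ (2 * b + 20) * S.B, (askBody.run S.O (Data.node (enc (q, c)) (Data.elt s))) =
      PMF.pure ⟨Data.elt (s + c * v), t, 1⟩ := by
  have hsize : (enc q : Data S.F).size = 2 * q.length + 1 := size_ofElts q
  refine ⟨_, ?_, by
    simp only [askBody, Prog.run, Prog.ret, charge_eq, andThen_pure, PMF.pure_map, Data.fst,
      Data.snd, enc, Data.map₂] at hq ⊢
    rw [hq]⟩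
  have h1 := S.bits_le
  have h2 := S.le_B
  have h3 : Prog.fieldBits S.F ≤ Prog.fieldBits S.F ^ 2 := Nat.le_self_pow (by norm_num) _
  have h4 : (enc q : Data S.F).size * Prog.fieldBits S.F ≤ (2 * b + 1) * S.B := by
    rw [hsize]
    exact Nat.mul_le_mul (by omega) (h3.trans h1)
  simp only [enc] at h4
  have h5 : (2 * b + 20) * S.B = (2 * b + 1) * S.B + 19 * S.B := by ring
  omega

theorem run_fold_askBody (S : Setting.{u}) {b : ℕ} (l : List (List S.F × S.F)) (s : S.F)
    (val : List S.F → S.F) (hl : ∀ q ∈ l, S.O (enc q.1) = Data.elt (val q.1) ∧ q.1.length ≤ b) :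
    ∃ t ≤ l.length * ((2 * b + 20) * S.B + 1) + 2,
      (Prog.fold askBody).run S.O (enc (l, s)) =
        PMF.pure ⟨Data.elt (s + (l.map fun q => q.2 * val q.1).sum), t, l.length⟩ := by
  obtain ⟨t, ht, h⟩ := foldRun_pure (F := S.F) (q := 1) (t := (2 * b + 20) * S.B)
    (body := askBody.run S.O) (l.map enc)
    (fun k => Data.elt (s + ((l.take k).map fun q => q.2 * val q.1).sum)) fun k hk => by
      have hk' : k < l.length := by simpa using hk
      obtain ⟨h1, h2⟩ := hl l[k] (List.getElem_mem _)
      obtain ⟨t, ht, h⟩ := run_askBody S (c := l[k].2)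
        (s := s + ((l.take k).map fun q => q.2 * val q.1).sum) h1 h2
      refine ⟨t, ht, ?_⟩
      rw [List.getElem_map, h, List.take_add_one, List.getElem?_eq_getElem hk']
      simp only [List.map_append, List.sum_append, Option.toList_some, List.map_cons, List.map_nil,
        List.sum_singleton, add_assoc]
  refine ⟨1 + t, by simp only [List.length_map] at ht; omega, ?_⟩
  simp only [List.take_zero, List.map_nil, List.sum_nil, add_zero, List.length_map,
    List.take_length, one_mul] at h
  simp only [Prog.run, enc, Data.fst, Data.snd, Data.toList_ofList, charge_eq]
  simp only [enc] at h
  rw [h, PMF.pure_map]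

/-- One program samples a uniformly random element if there is no useful relation, and evaluates the
plan otherwise. -/
theorem exists_program : ∃ (P : Prog) (k : ℕ), ∀ I : Input.{u},
    (I.useful = [] → ∃ t ≤ I.S.B ^ k, P.run I.S.O (enc I.raw) =
      (PMF.uniformOfFintype I.S.F).map fun a => ⟨Data.elt a, t, 0⟩) ∧
    (I.useful ≠ [] → ∀ val : List I.S.F → I.S.F,
      (∀ q ∈ plan I.z I.L I.d, I.S.O (enc q.1) = Data.elt (val q.1) ∧ q.1.length ≤ I.m) →
      (plan I.z I.L I.d).length ≤ searchBound (I.n + 2) I.L + 1 →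
      ∃ t ≤ I.S.B ^ k, P.run I.S.O (enc I.raw) =
        PMF.pure ⟨Data.elt (I.known + ((plan I.z I.L I.d).map fun q => q.2 * val q.1).sum), t,
          (plan I.z I.L I.d).length⟩) := by
  obtain ⟨C, k, hC⟩ := Input.comp_useful.{u}.eq_nil
  obtain ⟨Q, l, hQ⟩ := Input.comp_plan.{u}.pair Input.comp_known.{u}
  have hbound := (Input.comp_L.{u}.searchBound (Input.comp_z.vec_card Input.bdd_N) Input.bdd_N
    Input.bdd_m Input.bdd_B fun I => I.L_le).2
  have htime : PolyBdd (fun I : Input.{u} => I.S) fun I => 2 + I.S.B ^ k + I.S.B ^ l +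
      ((searchBound (I.n + 2) I.L + 1) * ((2 * I.m + 20) * I.S.B + 1) + 2) + I.S.B :=
    (((((PolyBdd.const 2).add (g := fun I => I.S.B ^ k) ⟨k, fun _ => le_rfl⟩).add
      (g := fun I => I.S.B ^ l) ⟨l, fun _ => le_rfl⟩).add
      (((hbound.add (.const 1)).mul (((((PolyBdd.const 2).mul Input.bdd_m).add (.const 20)).mul
        Input.bdd_B).add (.const 1))).add (.const 2))).add Input.bdd_B)
  obtain ⟨e, he⟩ := htime
  -- All computation is done by `Q` before the first question: it leaves the list of questions and
  -- the initial value of the accumulator.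
  refine ⟨.ite C .sample (.comp (.fold askBody) Q), e, fun I => ⟨fun h => ?_, fun h val hv hlen => ?_⟩⟩
  · obtain ⟨t, ht, hrun⟩ := hC I
    refine ⟨1 + (t + Prog.fieldBits I.S.F ^ 2), ?_, ?_⟩
    · have := he I
      have := I.S.bits_le
      dsimp only at *
      omega
    · have hnil : (enc (I.useful = []) : Data I.S.F).isNil = false := by
        simp [enc, Data.ofProp, h, Data.isNil]
      rw [Prog.run, hrun, andThen_pure, hnil, if_neg (by simp), Prog.run]
      simp [charge_eq, PMF.map_comp, Function.comp_def]
  · obtain ⟨t, ht, hrun⟩ := hC I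
    obtain ⟨t', ht', hrun'⟩ := hQ ⟨I, h⟩
    obtain ⟨t'', ht'', hrun''⟩ := run_fold_askBody I.S (plan I.z I.L I.d) I.known val hv
    refine ⟨1 + (t + (1 + (t' + t''))), ?_, ?_⟩
    · have := he I
      have h1 : (plan I.z I.L I.d).length * ((2 * I.m + 20) * I.S.B + 1) ≤
        (searchBound (I.n + 2) I.L + 1) * ((2 * I.m + 20) * I.S.B + 1) :=
        Nat.mul_le_mul_right _ hlen
      dsimp only at *
      omega
    · have hnil : (enc (I.useful = []) : Data I.S.F).isNil = true := by
        simp [enc, Data.ofProp, h, Data.isNil]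
      rw [Prog.run, hrun, andThen_pure, hnil, if_pos rfl, Prog.run, hrun', andThen_pure, hrun'']
      simp [charge_eq, PMF.pure_map]

end PolyComp

/-! ### Low-degree functions and the relations between their sums -/

namespace LowDeg

universe u

open Polynomial

variable {F : Type u} [Field F] {m N : ℕ}

/-- The functions given by polynomials of degree at most `d i` in the `i`-th variable. -/
def lowDeg (F : Type u) [Field F] (d : Fin m → ℕ) : Submodule F ((Fin m → F) → F) where
  carrier := {f | ∃ P : MvPolynomial (Fin m) F, (∀ i, P.degreeOf i ≤ d i) ∧
    ∀ x, MvPolynomial.eval x P = f x}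
  zero_mem' := ⟨0, fun i => by simp, fun x => by simp⟩
  add_mem' := by
    rintro f g ⟨P, hP, hPf⟩ ⟨Q, hQ, hQg⟩
    exact ⟨P + Q, fun i => (MvPolynomial.degreeOf_add_le _ _ _).trans (max_le (hP i) (hQ i)),
      fun x => by simp [hPf, hQg]⟩
  smul_mem' := by
    rintro c f ⟨P, hP, hPf⟩
    exact ⟨MvPolynomial.C c * P, fun i => (MvPolynomial.degreeOf_C_mul_le _ _ _).trans (hP i),
      fun x => by simp [hPf]⟩

/-- A product of functions of one variable each. -/
def prodFun (q : Fin m → F[X]) : (Fin m → F) → F := fun x => ∏ i, (q i).eval (x i)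

theorem prodFun_mem {d : Fin m → ℕ} {q : Fin m → F[X]} (hq : ∀ i, (q i).natDegree ≤ d i) :
    prodFun q ∈ lowDeg F d := by
  refine ⟨∏ i, (q i).toMvPolynomial i, fun j => ?_, fun x => ?_⟩
  · refine (MvPolynomial.degreeOf_prod_le _ _ _).trans ?_
    refine (Finset.sum_le_sum fun i _ => degreeOf_toMvPolynomial_le i j _).trans ?_
    rw [Finset.sum_ite_eq' Finset.univ j]
    simpa using hq j
  · simp [prodFun, MvPolynomial.eval_toMvPolynomial]

/-- Low-degree functions are linear combinations of monomials. -/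
theorem lowDeg_induction {d : Fin m → ℕ} {f : (Fin m → F) → F} (hf : f ∈ lowDeg F d)
    {V : Submodule F ((Fin m → F) → F)}
    (hV : ∀ e : Fin m → ℕ, (∀ i, e i ≤ d i) → prodFun (fun i => X ^ e i) ∈ V) : f ∈ V := by
  obtain ⟨P, hP, hPf⟩ := hf
  have : f = ∑ e ∈ P.support, P.coeff e • prodFun fun i => X ^ e i := by
    ext x
    rw [← hPf, MvPolynomial.eval_eq']
    simp [prodFun]
  rw [this]
  exact Submodule.sum_mem _ fun e he => Submodule.smul_mem _ _ (hV _ fun i =>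
    (MvPolynomial.monomial_le_degreeOf i he).trans (hP i))

section Sums

variable (A : Fin m → Finset F)

/-- The value at the `i`-th coordinate of `z`, if there is one, and the sum over `A i` otherwise. -/
def factor (z : PartialPoint F m) (i : Fin m) (g : F → F) : F :=
  if h : (i : ℕ) < z.1 then g (z.2 ⟨i, h⟩) else ∑ s ∈ A i, g s

/-- A sum over a subcube of a product of one-variable functions factors. This is why the conditions
on a relation are products over the levels. -/
theorem sumWord_prod (g : Fin m → F → F) (z : PartialPoint F m) :
    sumWord A (fun x => ∏ i, g i (x i)) z = ∏ i, factor A z i (g i) := by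
  rw [sumWord, subcube, ← Finset.prod_univ_sum]
  refine Finset.prod_congr rfl fun i _ => ?_
  rw [factor]
  split_ifs <;> simp

theorem sumWord_prodFun (q : Fin m → F[X]) (z : PartialPoint F m) :
    sumWord A (prodFun q) z = ∏ i, factor A z i fun x => (q i).eval x :=
  sumWord_prod A (fun i x => (q i).eval x) z

/-- The linear combination with coefficients `c` of the sums at the points `Z`. -/
def functional (Z : Fin N → PartialPoint F m) (c : Fin N → F) :
    ((Fin m → F) → F) →ₗ[F] F where
  toFun p := ∑ j, c j * sumWord A p (Z j)
  map_add' p q := by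
    simp only [sumWord, Pi.add_apply, Finset.sum_add_distrib, mul_add]
  map_smul' a p := by
    simp only [sumWord, Pi.smul_apply, smul_eq_mul, ← Finset.mul_sum, RingHom.id_apply]
    rw [Finset.mul_sum]
    exact Finset.sum_congr rfl fun j _ => by ring

theorem functional_apply (Z : Fin N → PartialPoint F m) (c : Fin N → F) (p : (Fin m → F) → F) :
    functional A Z c p = ∑ j, c j * sumWord A p (Z j) := rfl

variable [DecidableEq F]

noncomputable def lagPoly (a : Fin m → F) (i : Fin m) : F[X] := Lagrange.basis (A i) id (a i)

/-- The interpolation polynomial of the indicator function of `a`. -/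
noncomputable def lagFun (a : Fin m → F) : (Fin m → F) → F := prodFun (lagPoly A a)

variable {A}

theorem eval_lagPoly {a : Fin m → F} {i : Fin m} (ha : a i ∈ A i) {x : F} (hx : x ∈ A i) :
    (lagPoly A a i).eval x = if x = a i then 1 else 0 := by
  split_ifs with h
  · rw [h]
    exact Lagrange.eval_basis_self (v := id) Function.injective_id.injOn ha
  · exact Lagrange.eval_basis_of_ne (v := id) (Ne.symm h) hx

theorem natDegree_lagPoly {a : Fin m → F} {i : Fin m} (ha : a i ∈ A i) :
    (lagPoly A a i).natDegree = (A i).card - 1 :=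
  Lagrange.natDegree_basis Function.injective_id.injOn ha

theorem sum_lagPoly {a : Fin m → F} {i : Fin m} (ha : a i ∈ A i) :
    ∑ s ∈ A i, (lagPoly A a i).eval s = 1 := by
  rw [Finset.sum_congr rfl fun s hs => eval_lagPoly ha hs]
  simp [ha]

theorem lagFun_apply {a x : Fin m → F} (ha : a ∈ Fintype.piFinset A)
    (hx : x ∈ Fintype.piFinset A) : lagFun A a x = if x = a then 1 else 0 := by
  rw [Fintype.mem_piFinset] at ha hx
  rw [lagFun, prodFun, Finset.prod_congr rfl fun i _ => eval_lagPoly (ha i) (hx i)]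
  split_ifs with h
  · exact Finset.prod_eq_one fun i _ => by rw [h, if_pos rfl]
  · obtain ⟨i, hi⟩ := Function.ne_iff.1 h
    exact Finset.prod_eq_zero (Finset.mem_univ i) (if_neg hi)

theorem lagFun_mem {d : Fin m → ℕ} (hd : ∀ i, (A i).card - 1 ≤ d i) {a : Fin m → F}
    (ha : a ∈ Fintype.piFinset A) : lagFun A a ∈ lowDeg F d :=
  prodFun_mem fun i => (natDegree_lagPoly (Fintype.mem_piFinset.1 ha i)).trans_le (hd i)

/-- The point with the reversed coordinates. -/
def rev (a : Fin m → F) : Fin m → F := fun i => a i.rev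

omit [Field F] [DecidableEq F] in
theorem rev_apply (a : Fin m → F) (i : Fin m) : rev a i = a i.rev := rfl

omit [Field F] [DecidableEq F] in
theorem rev_rev (a : Fin m → F) : rev (rev a) = a := by
  ext i
  simp [rev]

omit [Field F] [DecidableEq F] in
theorem rev_mem (hsymm : ∀ i, A i.rev = A i) {a : Fin m → F} (ha : a ∈ Fintype.piFinset A) :
    rev a ∈ Fintype.piFinset A := by
  rw [Fintype.mem_piFinset] at ha ⊢
  intro i
  rw [← hsymm i]
  exact ha i.rev

/-! ### Relations valid for all antisymmetric low-degree functions -/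

section Relations

variable (A)

/-- Functions on the product set that are antisymmetric. -/
def Anti (p : (Fin m → F) → F) : Prop := ∀ a ∈ Fintype.piFinset A, p a + p (rev a) = 0

/-- The relations that hold for all low-degree functions that are antisymmetric. -/
def IsRel (d : Fin m → ℕ) (Λ : ((Fin m → F) → F) →ₗ[F] F) : Prop :=
  ∀ p ∈ lowDeg F d, Anti A p → Λ p = 0

/-- The two kinds of conditions for a relation. -/
structure Conditions (d : Fin m → ℕ) (Λ : ((Fin m → F) → F) →ₗ[F] F) : Prop where
  pow : ∀ e : Fin m → ℕ, (∀ i, e i ≤ d i) → Λ (prodFun fun i => X ^ e i) =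
    ∑ a ∈ Fintype.piFinset A, (∏ i, a i ^ e i) * Λ (lagFun A (rev a))
  pal : (1 + 1 : F) = 0 → ∀ a ∈ Fintype.piFinset A, rev a = a → Λ (lagFun A a) = 0

variable {A} {d : Fin m → ℕ} {Λ : ((Fin m → F) → F) →ₗ[F] F}

/-- Both sides are linear in `p`, and `pow` says that they agree on the monomials, which span. -/
theorem Conditions.apply (h : Conditions A d Λ) {p : (Fin m → F) → F} (hp : p ∈ lowDeg F d) :
    Λ p = ∑ a ∈ Fintype.piFinset A, p a * Λ (lagFun A (rev a)) := by
  let Λ' : ((Fin m → F) → F) →ₗ[F] F :=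
    ∑ a ∈ Fintype.piFinset A, Λ (lagFun A (rev a)) • LinearMap.proj a
  have hΛ' : ∀ p, Λ' p = ∑ a ∈ Fintype.piFinset A, p a * Λ (lagFun A (rev a)) := fun p => by
    simp [Λ', mul_comm]
  have := lowDeg_induction hp (V := LinearMap.eqLocus Λ Λ') fun e he => by
    rw [LinearMap.mem_eqLocus, h.pow e he, hΛ']
    simp [prodFun]
  rw [LinearMap.mem_eqLocus] at this
  rw [this, hΛ']

/-- Take `p = lagFun A a`, which picks out a single term of the sum. -/
theorem Conditions.symm (h : Conditions A d Λ)
    (hd : ∀ i, (A i).card - 1 ≤ d i) {a : Fin m → F} (ha : a ∈ Fintype.piFinset A) :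
    Λ (lagFun A (rev a)) = Λ (lagFun A a) := by
  rw [h.apply (lagFun_mem hd ha), Finset.sum_eq_single a, lagFun_apply ha ha, if_pos rfl, one_mul]
  · intro b hb hba
    rw [lagFun_apply ha hb, if_neg hba, zero_mul]
  · exact fun h => absurd ha h

theorem Conditions.apply' (h : Conditions A d Λ)
    (hd : ∀ i, (A i).card - 1 ≤ d i) {p : (Fin m → F) → F} (hp : p ∈ lowDeg F d) :
    Λ p = ∑ a ∈ Fintype.piFinset A, p a * Λ (lagFun A a) := by
  rw [h.apply hp]
  exact Finset.sum_congr rfl fun a ha => by rw [h.symm hd ha]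

/-- The terms of `a` and `rev a` cancel. At a palindrome `2 * g a = 0`, so either `g a = 0`, or the
characteristic is two and `pal` applies. -/
theorem Conditions.sum_anti (h : Conditions A d Λ) (hsymm : ∀ i, A i.rev = A i)
    (hd : ∀ i, (A i).card - 1 ≤ d i) {g : (Fin m → F) → F} (hg : Anti A g) :
    ∑ a ∈ Fintype.piFinset A, g a * Λ (lagFun A a) = 0 := by
  refine Finset.sum_involution (fun a _ => rev a) (fun a ha => ?_) (fun a ha hne heq => hne ?_)
    (fun a ha => rev_mem hsymm ha) fun a _ => rev_rev a
  · rw [h.symm hd ha, ← add_mul, hg a ha, zero_mul]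
  · have h2 := hg a ha
    rw [heq, ← two_mul, mul_eq_zero, ← one_add_one_eq_two] at h2
    rcases h2 with h2 | h2
    · rw [h.pal h2 a ha heq, mul_zero]
    · rw [h2, zero_mul]

/-- The value of a relation on a function that is known up to an antisymmetric one. -/
theorem Conditions.apply_add (h : Conditions A d Λ) (hsymm : ∀ i, A i.rev = A i)
    (hd : ∀ i, (A i).card - 1 ≤ d i) {p f g : (Fin m → F) → F} (hp : p ∈ lowDeg F d)
    (hg : Anti A g) (hpfg : ∀ a ∈ Fintype.piFinset A, p a = f a + g a) :
    Λ p = ∑ a ∈ Fintype.piFinset A, f a * Λ (lagFun A a) := by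
  rw [h.apply' hd hp, Finset.sum_congr rfl fun a ha => by rw [hpfg a ha, add_mul],
    Finset.sum_add_distrib, h.sum_anti hsymm hd hg, add_zero]

/-- A monomial minus the interpolation of its reversal is antisymmetric and of low degree, hence
killed by `Λ`. In characteristic two the same holds for `lagFun A a` at a palindrome `a`. -/
theorem IsRel.conditions (h : IsRel A d Λ) (hsymm : ∀ i, A i.rev = A i)
    (hd : ∀ i, (A i).card - 1 ≤ d i) : Conditions A d Λ := by
  refine ⟨fun e he => ?_, fun h2 a ha hrev => h _ (lagFun_mem hd ha) fun b hb => ?_⟩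
  · let p : (Fin m → F) → F := prodFun fun i => X ^ e i
    let q : (Fin m → F) → F := ∑ a ∈ Fintype.piFinset A, p a • lagFun A (rev a)
    have hq : ∀ b ∈ Fintype.piFinset A, q b = p (rev b) := fun b hb => by
      simp only [q, Finset.sum_apply, Pi.smul_apply, smul_eq_mul]
      rw [Finset.sum_eq_single (rev b), rev_rev, lagFun_apply hb hb, if_pos rfl, mul_one]
      · intro a ha hab
        rw [lagFun_apply (rev_mem hsymm ha) hb, if_neg, mul_zero]
        rintro rfl
        exact hab (rev_rev a).symm
      · exact fun h => absurd (rev_mem hsymm hb) h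
    have hmem : p - q ∈ lowDeg F d := Submodule.sub_mem _
      (prodFun_mem fun i => by simpa using he i)
      (Submodule.sum_mem _ fun a ha => Submodule.smul_mem _ _
        (lagFun_mem hd (rev_mem hsymm ha)))
    have := h _ hmem fun b hb => by
      rw [Pi.sub_apply, Pi.sub_apply, hq b hb, hq _ (rev_mem hsymm hb), rev_rev]
      ring
    rw [map_sub, sub_eq_zero] at this
    rw [this]
    simp [q, p, prodFun]
  · rw [lagFun_apply ha hb, lagFun_apply ha (rev_mem hsymm hb)]
    by_cases hba : b = a
    · rw [hba, hrev, if_pos rfl, h2]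
    · rw [if_neg hba, if_neg, add_zero]
      intro h'
      exact hba (by rw [← rev_rev b, h', hrev])

end Relations

end Sums

end LowDeg

/-! ### Relations are sparse up to a constant -/

namespace LowDeg

universe u

open Polynomial

variable {F : Type u} [Field F] [DecidableEq F] {m N : ℕ} {A : Fin m → Finset F}

/-- The first `k` coordinates; the others are replaced by zero. -/
def pre (k : ℕ) (a : Fin m → F) : Fin m → F := fun i => if (i : ℕ) < k then a i else 0

omit [DecidableEq F] in
theorem pre_eq_iff {k : ℕ} {a b : Fin m → F} :
    pre k a = pre k b ↔ ∀ i : Fin m, (i : ℕ) < k → a i = b i := by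
  constructor
  · intro h i hi
    simpa [pre, hi] using congrFun h i
  · intro h
    ext i
    by_cases hi : (i : ℕ) < k
    · simp [pre, hi, h i hi]
    · simp [pre, hi]

/-- The function `φ` is not constant on the points of the product set that agree with `a` in the
first `k` coordinates. -/
def Nonfree (A : Fin m → Finset F) (φ : (Fin m → F) → F) (k : ℕ) (a : Fin m → F) : Prop :=
  ∃ b ∈ Fintype.piFinset A, ∃ c ∈ Fintype.piFinset A,
    pre k b = pre k a ∧ pre k c = pre k a ∧ φ b ≠ φ c

open Classical in
/-- The prefixes of length `k` that do not determine the value of `φ`. -/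
noncomputable def nonfreePrefixes (A : Fin m → Finset F) (φ : (Fin m → F) → F) (k : ℕ) :
    Finset (Fin m → F) :=
  ((Fintype.piFinset A).filter (Nonfree A φ k)).image (pre k)

/-- The factors of a function that, on the product set, indicates the points with prefix `w`
(`eval_prefix`). -/
noncomputable def prefixPoly (A : Fin m → Finset F) (k : ℕ) (w : Fin m → F) (i : Fin m) : F[X] :=
  if (i : ℕ) < k then lagPoly A w i else 1

/-- A partial point, extended by zeros. -/
def extend (z : PartialPoint F m) : Fin m → F := fun i => if h : (i : ℕ) < z.1 then z.2 ⟨i, h⟩ else 0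

theorem eval_prefix {k : ℕ} {w : Fin m → F} (hw : w ∈ (Fintype.piFinset A).image (pre k))
    {a : Fin m → F} (ha : a ∈ Fintype.piFinset A) :
    prodFun (prefixPoly A k w) a = if w = pre k a then 1 else 0 := by
  obtain ⟨b, hb, rfl⟩ := Finset.mem_image.1 hw
  rw [Fintype.mem_piFinset] at ha hb
  have hfac : ∀ i : Fin m, (prefixPoly A k (pre k b) i).eval (a i) =
      if (i : ℕ) < k then (if a i = b i then 1 else 0) else 1 := fun i => by
    rw [prefixPoly]
    split_ifs with hi hab
    · have hp : pre k b i = b i := by simp [pre, hi]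
      rw [eval_lagPoly (by rw [hp]; exact hb i) (ha i), hp, if_pos hab]
    · have hp : pre k b i = b i := by simp [pre, hi]
      rw [eval_lagPoly (by rw [hp]; exact hb i) (ha i), hp, if_neg hab]
    · simp
  rw [prodFun, Finset.prod_congr rfl fun i _ => hfac i]
  split_ifs with h
  · refine Finset.prod_eq_one fun i _ => ?_
    split_ifs with hi hab
    · rfl
    · exact absurd (pre_eq_iff.1 h i hi).symm hab
    · rfl
  · rw [pre_eq_iff] at h
    push Not at h
    obtain ⟨i, hi, hne⟩ := h
    exact Finset.prod_eq_zero (Finset.mem_univ i) (by rw [if_pos hi, if_neg (Ne.symm hne)])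

/-- A point of length at least `k` fixes all coordinates on which the prefix factor depends, so this
factor leaves the sum. The zeros in `extend` are harmless because later factors are `1`. -/
theorem sumWord_long {k : ℕ} {z : PartialPoint F m} (hz : k ≤ z.1) (w a : Fin m → F) :
    sumWord A (prodFun fun i => prefixPoly A k w i * lagPoly A a i) z =
      prodFun (prefixPoly A k w) (extend z) * sumWord A (lagFun A a) z := by
  rw [lagFun, sumWord_prodFun, sumWord_prodFun, prodFun, ← Finset.prod_mul_distrib]
  refine Finset.prod_congr rfl fun i _ => ?_
  simp only [factor, extend, prefixPoly]
  by_cases hi : (i : ℕ) < k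
  · have h : (i : ℕ) < z.1 := hi.trans_le hz
    simp [hi, h]
  · simp [hi]

/-- The first `k` factors agree, and each later coordinate is summed over, where every Lagrange
basis polynomial contributes `1`. -/
theorem sumWord_short {k : ℕ} {z : PartialPoint F m} (hz : (z.1 : ℕ) < k) (w : Fin m → F)
    {a b : Fin m → F} (ha : a ∈ Fintype.piFinset A) (hb : b ∈ Fintype.piFinset A)
    (hab : pre k a = pre k b) :
    sumWord A (prodFun fun i => prefixPoly A k w i * lagPoly A a i) z =
      sumWord A (prodFun fun i => prefixPoly A k w i * lagPoly A b i) z := by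
  rw [Fintype.mem_piFinset] at ha hb
  rw [sumWord_prodFun, sumWord_prodFun]
  refine Finset.prod_congr rfl fun i _ => ?_
  by_cases hi : (i : ℕ) < k
  · simp only [lagPoly, pre_eq_iff.1 hab i hi]
  · have h : ¬ (i : ℕ) < z.1 := fun h => hi (h.trans hz)
    simp only [factor, h, prefixPoly, hi, dite_false, if_false, one_mul]
    rw [sum_lagPoly (ha i), sum_lagPoly (hb i)]

/-- With more than `N` such prefixes, some nontrivial combination of their indicators vanishes at
all `N` extended points. Multiply it by `lagFun A b - lagFun A b'`, where `b` and `b'` share a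
prefix of nonzero coefficient but `φ b ≠ φ b'`. The functional kills the product: at long points
because of the combination, at short ones because `b` and `b'` give equal sums. Its expansion in
`φ`, however, is nonzero. -/
theorem card_nonfreePrefixes_le {d : Fin m → ℕ} (hd : ∀ i, 2 * ((A i).card - 1) ≤ d i)
    {Z : Fin N → PartialPoint F m} {c : Fin N → F} {φ : (Fin m → F) → F}
    (h : ∀ p ∈ lowDeg F d, functional A Z c p = ∑ a ∈ Fintype.piFinset A, p a * φ a) (k : ℕ) :
    (nonfreePrefixes A φ k).card ≤ N := by
  classical
  by_contra! hcard
  set W := nonfreePrefixes A φ k with hW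
  have hWA : ∀ w ∈ W, w ∈ (Fintype.piFinset A).image (pre k) := fun w hw =>
    Finset.image_subset_image (Finset.filter_subset _ _) hw
  -- A nonzero kernel vector `e` exists because `W` has more than `N` elements.
  let T : (W → F) →ₗ[F] (Fin N → F) :=
    { toFun := fun e j => ∑ w : W, e w * prodFun (prefixPoly A k w.1) (extend (Z j))
      map_add' := fun e e' => by
        ext j
        simp [add_mul, Finset.sum_add_distrib]
      map_smul' := fun r e => by
        ext j
        simp [Finset.mul_sum, mul_assoc] }
  obtain ⟨e, he, hne⟩ := Submodule.exists_mem_ne_zero_of_ne_bot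
    (LinearMap.ker_ne_bot_of_finrank_lt (f := T) (by simpa using hcard))
  obtain ⟨w₀, hw₀⟩ := Function.ne_iff.1 hne
  obtain ⟨a, ha, haw⟩ := Finset.mem_image.1 w₀.2
  obtain ⟨haA, b, hb, b', hb', hpb, hpb', hφ⟩ := Finset.mem_filter.1 ha
  let p : (Fin m → F) → F := ∑ w : W, e w •
    (prodFun (fun i => prefixPoly A k w.1 i * lagPoly A b i) -
      prodFun fun i => prefixPoly A k w.1 i * lagPoly A b' i)
  have hdeg : ∀ w ∈ W, ∀ {a : Fin m → F}, a ∈ Fintype.piFinset A →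
      prodFun (fun i => prefixPoly A k w i * lagPoly A a i) ∈ lowDeg F d := by
    intro w hw a ha
    obtain ⟨x, hx, rfl⟩ := Finset.mem_image.1 (hWA w hw)
    rw [Fintype.mem_piFinset] at ha hx
    refine prodFun_mem fun i => (natDegree_mul_le).trans ?_
    -- The first `k` coordinates carry two basis polynomials each, which accounts for the degree `2
    -- * ((A i).card - 1)`.
    have h1 : (prefixPoly A k (pre k x) i).natDegree ≤ (A i).card - 1 := by
      rw [prefixPoly]
      split_ifs with hi
      · exact (natDegree_lagPoly (by simpa [pre, hi] using hx i)).le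
      · simp
    have h2 := (natDegree_lagPoly (ha i)).le
    have := hd i
    omega
  have hp : p ∈ lowDeg F d := Submodule.sum_mem _ fun w _ => Submodule.smul_mem _ _
    (Submodule.sub_mem _ (hdeg w.1 w.2 hb) (hdeg w.1 w.2 hb'))
  have hzero : functional A Z c p = 0 := by
    have hsum : ∀ z, sumWord A p z = ∑ w : W, e w *
        (sumWord A (prodFun fun i => prefixPoly A k w.1 i * lagPoly A b i) z -
          sumWord A (prodFun fun i => prefixPoly A k w.1 i * lagPoly A b' i) z) := fun z => by
      simp only [sumWord, p, Finset.sum_apply, Pi.smul_apply, Pi.sub_apply, smul_eq_mul,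
        ← Finset.sum_sub_distrib, Finset.mul_sum]
      exact Finset.sum_comm
    rw [functional_apply]
    refine Finset.sum_eq_zero fun j _ => ?_
    rw [hsum]
    rcases lt_or_ge ((Z j).1 : ℕ) k with hz | hz
    · rw [Finset.sum_eq_zero, mul_zero]
      intro w _
      rw [sumWord_short hz w.1 hb hb' (hpb.trans hpb'.symm), sub_self, mul_zero]
    · have hT : ∑ w : W, e w * prodFun (prefixPoly A k w.1) (extend (Z j)) = 0 :=
        congrFun (LinearMap.mem_ker.1 he) j
      simp only [sumWord_long hz, ← mul_sub, ← mul_assoc, ← Finset.sum_mul]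
      rw [hT, mul_zero, zero_mul]
  -- On the product set, `p` is supported on `b` and `b'`, with the coefficient of the prefix as its
  -- value up to sign.
  have hval : ∀ x ∈ Fintype.piFinset A, p x =
      (∑ w : W, e w * if w.1 = pre k x then 1 else 0) *
        ((if x = b then 1 else 0) - if x = b' then 1 else 0) := fun x hx => by
    rw [Finset.sum_mul]
    simp only [p, Finset.sum_apply, Pi.smul_apply, Pi.sub_apply, smul_eq_mul]
    refine Finset.sum_congr rfl fun w _ => ?_
    rw [← eval_prefix (hWA w.1 w.2) hx, ← lagFun_apply hb hx, ← lagFun_apply hb' hx]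
    simp only [prodFun, lagFun, eval_mul, Finset.prod_mul_distrib]
    ring
  have hcoef : ∀ x, pre k x = pre k a →
      (∑ w : W, e w * if w.1 = pre k x then 1 else 0) = e w₀ := fun x hx => by
    rw [Finset.sum_eq_single w₀, if_pos (by rw [hx, haw]), mul_one]
    · intro w _ hw
      rw [if_neg, mul_zero]
      rw [hx, haw]
      exact fun h => hw (Subtype.ext h)
    · exact fun h => absurd (Finset.mem_univ _) h
  have hright : ∑ x ∈ Fintype.piFinset A, p x * φ x = e w₀ * (φ b - φ b') := by
    rw [Finset.sum_congr rfl fun x hx => by rw [hval x hx]]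
    simp only [mul_sub, sub_mul, Finset.sum_sub_distrib, mul_ite, ite_mul, mul_one, mul_zero,
      zero_mul, Finset.sum_ite_eq', hb, hb', if_true]
    simp only [mul_ite, mul_one, mul_zero] at hcoef
    rw [hcoef b hpb, hcoef b' hpb']
  rw [h p hp, hright, mul_eq_zero, sub_eq_zero] at hzero
  exact hzero.elim hw₀ hφ

/-- A symmetric function of which few prefixes matter is constant up to few points. -/
theorem exists_const (hsymm : ∀ i, A i.rev = A i) (hm : 0 < m) (hne : ∀ i, (A i).Nonempty)
    {φ : (Fin m → F) → F} (hφ : ∀ a ∈ Fintype.piFinset A, φ (rev a) = φ a)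
    (hcard : ∀ k, (nonfreePrefixes A φ k).card ≤ N) :
    ∃ c, ((Fintype.piFinset A).filter fun a => φ a ≠ c).card ≤ N * (N * ∑ i, (A i).card) := by
  classical
  have hcover : ∀ {k : ℕ} {a : Fin m → F}, a ∈ Fintype.piFinset A → Nonfree A φ k a →
      pre k a ∈ nonfreePrefixes A φ k := fun ha h =>
    Finset.mem_image_of_mem _ (Finset.mem_filter.2 ⟨ha, h⟩)
  -- Either some first half determines `φ`, and its value is the constant, or the product set itself
  -- is small.
  by_cases hex : ∃ b ∈ Fintype.piFinset A, ¬ Nonfree A φ (m / 2) b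
  · obtain ⟨b, hb, hbfree⟩ := hex
    refine ⟨φ b, ?_⟩
    set k := m - m / 2 with hk
    have hfree : ∀ a ∈ Fintype.piFinset A, ¬ Nonfree A φ k a → φ a = φ b := by
      intro a ha hafree
      -- The point `c` begins like `a`, while its reversal begins like `b`. Thus `φ a = φ c = φ (rev
      -- c) = φ b`.
      let c : Fin m → F := fun i => if (i : ℕ) < k then a i else rev b i
      have hc : c ∈ Fintype.piFinset A := Fintype.mem_piFinset.2 fun i => by
        simp only [c]
        split_ifs
        · exact Fintype.mem_piFinset.1 ha i
        · exact Fintype.mem_piFinset.1 (rev_mem hsymm hb) i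
      have h1 : φ c = φ a := by
        by_contra h
        refine hafree ⟨c, hc, a, ha, pre_eq_iff.2 fun i hi => ?_, rfl, h⟩
        simp [c, hi]
      have h2 : φ (rev c) = φ b := by
        by_contra h
        refine hbfree ⟨rev c, rev_mem hsymm hc, b, hb, pre_eq_iff.2 fun i hi => ?_, rfl, h⟩
        have : ¬ ((i.rev : Fin m) : ℕ) < k := by
          rw [Fin.val_rev]
          omega
        simp only [rev_apply, c, if_neg this, Fin.rev_rev]
      rw [← h1, ← hφ c hc, h2]
    -- An exceptional point has a nonfree prefix read from either end, and the two prefixes together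
    -- determine it.
    have hsub : ∀ a ∈ (Fintype.piFinset A).filter fun a => φ a ≠ φ b,
        (pre k a, pre k (rev a)) ∈ nonfreePrefixes A φ k ×ˢ nonfreePrefixes A φ k := by
      intro a ha
      obtain ⟨ha, hab⟩ := Finset.mem_filter.1 ha
      refine Finset.mem_product.2 ⟨hcover ha ?_, hcover (rev_mem hsymm ha) ?_⟩
      · by_contra h
        exact hab (hfree a ha h)
      · by_contra h
        exact hab ((hφ a ha).symm.trans (hfree _ (rev_mem hsymm ha) h))
    refine (Finset.card_le_card_of_injOn _ hsub ?_).trans ?_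
    · intro a _ a' _ h
      obtain ⟨h1, h2⟩ := Prod.mk.inj h
      rw [pre_eq_iff] at h1 h2
      ext i
      rcases lt_or_ge (i : ℕ) k with hi | hi
      · exact h1 i hi
      · have := h2 i.rev (by rw [Fin.val_rev]; omega)
        simpa [rev_apply] using this
    · rw [Finset.card_product]
      have h1 : 1 ≤ ∑ i, (A i).card :=
        (Finset.card_pos.2 (hne ⟨0, hm⟩)).trans_le
          (Finset.single_le_sum (f := fun i => (A i).card) (fun _ _ => Nat.zero_le _)
            (Finset.mem_univ _))
      calc _ ≤ N * N := Nat.mul_le_mul (hcard k) (hcard k)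
        _ ≤ N * (N * ∑ i, (A i).card) := Nat.mul_le_mul_left _ (Nat.le_mul_of_pos_right _ h1)
  · push Not at hex
    refine ⟨0, ?_⟩
    have hmid : m / 2 < m := Nat.div_lt_self hm (by norm_num)
    -- Every point is nonfree at `m / 2`; its two halves and the coordinate `m / 2`, which is the
    -- middle one if `m` is odd, determine it.
    have hsub : ∀ a ∈ (Fintype.piFinset A).filter fun a => φ a ≠ 0,
        (pre (m / 2) a, pre (m / 2) (rev a), a ⟨m / 2, hmid⟩) ∈
          nonfreePrefixes A φ (m / 2) ×ˢ nonfreePrefixes A φ (m / 2) ×ˢ A ⟨m / 2, hmid⟩ := by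
      intro a ha
      have ha := (Finset.mem_filter.1 ha).1
      exact Finset.mem_product.2 ⟨hcover ha (hex a ha), Finset.mem_product.2
        ⟨hcover (rev_mem hsymm ha) (hex _ (rev_mem hsymm ha)), Fintype.mem_piFinset.1 ha _⟩⟩
    refine (Finset.card_le_card_of_injOn _ hsub ?_).trans ?_
    · intro a _ a' _ h
      obtain ⟨h1, h2⟩ := Prod.mk.inj h
      obtain ⟨h2, h3⟩ := Prod.mk.inj h2
      rw [pre_eq_iff] at h1 h2
      ext i
      rcases lt_trichotomy (i : ℕ) (m / 2) with hi | hi | hi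
      · exact h1 i hi
      · have : i = ⟨m / 2, hmid⟩ := Fin.ext hi
        rw [this, h3]
      · have := h2 i.rev (by rw [Fin.val_rev]; omega)
        simpa [rev_apply] using this
    · rw [Finset.card_product, Finset.card_product]
      exact Nat.mul_le_mul (hcard _) (Nat.mul_le_mul (hcard _)
        (Finset.single_le_sum (f := fun i => (A i).card) (fun _ _ => Nat.zero_le _)
          (Finset.mem_univ _)))

end LowDeg

/-! ### The algorithm finds the relations and evaluates them -/

namespace LowDeg

universe u

open PolyComp

variable {F : Type u} {m n N : ℕ}

theorem atCoord_ofFn (x : PartialPoint F m) (i : ℕ) (f : F → F) (c : F) :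
    atCoord (List.ofFn x.2) i f c = if h : i < x.1 then f (x.2 ⟨i, h⟩) else c := by
  split_ifs with h
  · have hi : i < (List.ofFn x.2).length := by simpa using h
    rw [atCoord, List.drop_eq_getElem_cons hi]
    simp
  · have hi : (List.ofFn x.2).drop i = [] := by
      rw [List.drop_eq_nil_iff]
      simpa using h
    rw [atCoord, hi]

theorem sum_map_eq [DecidableEq F] {M : Type*} [AddCommMonoid M] {l : List F} {A : Finset F} (hl : l.Nodup)
    (hA : ∀ x, x ∈ l ↔ x ∈ A) (f : F → M) : (l.map f).sum = ∑ x ∈ A, f x := by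
  have : l.toFinset = A := by ext x; simp [hA]
  rw [← this, List.sum_toFinset _ hl]

theorem searchBound_eq [DecidableEq F] {A : Fin m → Finset F} {L : Fin m → List F}
    (hnodup : ∀ i, (L i).Nodup) (hL : ∀ i x, x ∈ L i ↔ x ∈ A i) :
    searchBound N L = N * (N * ∑ i, (A i).card) := by
  have : ∀ i, (L i).length = (A i).card := fun i => by
    have : (L i).toFinset = A i := by ext x; simp [hL]
    rw [← this, List.toFinset_card_of_nodup (hnodup i)]
  simp [searchBound, List.sum_ofFn, this]

variable [Field F]

theorem dot_left (c : Fin N → F) (r : VecPair F N) : dot (c, 0) r = ∑ j, c j * r.1 j := by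
  simp [dot]

variable [DecidableEq F]

theorem lag_eq {l : List F} {A : Finset F} (hl : l.Nodup) (hA : ∀ x, x ∈ l ↔ x ∈ A) (s x : F) :
    lag l s x = (Lagrange.basis A id s).eval x := by
  have hA' : l.toFinset = A := by ext x; simp [hA]
  rw [Lagrange.basis, Polynomial.eval_prod, lag, ← hA']
  trans ∏ t ∈ l.toFinset, if s - t = 0 then 1 else (x - t) / (s - t)
  · rw [List.prod_toFinset _ hl]
    congr! 3
    split_ifs <;> rfl
  -- The node `s` itself contributes the factor `1`.
  · rw [← Finset.prod_erase _ (a := s) (by simp)]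
    refine Finset.prod_congr rfl fun t ht => ?_
    rw [if_neg (sub_ne_zero.2 (Finset.ne_of_mem_erase ht).symm), Lagrange.basisDivisor]
    simp [div_eq_inv_mul]

/-! ### Product vectors as sums over subcubes -/

section Weights

variable {A : Fin m → Finset F} {L : Fin m → List F} (hnodup : ∀ i, (L i).Nodup)
  (hL : ∀ i x, x ∈ L i ↔ x ∈ A i) (hsymm : ∀ i, A i.rev = A i) (Z : Fin N → PartialPoint F m)

/-- The points, written as lists. -/
def lists (Z : Fin N → PartialPoint F m) : Fin N → List F := fun j => List.ofFn (Z j).2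

include hnodup hL

/-- The two indices differ when the list of level `i` is used at the mirror coordinate, which is
legitimate because the two sets agree. -/
theorem lagVec_eq (i i' : Fin m) (hi : A i = A i') (a : Fin m → F) (ha : a i' ∈ A i') (j : Fin N) :
    lagVec (lists Z) (L i) i' (a i') j = factor A (Z j) i' fun x => (lagPoly A a i').eval x := by
  rw [lagVec, lists, atCoord_ofFn, factor]
  split_ifs
  · rw [lag_eq (hnodup i) (hL i), lagPoly, hi]
  · rw [sum_lagPoly ha]

theorem prod_lagVec {a : Fin m → F} (ha : a ∈ Fintype.piFinset A) (j : Fin N) :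
    (∏ i : Fin m, lagVec (lists Z) (L i) i (a i)) j = sumWord A (lagFun A a) (Z j) := by
  rw [Finset.prod_apply, lagFun, sumWord_prodFun]
  exact Finset.prod_congr rfl fun i _ =>
    lagVec_eq hnodup hL Z i i rfl a (Fintype.mem_piFinset.1 ha i) j

theorem prod_powVec (e : Fin m → ℕ) (j : Fin N) :
    (∏ i : Fin m, powVec (lists Z) (L i) i (e i)) j =
      sumWord A (prodFun fun i => Polynomial.X ^ e i) (Z j) := by
  rw [Finset.prod_apply, sumWord_prodFun]
  refine Finset.prod_congr rfl fun i _ => ?_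
  rw [powVec, lists, atCoord_ofFn, factor]
  split_ifs
  · simp
  · rw [sum_map_eq (hnodup i) (hL i)]
    simp

include hsymm

/-- Expanding the product gives one term for each `a`. The factor of `a i` sits at coordinate
`i.rev`, which is where `rev a` has the entry `a i`. -/
theorem prod_powLagVec (e : Fin m → ℕ) (j : Fin N) :
    (∏ i : Fin m, powLagVec (lists Z) (L i) i.rev (e i)) j =
      ∑ a ∈ Fintype.piFinset A, (∏ i, a i ^ e i) * sumWord A (lagFun A (rev a)) (Z j) := by
  rw [Finset.prod_apply]
  have : ∀ i : Fin m, powLagVec (lists Z) (L i) i.rev (e i) j =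
      ∑ s ∈ A i, s ^ e i * lagVec (lists Z) (L i) i.rev s j := fun i =>
    sum_map_eq (hnodup i) (hL i) _
  rw [Finset.prod_congr rfl fun i _ => this i, Finset.prod_univ_sum]
  refine Finset.sum_congr rfl fun a ha => ?_
  rw [Finset.prod_mul_distrib]
  congr 1
  rw [← prod_lagVec hnodup hL Z (rev_mem hsymm ha), Finset.prod_apply,
    ← Equiv.prod_comp Fin.revPerm]
  refine Finset.prod_congr rfl fun i _ => ?_
  have hr := Fintype.mem_piFinset.1 (rev_mem hsymm ha)
  have h1 := lagVec_eq hnodup hL Z i.rev i (hsymm i) (rev a) (hr i) j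
  have h2 := lagVec_eq hnodup hL Z i i rfl (rev a) (hr i) j
  rw [h2, ← h1]
  simp [rev]

/-- The choices of one element of each of the levels for palindromes correspond to palindromes. -/
theorem palLevel_prod {a : Fin m → F} (ha : a ∈ Fintype.piFinset A) (hrev : rev a = a)
    {w : Fin m → VecPair F N}
    (hw : ∀ i : Fin m, w i = if (i.rev : ℕ) ≤ i then
      if (i : ℕ) ≤ i.rev then (lagVec (lists Z) (L i) i (a i), 1) else (1, 1)
      else (lagVec (lists Z) (L i) i (a i) * lagVec (lists Z) (L i) i.rev (a i), 1)) :
    (∏ i, w i).1 = ∏ i : Fin m, lagVec (lists Z) (L i) i (a i) := by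
  have hai : ∀ i, a i.rev = a i := fun i => congrFun hrev i
  have hV : ∀ i : Fin m, lagVec (lists Z) (L i) i.rev (a i) =
      lagVec (lists Z) (L i.rev) i.rev (a i.rev) := fun i => by
    ext j
    have hr := Fintype.mem_piFinset.1 ha
    rw [← hai i, lagVec_eq hnodup hL Z i i.rev (hsymm i).symm a (hr _),
      lagVec_eq hnodup hL Z i.rev i.rev rfl a (hr _)]
  have hfst : (∏ i, w i).1 = ∏ i, (w i).1 := map_prod (MonoidHom.fst _ _) _ _
  -- The mirror factor, carried by the first half, is split off; reindexing by reversal then returns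
  -- it to its own coordinate.
  have hsplit : ∀ i : Fin m, (w i).1 =
      (if (i : ℕ) ≤ i.rev then lagVec (lists Z) (L i) i (a i) else 1) *
        if (i : ℕ) < i.rev then lagVec (lists Z) (L i.rev) i.rev (a i.rev) else 1 := fun i => by
    rw [hw i, hV i]
    rcases lt_trichotomy (i : ℕ) i.rev with h | h | h
    · simp only [if_neg h.not_ge, if_pos h.le, if_pos h]
    · simp only [if_pos h.le, if_pos h.ge, if_neg h.not_lt, mul_one]
    · simp only [if_pos h.le, if_neg h.not_ge, if_neg h.not_gt, mul_one]
  rw [hfst, Finset.prod_congr rfl fun i _ => hsplit i, Finset.prod_mul_distrib,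
    ← Equiv.prod_comp Fin.revPerm fun i : Fin m =>
      if (i : ℕ) < i.rev then lagVec (lists Z) (L i.rev) i.rev (a i.rev) else 1,
    ← Finset.prod_mul_distrib]
  refine Finset.prod_congr rfl fun i _ => ?_
  simp only [Fin.revPerm_apply, Fin.rev_rev]
  rcases le_or_gt (i : ℕ) i.rev with h | h
  · rw [if_pos h, if_neg h.not_gt, mul_one]
  · rw [if_neg h.not_ge, if_pos h, one_mul]

end Weights

theorem decide_eq_true_iff' (p : Prop) (i : Decidable p) : @decide p i = true ↔ p :=
  decide_eq_true_iff

section Conditions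

variable {A : Fin m → Finset F} {L : Fin m → List F} (hnodup : ∀ i, (L i).Nodup)
  (hL : ∀ i x, x ∈ L i ↔ x ∈ A i) (hsymm : ∀ i, A i.rev = A i) (d : Fin m → ℕ)

include hnodup hL hsymm

theorem dot_powRows (Z : Fin N → PartialPoint F m) (c : Fin N → F) :
    (∀ w ∈ powRows (lists Z) L d, dot (c, 0) (w.1 - w.2, 0) = 0) ↔
      ∀ e : Fin m → ℕ, (∀ i, e i ≤ d i) → functional A Z c (prodFun fun i => Polynomial.X ^ e i) =
        ∑ a ∈ Fintype.piFinset A, (∏ i, a i ^ e i) * functional A Z c (lagFun A (rev a)) := by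
  -- Moving the difference into the coefficients turns the tests into genuine product vectors.
  have h1 : ∀ w : VecPair F N, dot (c, 0) (w.1 - w.2, 0) = dot (c, -c) w := fun w => by
    simp [dot, sub_eq_add_neg, mul_add, Finset.sum_add_distrib]
  simp only [h1]
  rw [powRows, dot_products_ofFn]
  have key : ∀ e : Fin m → ℕ, dot (c, -c) ((∏ i : Fin m, (powVec (lists Z) (L i) i (e i),
      powLagVec (lists Z) (L i) i.rev (e i))) * (1, 1)) =
      functional A Z c (prodFun fun i => Polynomial.X ^ e i) -
        ∑ a ∈ Fintype.piFinset A, (∏ i, a i ^ e i) * functional A Z c (lagFun A (rev a)) := by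
    intro e
    have hfst : (∏ i : Fin m, (powVec (lists Z) (L i) i (e i),
        powLagVec (lists Z) (L i) i.rev (e i))).1 = ∏ i : Fin m, powVec (lists Z) (L i) i (e i) :=
      map_prod (MonoidHom.fst _ _) _ _
    have hsnd : (∏ i : Fin m, (powVec (lists Z) (L i) i (e i),
        powLagVec (lists Z) (L i) i.rev (e i))).2 =
        ∏ i : Fin m, powLagVec (lists Z) (L i) i.rev (e i) :=
      map_prod (MonoidHom.snd _ _) _ _
    simp only [dot, Prod.fst_mul, Prod.snd_mul, mul_one, hfst, hsnd,
      prod_powVec hnodup hL Z e, prod_powLagVec hnodup hL hsymm Z e, functional_apply,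
      Pi.neg_apply, neg_mul, Finset.sum_neg_distrib, ← sub_eq_add_neg, Finset.mul_sum]
    congr 1
    rw [Finset.sum_comm]
    exact Finset.sum_congr rfl fun a _ => Finset.sum_congr rfl fun j _ => by ring
  constructor
  · intro h e he
    rw [← sub_eq_zero, ← key]
    exact h _ fun i => List.mem_map.2 ⟨e i, List.mem_range.2 (Nat.lt_succ_of_le (he i)), rfl⟩
  · intro h w hw
    choose e he hew using fun i => List.mem_map.1 (hw i)
    rw [← funext hew] at *
    have := key e
    rw [this, sub_eq_zero]
    exact h e fun i => Nat.le_of_lt_succ (List.mem_range.1 (he i))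

theorem dot_palRows (Z : Fin N → PartialPoint F m) (hne : ∀ i, (A i).Nonempty) (c : Fin N → F) :
    (∀ w ∈ palRows (lists Z) L, dot (c, 0) (w.1, 0) = 0) ↔
      ∀ a ∈ Fintype.piFinset A, rev a = a → functional A Z c (lagFun A a) = 0 := by
  have h1 : ∀ w : VecPair F N, dot (c, 0) (w.1, 0) = dot (c, 0) w := fun w => by
    simp [dot]
  simp only [h1]
  rw [palRows, dot_products_ofFn]
  have key : ∀ {a : Fin m → F}, a ∈ Fintype.piFinset A → ∀ {w : Fin m → VecPair F N},
      (∏ i, w i).1 = (∏ i : Fin m, lagVec (lists Z) (L i) i (a i)) →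
      dot (c, 0) ((∏ i, w i) * (1, 0)) = functional A Z c (lagFun A a) := by
    intro a ha w hw
    rw [dot_left, functional_apply]
    refine Finset.sum_congr rfl fun j _ => ?_
    rw [Prod.fst_mul, hw, mul_one, prod_lagVec hnodup hL Z ha]
  constructor
  · intro h a ha hrev
    rw [← key ha (palLevel_prod hnodup hL hsymm Z ha hrev fun i => rfl)]
    refine h _ fun i => ?_
    have hai : a i ∈ L i := (hL i _).2 (Fintype.mem_piFinset.1 ha i)
    rw [palLevel]
    split_ifs
    · exact List.mem_map.2 ⟨_, hai, rfl⟩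
    · exact List.mem_singleton.2 rfl
    · exact List.mem_map.2 ⟨_, hai, rfl⟩
  · intro h w hw
    have hex : ∀ i : Fin m, ∃ s ∈ A i, w i = if (i.rev : ℕ) ≤ i then
        if (i : ℕ) ≤ i.rev then (lagVec (lists Z) (L i) i s, 1) else (1, 1)
        else (lagVec (lists Z) (L i) i s * lagVec (lists Z) (L i) i.rev s, 1) := by
      intro i
      have := hw i
      rw [palLevel] at this
      split_ifs at this ⊢
      · obtain ⟨s, hs, h⟩ := List.mem_map.1 this
        exact ⟨s, (hL i s).1 hs, h.symm⟩
      · exact ⟨_, (hne i).choose_spec, List.mem_singleton.1 this⟩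
      · obtain ⟨s, hs, h⟩ := List.mem_map.1 this
        exact ⟨s, (hL i s).1 hs, h.symm⟩
    choose s hs hws using hex
    -- Choices in the first half are mirrored; those in the second half do not affect `w`.
    let a : Fin m → F := fun i => if (i : ℕ) ≤ i.rev then s i else s i.rev
    have ha : a ∈ Fintype.piFinset A := Fintype.mem_piFinset.2 fun i => by
      simp only [a]
      split_ifs
      · exact hs i
      · exact hsymm i ▸ hs i.rev
    have hrev : rev a = a := by
      ext i
      simp only [rev, a, Fin.rev_rev]
      rcases lt_trichotomy (i : ℕ) i.rev with h | h | h
      · rw [if_neg h.not_ge, if_pos h.le]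
      · rw [if_pos h.ge, if_pos h.le, ← Fin.ext h]
      · rw [if_pos h.le, if_neg h.not_ge]
    rw [key ha (palLevel_prod hnodup hL hsymm Z ha hrev fun i => ?_)]
    · exact h a ha hrev
    · rw [hws i]
      by_cases h1 : (i : ℕ) ≤ i.rev
      · simp only [a, h1, if_true]
      · have h2 : (i.rev : ℕ) ≤ i := (not_le.1 h1).le
        simp only [h1, h2, if_true, if_false]

theorem dot_conditions (Z : Fin (n + 1) → PartialPoint F m) (hne : ∀ i, (A i).Nonempty)
    (c : Fin (n + 1) → F) :
    (∀ r ∈ conditions (lists Z) L d, dot (c, 0) r = 0) ↔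
      Conditions A d (functional A Z c) ∧ c 0 = 0 := by
  have h0 : dot (c, 0) (unitVec F n, 0) = c 0 := by
    simp [dot_left, unitVec, Fin.sum_univ_succ]
  rw [conditions]
  simp only [List.forall_mem_append, List.forall_mem_map, List.forall_mem_singleton, h0]
  rw [dot_powRows hnodup hL hsymm d]
  constructor
  · rintro ⟨h1, h2, h3⟩
    refine ⟨⟨h1, fun h => ?_⟩, h3⟩
    rw [if_pos h, List.forall_mem_map] at h2
    exact (dot_palRows hnodup hL hsymm Z hne c).1 h2
  · rintro ⟨⟨h1, h2⟩, h3⟩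
    refine ⟨h1, ?_, h3⟩
    split_ifs with h
    · rw [List.forall_mem_map]
      exact (dot_palRows hnodup hL hsymm Z hne c).2 (h2 h)
    · simp

theorem mem_span_relations_iff (Z : Fin (n + 1) → PartialPoint F m) (hne : ∀ i, (A i).Nonempty)
    (c : Fin (n + 1) → F) :
    (c, 0) ∈ Submodule.span F {y | y ∈ relations (lists Z) L d} ↔
      Conditions A d (functional A Z c) ∧ c 0 = 0 := by
  rw [mem_span_relations, ← dot_conditions hnodup hL hsymm d Z hne]
  simp

/-- All generators of the relations vanish at position `1`, hence so does their span. -/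
theorem apply_one_eq_zero (Z : Fin (n + 2) → PartialPoint F m) (hne : ∀ i, (A i).Nonempty)
    (h : usefulRelations (lists Z) L d = []) {c : Fin (n + 2) → F}
    (hc : Conditions A d (functional A Z c)) (hc0 : c 0 = 0) : c (Fin.succ 0) = 0 := by
  have hmem := (mem_span_relations_iff hnodup hL hsymm d Z hne c).2 ⟨hc, hc0⟩
  have hle : Submodule.span F {y | y ∈ relations (lists Z) L d} ≤
      LinearMap.ker (LinearMap.proj (R := F) (φ := fun _ => F) (Fin.succ 0 : Fin (n + 2)) ∘ₗ
        LinearMap.fst F (Fin (n + 2) → F) (Fin (n + 2) → F)) := by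
    refine Submodule.span_le.2 fun y hy => ?_
    have := List.filter_eq_nil_iff.1 h y hy
    exact not_not.1 (mt (decide_eq_true_iff' _ _).2 this)
  simpa using hle hmem

theorem coeffs_spec (Z : Fin (n + 2) → PartialPoint F m) (hne : ∀ i, (A i).Nonempty)
    (h : usefulRelations (lists Z) L d ≠ []) :
    Conditions A d (functional A Z (coeffs (lists Z) L d)) ∧ coeffs (lists Z) L d 0 = 0 ∧
      coeffs (lists Z) L d (Fin.succ 0) = 1 := by
  obtain ⟨κ, t, hκ⟩ := List.exists_cons_of_ne_nil h
  have hmem := List.mem_filter.1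
    (hκ ▸ List.mem_cons_self : κ ∈ usefulRelations (lists Z) L d)
  have hpiv : κ.1 (Fin.succ 0) ≠ 0 := (decide_eq_true_iff' _ _).1 hmem.2
  have hc : coeffs (lists Z) L d = fun i => κ.1 i / κ.1 (Fin.succ 0) := by
    rw [coeffs, hκ]
  have hspan : κ ∈ Submodule.span F {y | y ∈ relations (lists Z) L d} :=
    Submodule.subset_span hmem.1
  have hκ2 := ((mem_span_relations _ _ _ _).1 hspan).1
  have : ((coeffs (lists Z) L d), 0) = (κ.1 (Fin.succ 0))⁻¹ • κ := by
    refine Prod.ext ?_ ?_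
    · rw [hc]
      ext i
      simp [div_eq_inv_mul]
    · simp [hκ2]
  have h3 := (mem_span_relations_iff hnodup hL hsymm d Z hne _).1
    (this ▸ Submodule.smul_mem _ _ hspan)
  exact ⟨h3.1, h3.2, by rw [hc]; exact div_self hpiv⟩

end Conditions

/-- The first of the points is `⊥`. -/
theorem functional_sub_unitVec {A : Fin m → Finset F} {Z : Fin (n + 1) → PartialPoint F m} (hZ : (Z 0).1 = 0)
    (c : Fin (n + 1) → F) (c₀ : F) {a : Fin m → F} (ha : a ∈ Fintype.piFinset A) :
    functional A Z (fun j => c j - c₀ * unitVec F n j) (lagFun A a) =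
      functional A Z c (lagFun A a) - c₀ := by
  have h0 : sumWord A (lagFun A a) (Z 0) = 1 := by
    rw [lagFun, sumWord_prodFun]
    refine Finset.prod_eq_one fun i _ => ?_
    rw [factor, dif_neg (by simp [hZ]), sum_lagPoly (Fintype.mem_piFinset.1 ha i)]
  simp only [functional_apply, sub_mul, Finset.sum_sub_distrib]
  congr 1
  simp [Fin.sum_univ_succ, unitVec, h0]

/-! ### Finding the constant and the exceptional points -/

section Search

variable {A : Fin m → Finset F} {L : Fin m → List F} (hnodup : ∀ i, (L i).Nodup)
  (hL : ∀ i x, x ∈ L i ↔ x ∈ A i)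

include hnodup hL

/-- Sums over all paths, in terms of the points of the product set. -/
theorem sum_full_lagLevels {M : Type*} [AddCommMonoid M] (Z : Fin N → PartialPoint F m)
    (μ : Fin N → F) (G : List F → F → M) :
    ((full (lagLevels (lists Z) L) [([], μ)]).map fun x => G x.1 (weight x)).sum =
      ∑ a ∈ Fintype.piFinset A, G (List.ofFn a) (functional A Z μ (lagFun A a)) := by
  rw [lagLevels, sum_full hnodup hL (fun i s => lagVec (lists Z) (L i) i s) μ
    fun x => G x.1 (weight x)]
  refine Finset.sum_congr rfl fun a ha => ?_
  simp only [weight, functional_apply, Pi.mul_apply]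
  congr 1
  exact Finset.sum_congr rfl fun j _ => by rw [prod_lagVec hnodup hL Z ha]

theorem countP_full_lagLevels (Z : Fin N → PartialPoint F m) (μ : Fin N → F) (q : F → Prop)
    [DecidablePred q] :
    (full (lagLevels (lists Z) L) [([], μ)]).countP (fun x => q (weight x)) =
      ((Fintype.piFinset A).filter fun a => q (functional A Z μ (lagFun A a))).card := by
  rw [Finset.card_filter, ← sum_full_lagLevels hnodup hL Z μ fun _ w => if q w then 1 else 0]
  induction full (lagLevels (lists Z) L) [([], μ)] with
  | nil => rfl
  | cons x l ih => by_cases h : q (weight x) <;> simp [h, ih, add_comm]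

theorem mem_full_lagLevels (Z : Fin N → PartialPoint F m) (μ : Fin N → F)
    {x : Path F N} (hx : x ∈ full (lagLevels (lists Z) L) [([], μ)]) :
    ∃ a ∈ Fintype.piFinset A, x.1 = List.ofFn a := by
  classical
  by_contra! h
  -- Sum the indicator of the lists that are not points: the right-hand side is `0`, so no path
  -- contributes.
  have h1 := sum_full_lagLevels hnodup hL Z μ
    fun b _ => if ∀ a ∈ Fintype.piFinset A, b ≠ List.ofFn a then 1 else 0
  rw [Finset.sum_eq_zero (s := Fintype.piFinset A) fun a ha => if_neg fun h => h a ha rfl,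
    List.sum_eq_zero_iff] at h1
  have := h1 _ (List.mem_map.2 ⟨x, hx, rfl⟩)
  rw [if_pos h] at this
  exact one_ne_zero this

/-- More than `bound` candidates must include a point where the value is `c₀`. If there are fewer,
the candidates are all points; then the whole product set is within the bound, and any constant
works. -/
theorem search_ne_nil {Z : Fin (n + 1) → PartialPoint F m} (hZ : (Z 0).1 = 0)
    (c : Fin (n + 1) → F) (hne : ∀ i, (A i).Nonempty) (hb : 1 ≤ searchBound (n + 1) L)
    (hc : ∃ c₀, ((Fintype.piFinset A).filter fun a => functional A Z c (lagFun A a) ≠ c₀).card ≤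
      searchBound (n + 1) L) : search (lists Z) L c ≠ [] := by
  classical
  set bound := searchBound (n + 1) L with hbound
  have hls : ∀ l ∈ lagLevels (lists Z) L, l ≠ [] := by
    intro l hl
    obtain ⟨i, rfl⟩ := List.mem_ofFn.1 (List.mem_reverse.1 hl)
    obtain ⟨s, hs⟩ := hne i
    exact List.ne_nil_of_mem (List.mem_map.2 ⟨s, (hL i s).2 hs, rfl⟩)
  have hsupp : ∀ c₀ : F, (fullSupport (lagLevels (lists Z) L)
      [([], fun j => c j - c₀ * unitVec F n j)]).length =
        ((Fintype.piFinset A).filter fun a => functional A Z c (lagFun A a) ≠ c₀).card := by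
    intro c₀
    rw [fullSupport, ← List.countP_eq_length_filter]
    have := countP_full_lagLevels hnodup hL Z (fun j => c j - c₀ * unitVec F n j) (fun w => ¬ w = 0)
    refine Eq.trans (by congr!) (this.trans ?_)
    congr 1
    refine Finset.filter_congr fun a ha => ?_
    rw [functional_sub_unitVec hZ c c₀ ha, sub_eq_zero]
  obtain ⟨c₀, hc₀⟩ := hc
  suffices h : ∃ x ∈ cands bound (lagLevels (lists Z) L) c,
      ((Fintype.piFinset A).filter fun a => functional A Z c (lagFun A a) ≠ weight x).card ≤
        bound by
    obtain ⟨x, hx, hxb⟩ := h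
    rw [← hsupp] at hxb
    obtain ⟨r, hr⟩ := List.exists_mem_of_ne_nil _ ((enum_spec hb _ _).2 hxb)
    exact List.ne_nil_of_mem (List.mem_flatMap.2 ⟨x, hx, List.mem_map.2 ⟨r, hr, rfl⟩⟩)
  by_cases hex : ∃ x ∈ cands bound (lagLevels (lists Z) L) c, weight x = c₀
  · obtain ⟨x, hx, rfl⟩ := hex
    exact ⟨x, hx, hc₀⟩
  · push Not at hex
    have hcount : (cands bound (lagLevels (lists Z) L) c).length ≤ bound := by
      have h1 := (cands_sublist bound (lagLevels (lists Z) L)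
        (List.Sublist.refl [(([] : List F), c)])).countP_le (p := fun x => ¬ weight x = c₀)
      rw [countP_full_lagLevels hnodup hL Z c fun w => ¬ w = c₀] at h1
      refine le_trans ?_ (h1.trans hc₀)
      refine (List.countP_eq_length.2 fun x hx => ?_).ge
      simpa using hex x hx
    have hfull := (cands_eq_or bound hls [(([] : List F), c)]).resolve_right (not_lt.2 hcount)
    have hpos := length_le_cands bound hls [(([] : List F), c)]
    obtain ⟨x, hx⟩ := List.exists_mem_of_length_pos (l := cands bound (lagLevels (lists Z) L) c)
      (Nat.lt_of_lt_of_le (by simp) hpos)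
    refine ⟨x, hx, (Finset.card_filter_le _ _).trans ?_⟩
    have hcard := countP_full_lagLevels hnodup hL Z c fun _ => True
    rw [Finset.filter_true_of_mem (by simp)] at hcard
    rw [← hcard, ← hfull]
    exact List.countP_le_length.trans hcount

theorem search_spec {Z : Fin (n + 1) → PartialPoint F m} (hZ : (Z 0).1 = 0)
    (c : Fin (n + 1) → F) (hb : 1 ≤ searchBound (n + 1) L)
    {r : F × List (Path F (n + 1))} (hr : r ∈ search (lists Z) L c) :
    r.2.length ≤ searchBound (n + 1) L ∧ (∀ x ∈ r.2, ∃ a ∈ Fintype.piFinset A, x.1 = List.ofFn a) ∧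
      ∀ val : List F → F, (r.2.map fun x => weight x * val x.1).sum =
        ∑ a ∈ Fintype.piFinset A, (functional A Z c (lagFun A a) - r.1) * val (List.ofFn a) := by
  classical
  obtain ⟨x, _, hx⟩ := List.mem_flatMap.1 hr
  obtain ⟨r', hr', rfl⟩ := List.mem_map.1 hx
  obtain ⟨h1, h2⟩ := (enum_spec hb _ _).1 r' hr'
  refine ⟨h2, fun y hy => mem_full_lagLevels hnodup hL Z _ ((enum_sublist hr').subset hy),
    fun val => ?_⟩
  -- Paths of weight zero do not contribute, so the lists need only be compared on their supports.
  have hfilter : ∀ l : List (Path F (n + 1)), (l.map fun x => weight x * val x.1).sum =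
      ((l.filter fun x => ¬ weight x = 0).map fun x => weight x * val x.1).sum := by
    intro l
    induction l with
    | nil => rfl
    | cons y l ih => by_cases h : weight y = 0 <;> simp_all
  have h1' : (r'.filter fun x => ¬ weight x = 0) = (full (lagLevels (lists Z) L)
      [([], fun j => c j - weight x * unitVec F n j)]).filter fun x => ¬ weight x = 0 := by
    convert h1 using 2 <;>
      exact List.filter_congr fun _ _ => by congr
  rw [hfilter, h1', ← hfilter, sum_full_lagLevels hnodup hL Z _ fun b w => w * val b]
  exact Finset.sum_congr rfl fun a ha => by
    rw [functional_sub_unitVec hZ c _ ha]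

/-- The plan evaluates the relation. -/
theorem plan_spec (hm : 0 < m) (hsymm : ∀ i, A i.rev = A i) (hne : ∀ i, (A i).Nonempty)
    {d : Fin m → ℕ} (hd : ∀ i, 2 * ((A i).card - 1) ≤ d i)
    {Z : Fin (n + 2) → PartialPoint F m} (hZ : (Z 0).1 = 0)
    (h : usefulRelations (lists Z) L d ≠ []) :
    (plan (lists Z) L d).length ≤ searchBound (n + 2) L + 1 ∧
      (∀ q ∈ plan (lists Z) L d, q.1 = [] ∨ ∃ a ∈ Fintype.piFinset A, q.1 = List.ofFn a) ∧
      ∀ val : List F → F, val [] = ∑ a ∈ Fintype.piFinset A, val (List.ofFn a) →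
        ((plan (lists Z) L d).map fun q => q.2 * val q.1).sum =
          ∑ a ∈ Fintype.piFinset A, val (List.ofFn a) *
            functional A Z (coeffs (lists Z) L d) (lagFun A a) := by
  have hd' : ∀ i, (A i).card - 1 ≤ d i := fun i => by have := hd i; omega
  obtain ⟨hcond, _, _⟩ := coeffs_spec hnodup hL hsymm d Z hne h
  have hb : 1 ≤ searchBound (n + 2) L := by
    rw [searchBound_eq hnodup hL]
    have h1 : 1 ≤ ∑ i, (A i).card :=
      (Finset.card_pos.2 (hne ⟨0, hm⟩)).trans_le
        (Finset.single_le_sum (f := fun i => (A i).card) (fun _ _ => Nat.zero_le _)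
          (Finset.mem_univ _))
    exact Nat.succ_le_of_lt (by positivity)
  have hconst := exists_const (N := n + 2) hsymm hm hne
    (φ := fun a => functional A Z (coeffs (lists Z) L d) (lagFun A a))
    (fun a ha => hcond.symm hd' ha)
    (card_nonfreePrefixes_le hd fun p hp => hcond.apply' hd' hp)
  rw [← searchBound_eq hnodup hL] at hconst
  obtain ⟨r, t, hr⟩ := List.exists_cons_of_ne_nil
    (search_ne_nil hnodup hL hZ (coeffs (lists Z) L d) hne hb hconst)
  have hplan : plan (lists Z) L d = questions r := by rw [plan, hr]
  obtain ⟨h1, h2, h3⟩ := search_spec hnodup hL hZ (coeffs (lists Z) L d) hb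
    (hr ▸ List.mem_cons_self)
  rw [hplan, questions]
  refine ⟨by simpa using h1, ?_, fun val hval => ?_⟩
  · intro q hq
    rcases List.mem_cons.1 hq with rfl | hq
    · exact Or.inl rfl
    · obtain ⟨x, hx, rfl⟩ := List.mem_map.1 hq
      exact Or.inr (h2 x hx)
  · rw [List.map_cons, List.sum_cons, List.map_map]
    refine (congrArg _ (h3 val)).trans ?_
    -- The answer at `⊥` is the total sum, so it accounts for the constant part of the coefficients.
    rw [hval, Finset.mul_sum, ← Finset.sum_add_distrib]
    exact Finset.sum_congr rfl fun a _ => by ring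

end Search

end LowDeg

/-! ### The law of the encoding -/

namespace PMF

universe u v

variable {α : Type u} {β : Type v}

theorem eq_uniformOfFintype [Fintype α] [Nonempty α] (μ : PMF α) (h : ∀ a b, μ a = μ b) :
    μ = uniformOfFintype α := by
  ext a
  have h1 := μ.tsum_coe
  rw [tsum_fintype, Finset.sum_congr rfl fun b _ => h b a, Finset.sum_const, nsmul_eq_mul] at h1
  rw [uniformOfFintype_apply]
  exact ENNReal.eq_inv_of_mul_eq_one_left (by rw [mul_comm]; exact h1)

theorem map_apply_of_injective (μ : PMF α) {f : α → β} (hf : Function.Injective f) (a : α) :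
    μ.map f (f a) = μ a := by
  classical
  rw [map_apply, tsum_eq_single a]
  · simp
  · intro b hb
    rw [if_neg fun h => hb (hf h).symm]

theorem map_eq_pure (μ : PMF α) {f : α → β} {b : β} (h : ∀ a ∈ μ.support, f a = b) :
    μ.map f = pure b := by
  have : μ.map f = μ.map fun _ => b := by
    simp only [map, bind]
    refine PMF.ext fun x => tsum_congr fun a => ?_
    by_cases ha : μ a = 0
    · simp [ha]
    · rw [Function.comp_apply, Function.comp_apply, h a ((mem_support_iff _ _).2 ha)]
  rw [this]
  exact map_const _ _

theorem uniformOn_apply_congr [Finite α] [Finite β] {s : Set α} {t : Set β} (hs : s.Nonempty)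
    (ht : t.Nonempty) (e : α ≃ β) (h : ∀ a, e a ∈ t ↔ a ∈ s) (a : α) :
    uniformOn t ht (e a) = uniformOn s hs a := by
  classical
  have hcard : s.toFinite.toFinset.card = t.toFinite.toFinset.card :=
    Finset.card_bij (fun a _ => e a) (fun a ha => by simpa [h] using ha)
      (fun a _ b _ hab => e.injective hab) fun b hb => ⟨e.symm b, by
        rw [Set.Finite.mem_toFinset, ← h]; simpa using hb, by simp⟩
  rw [uniformOn, uniformOn, uniformOfFinset_apply, uniformOfFinset_apply, hcard]
  simp [h]

theorem mem_support_uniformOn [Finite α] {s : Set α} (hs : s.Nonempty) {a : α} :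
    a ∈ (uniformOn s hs).support ↔ a ∈ s := by
  rw [uniformOn, mem_support_uniformOfFinset_iff, Set.Finite.mem_toFinset]

end PMF

/-! ### Translation invariance of the encoding -/

namespace LowDeg

universe u

variable {F : Type u} [Field F] {m : ℕ} {A : Fin m → Finset F}

theorem mem_lowDeg_iff {d : Fin m → ℕ} {p : (Fin m → F) → F} :
    p ∈ lowDeg F d ↔ ∃ P : MvPolynomial (Fin m) F, (∀ i, P.degreeOf i ≤ d i) ∧
      (fun x => MvPolynomial.eval x P) = p := by
  simp only [funext_iff]
  rfl

/-- Sums over subcubes, as a linear map. -/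
def sumWordHom (A : Fin m → Finset F) : ((Fin m → F) → F) →ₗ[F] (PartialPoint F m → F) where
  toFun := sumWord A
  map_add' p q := by
    ext x
    simp [sumWord, Finset.sum_add_distrib]
  map_smul' c p := by
    ext x
    simp [sumWord, Finset.mul_sum]

/-- The subcube of a prefix of full length is a single point, so `w` can be read off. -/
theorem sumWordOn_injective : Function.Injective (sumWordOn A) := by
  classical
  have h : ∀ (w : Points A → F) (a : Points A), sumWordOn A w ⟨⟨Fin.last m, a.1⟩,
      fun i => Fintype.mem_piFinset.1 a.2 i⟩ = w a := by
    intro w a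
    rw [sumWordOn, Finset.sum_eq_single a]
    · intro b hb hba
      refine absurd (Subtype.ext (funext fun i => ?_)) hba
      have := Fintype.mem_piFinset.1 (Finset.mem_filter.1 hb).2 i
      simpa using this
    · intro h
      rw [Finset.mem_filter] at h
      refine absurd ⟨Finset.mem_univ _, Fintype.mem_piFinset.2 fun i => ?_⟩ h
      simp
  intro v w hvw
  ext a
  rw [← h v, hvw, h]

section Law

variable [Fintype F] {d : Fin m → ℕ} (hd : ∀ i, 2 * ((A i).card - 1) ≤ d i) (f : messages A)

include hd

theorem encPCP_apply (u : PartialPoint F m → F) :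
    encPCP A d hd f u = ∑' g, uniformOn (AntiSym A) ⟨0, fun _ _ _ => by simp⟩ g *
      encSigmaRM A d (fun i => by have := hd i; omega)
        ⟨sumWordOn A fun a => f.1 (some a) + g a, _, rfl⟩ u := by
  rw [encPCP, encSigmaAntiSym, PMF.bind_map, PMF.bind_apply]
  rfl

theorem exists_of_mem_support_encPCP {u : PartialPoint F m → F}
    (hu : u ∈ (encPCP A d hd f).support) : ∃ p ∈ lowDeg F d, u = sumWord A p ∧
      ∃ g ∈ AntiSym A, ∀ a : Points A, p a.1 = f.1 (some a) + g a := by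
  rw [encPCP, PMF.mem_support_bind_iff] at hu
  obtain ⟨c, hc, hu⟩ := hu
  rw [encSigmaAntiSym, PMF.mem_support_map_iff] at hc
  obtain ⟨g, hg, rfl⟩ := hc
  obtain ⟨w, hw, P, ⟨hP, hPw⟩, rfl⟩ := (PMF.mem_support_uniformOn _).1 hu
  refine ⟨_, mem_lowDeg_iff.2 ⟨P, hP, rfl⟩, rfl, g, (PMF.mem_support_uniformOn _).1 hg, fun a => ?_⟩
  rw [hPw, sumWordOn_injective hw]

/-- The law of the encoding is invariant under translations by codewords of the message `0`. -/
theorem encPCP_add {q : (Fin m → F) → F} (hq : q ∈ lowDeg F d) (hanti : ∀ x y : Points A,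
    (∀ i, y.1 i = x.1 i.rev) → q x.1 + q y.1 = 0) (u : PartialPoint F m → F) :
    encPCP A d hd f (u + sumWord A q) = encPCP A d hd f u := by
  let q' : Points A → F := fun a => q a.1
  have hq' : q' ∈ AntiSym A := hanti
  -- Shift the antisymmetric part by the restriction of `q` and the word by `sumWord A q` at the
  -- same time; both uniform laws are preserved.
  rw [encPCP_apply, encPCP_apply, ← (Equiv.addRight q').tsum_eq]
  refine tsum_congr fun g => ?_
  congr 1
  · refine PMF.uniformOn_apply_congr _ _ (Equiv.addRight q') (fun g => ?_) g
    refine forall₃_congr fun x y hxy => ?_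
    have := hq' x y hxy
    change g x + q' x + (g y + q' y) = 0 ↔ _
    rw [add_add_add_comm, this, add_zero]
  · rw [encSigmaRM, encSigmaRM]
    refine PMF.uniformOn_apply_congr _ _ (Equiv.addRight (sumWord A q)) (fun u => ?_) u
    have key : ∀ {q : (Fin m → F) → F} (_ : q ∈ lowDeg F d) {g : Points A → F}
        {u : PartialPoint F m → F},
        (∃ w, sumWordOn A w = sumWordOn A (fun a => f.1 (some a) + g a) ∧
          ∃ p ∈ LD A d w, u = sumWord A fun z => MvPolynomial.eval z p) →
        ∃ w, sumWordOn A w = sumWordOn A (fun a => f.1 (some a) + (g a + q a.1)) ∧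
          ∃ p ∈ LD A d w, u + sumWord A q = sumWord A fun z => MvPolynomial.eval z p := by
      rintro q hq g u ⟨w, hw, P, ⟨hP, hPw⟩, rfl⟩
      obtain ⟨Q, hQ, rfl⟩ := mem_lowDeg_iff.1 hq
      refine ⟨_, rfl, P + Q, ⟨fun i => (MvPolynomial.degreeOf_add_le _ _ _).trans
        (max_le (hP i) (hQ i)), fun a => ?_⟩, ?_⟩
      · rw [map_add, hPw, sumWordOn_injective hw, add_assoc]
      · refine ((sumWordHom A).map_add _ _).symm.trans ?_
        refine congrArg (sumWord A) (funext fun z => ?_)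
        simp
    -- The converse is the same statement for `-q`.
    refine ⟨fun h => ?_, fun h => key hq h⟩
    have h2 := key (Submodule.neg_mem _ hq) h
    have h3 : sumWord A (-q) = - sumWord A q := (sumWordHom A).map_neg q
    simpa [h3, q'] using h2

end Law

/-- If the value at a point is not determined by given values, then it is uniformly distributed. -/
theorem map_filter_eq_uniform [Fintype F] {D : Type*} {μ : PMF (D → F)} {E : Set (D → F)}
    (h : ∃ c ∈ E, c ∈ μ.support) {v : D → F} (hμ : ∀ (t : F) c, μ (c + t • v) = μ c)
    (hE : ∀ (t : F) c, c + t • v ∈ E ↔ c ∈ E) {α : D} (hv : v α = 1) :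
    (μ.filter E h).map (fun c => c α) = PMF.uniformOfFintype F := by
  classical
  refine PMF.eq_uniformOfFintype _ fun β γ => ?_
  -- Translation by `(β - γ) • v` matches the words with symbol `γ` at `α` with those with symbol
  -- `β`.
  rw [PMF.map_apply, PMF.map_apply, ← (Equiv.addRight ((β - γ) • v)).tsum_eq]
  refine tsum_congr fun c => ?_
  have h1 : (β = (Equiv.addRight ((β - γ) • v) c) α) = (γ = c α) := by
    simp only [Equiv.coe_addRight, Pi.add_apply, Pi.smul_apply, hv, smul_eq_mul, mul_one, eq_iff_iff]
    constructor <;> intro h <;> linear_combination h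
  simp only [h1]
  congr 1
  rw [PMF.filter_apply, PMF.filter_apply]
  congr 1
  rw [Set.indicator_apply, Set.indicator_apply]
  simp only [Equiv.coe_addRight, hE, hμ]

end LowDeg

/-! ### The simulator -/

namespace LowDeg

universe u

open PolyComp Enc

variable {F : Type u} [Field F] {m n : ℕ} {A : Fin m → Finset F} {d : Fin m → ℕ}

/-- The low-degree functions that are antisymmetric on the product set. -/
def antiLowDeg (A : Fin m → Finset F) (d : Fin m → ℕ) : Submodule F ((Fin m → F) → F) where
  carrier := {p | p ∈ lowDeg F d ∧ Anti A p}
  zero_mem' := ⟨Submodule.zero_mem _, fun a _ => by simp⟩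
  add_mem' := by
    rintro p q ⟨hp, hp'⟩ ⟨hq, hq'⟩
    refine ⟨Submodule.add_mem _ hp hq, fun a ha => ?_⟩
    rw [Pi.add_apply, Pi.add_apply, add_add_add_comm, hp' a ha, hq' a ha, add_zero]
  smul_mem' := by
    rintro c p ⟨hp, hp'⟩
    refine ⟨Submodule.smul_mem _ c hp, fun a ha => ?_⟩
    rw [Pi.smul_apply, Pi.smul_apply, ← smul_add, hp' a ha, smul_zero]

/-- If no relation determines the value at a point, then some word of an antisymmetric function is
`1` there and `0` at the other points. -/
theorem exists_antiLowDeg {Z : Fin (n + 2) → PartialPoint F m}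
    (h : ∀ c : Fin (n + 2) → F, c 0 = 0 → IsRel A d (functional A Z c) → c (Fin.succ 0) = 0) :
    ∃ q ∈ antiLowDeg A d, sumWord A q (Z (Fin.succ 0)) = 1 ∧
      ∀ i : Fin n, sumWord A q (Z i.succ.succ) = 0 := by
  by_contra! hcon
  let δ : PartialPoint F m → antiLowDeg A d →ₗ[F] F := fun z =>
    LinearMap.proj z ∘ₗ sumWordHom A ∘ₗ (antiLowDeg A d).subtype
  have hδ : ∀ z (q : antiLowDeg A d), δ z q = sumWord A q.1 z := fun z q => rfl
  -- If there is no such function, vanishing at the old points forces vanishing at the new one.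
  -- Evaluation at the new point is then a combination of the other evaluations, which is a relation
  -- with coefficient `1` there.
  have hker : ⨅ i : Fin n, LinearMap.ker (δ (Z i.succ.succ)) ≤
      LinearMap.ker (δ (Z (Fin.succ 0))) := by
    intro q hq
    by_contra hne
    rw [LinearMap.mem_ker] at hne
    obtain ⟨i, hi⟩ := hcon _ ((δ (Z (Fin.succ 0)) q)⁻¹ • q).2 (by
      rw [← hδ, map_smul, smul_eq_mul, inv_mul_cancel₀ hne])
    refine hi ?_
    rw [← hδ, map_smul, LinearMap.mem_ker.1 ((Submodule.mem_iInf _).1 hq i), smul_zero]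
  obtain ⟨c, hc⟩ := (Submodule.mem_span_range_iff_exists_fun F).1
    (mem_span_of_iInf_ker_le_ker hker)
  refine one_ne_zero (h (Fin.cons 0 (Fin.cons 1 fun i => - c i)) rfl fun p hp hanti => ?_)
  have := LinearMap.congr_fun hc ⟨p, hp, hanti⟩
  simp only [LinearMap.sum_apply, LinearMap.smul_apply, hδ, smul_eq_mul] at this
  rw [functional_apply, Fin.sum_univ_succ, Fin.sum_univ_succ]
  simp only [Fin.cons_zero, Fin.cons_succ, zero_mul, one_mul, zero_add, neg_mul,
    Finset.sum_neg_distrib, this]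
  exact add_neg_cancel _

/-- The points `⊥`, the new query, and the old queries. -/
def points (T : Fin n → PartialPoint F m × F) (α : PartialPoint F m) :
    Fin (n + 2) → PartialPoint F m :=
  Fin.cons ⟨0, Fin.elim0⟩ (Fin.cons α fun i => (T i).1)

omit [Field F] in
theorem lists_points (T : Fin n → PartialPoint F m × F) (α : PartialPoint F m) :
    lists (points T α) =
      Fin.cons [] (Fin.cons (List.ofFn α.2) fun i => List.ofFn (T i).1.2) := by
  ext1 i
  refine Fin.cases rfl (fun i => Fin.cases rfl (fun i => rfl) i) i

theorem anti_of_mem_antiSym [DecidableEq F] {g : Points A → F} (hg : g ∈ AntiSym A)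
    (hsymm : ∀ i, A i.rev = A i) :
    Anti A fun a => if h : a ∈ Fintype.piFinset A then g ⟨a, h⟩ else 0 := by
  intro a ha
  dsimp only
  rw [dif_pos ha, dif_pos (rev_mem hsymm ha)]
  exact hg _ _ fun i => rfl

section Simulation

variable [Fintype F] (hsymm : ∀ i, A i.rev = A i) (hne : ∀ i, (A i).Nonempty)
  (hd : ∀ i, 2 * ((A i).card - 1) ≤ d i) {L : Fin m → List F} (hnodup : ∀ i, (L i).Nodup)
  (hL : ∀ i x, x ∈ L i ↔ x ∈ A i) (f : messages A) (T : Fin n → PartialPoint F m × F)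
  (α : PartialPoint F m)

include hsymm hne hnodup hL

theorem map_filter_eq_uniform_of_useful_eq_nil
    (h : usefulRelations (lists (points T α)) L d = [])
    (hE : ∃ c ∈ agreeing T, c ∈ (encPCP A d hd f).support) :
    ((encPCP A d hd f).filter (agreeing T) hE).map (fun c => c α) = PMF.uniformOfFintype F := by
  classical
  have hd' : ∀ i, (A i).card - 1 ≤ d i := fun i => by have := hd i; omega
  obtain ⟨q, hq, h1, h0⟩ := exists_antiLowDeg (A := A) (d := d) (Z := points T α) fun c hc0 hc =>
    apply_one_eq_zero hnodup hL hsymm d _ hne h (hc.conditions hsymm hd') hc0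
  refine map_filter_eq_uniform hE (v := sumWord A q) (fun t c => ?_) (fun t c => ?_) h1
  · have hmem := Submodule.smul_mem _ t hq
    have hsmul : t • sumWord A q = sumWord A (t • q) := ((sumWordHom A).map_smul t q).symm
    rw [hsmul]
    refine encPCP_add hd f hmem.1 (fun x y hxy => ?_) c
    have : y.1 = rev x.1 := funext hxy
    rw [this]
    exact hmem.2 _ x.2
  · refine forall_congr' fun i => ?_
    have : sumWord A q (T i).1 = 0 := h0 i
    rw [Pi.add_apply, Pi.smul_apply, this, smul_zero, add_zero]

/-- The relation expresses the symbol at `α` by the old symbols and `Λ p`, and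
`Conditions.apply_add` removes the unknown antisymmetric part from `Λ p`. -/
theorem eq_of_mem_support [DecidableEq F] (h : usefulRelations (lists (points T α)) L d ≠ [])
    {c : PartialPoint F m → F} (hcT : c ∈ agreeing T) (hc : c ∈ (encPCP A d hd f).support) :
    c α = - ∑ i, PolyComp.coeffs (lists (points T α)) L d i *
        (Fin.cons 0 (Fin.cons 0 fun i => (T i).2) : Fin (n + 2) → F) i +
      ∑ a ∈ Fintype.piFinset A, (if h : a ∈ Fintype.piFinset A then f.1 (some ⟨a, h⟩) else 0) *
        functional A (points T α) (PolyComp.coeffs (lists (points T α)) L d) (lagFun A a) := by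
  have hd' : ∀ i, (A i).card - 1 ≤ d i := fun i => by have := hd i; omega
  obtain ⟨hcond, hc0, hc1⟩ := coeffs_spec hnodup hL hsymm d (points T α) hne h
  obtain ⟨p, hp, rfl, g, hg, hpg⟩ := exists_of_mem_support_encPCP hd f hc
  rw [← hcond.apply_add hsymm hd' hp (anti_of_mem_antiSym hg hsymm) fun a ha => by
    rw [dif_pos ha, dif_pos ha, ← hpg]]
  rw [functional_apply]
  simp only [Fin.sum_univ_succ, hc0, hc1]
  have hT : ∀ i, sumWord A p (T i).1 = (T i).2 := hcT
  simp [points, hT]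

end Simulation

open Classical in
/-- The value of a message in the position that is written as the given list. -/
noncomputable def messageValue (f : MessagePos A → F) (l : List F) : F :=
  if h : ∃ s, encodeMessagePos A s = Data.ofElts l then f h.choose else 0

theorem messageValue_eq (hm : 0 < m) (f : MessagePos A → F) {l : List F} {s : MessagePos A}
    (h : encodeMessagePos A s = Data.ofElts l) : messageValue f l = f s := by
  have h' : ∃ s, encodeMessagePos A s = Data.ofElts l := ⟨s, h⟩
  rw [messageValue, dif_pos h', encodeMessagePos_injective hm A (h'.choose_spec.trans h.symm)]

theorem messageOracle_eq (hm : 0 < m) (f : MessagePos A → F) {l : List F} {s : MessagePos A}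
    (h : encodeMessagePos A s = Data.ofElts l) :
    messageOracle (encodeMessagePos A) f (Data.ofElts l) = Data.elt (messageValue f l) := by
  rw [messageValue_eq hm f h, ← h, messageOracle_apply (encodeMessagePos_injective hm A)]

omit [Field F] in
theorem card_le_maxCard (i : Fin m) : (A i).card ≤ maxCard A :=
  Finset.le_sup (f := fun i => (A i).card) (Finset.mem_univ i)

-- The number of questions is of order `n² m a`, so the error term of `ellAntiSym` is not needed.
omit [Field F] in
theorem queries_le (hm : 0 < m) (hne : ∀ i, (A i).Nonempty) (n : ℕ) :
    (((n + 2) * ((n + 2) * ∑ i, (A i).card) + 1 : ℕ) : ℝ) ≤ ellSigmaRM A (ellAntiSym 0 A n) := by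
  have hsum : ∑ i, (A i).card ≤ m * maxCard A := by
    simpa using Finset.sum_le_card_nsmul Finset.univ (fun i => (A i).card) (maxCard A)
      fun i _ => card_le_maxCard i
  have ha : 1 ≤ maxCard A := (Finset.card_pos.2 (hne ⟨0, hm⟩)).trans_le (card_le_maxCard _)
  rw [ellSigmaRM, ellAntiSym]
  generalize maxCard A = a at hsum ha ⊢
  have h1 : (n + 2) * ((n + 2) * ∑ i, (A i).card) + 1 ≤
      (n ^ 2 * m ^ 2 + 1) * m * (m * (a + 1) + 1) ^ 2 :=
    calc (n + 2) * ((n + 2) * ∑ i, (A i).card) + 1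
        ≤ (n + 2) * ((n + 2) * (m * a)) + 1 := by gcongr
      _ = (n + 2) ^ 2 * (m * a) + 1 := by ring
      _ ≤ (5 * (n ^ 2 * 1 ^ 2 + 1)) * (m * a) + m * 1 := by
          -- The difference of the two sides is `(2n - 1)²`.
          have : (n + 2) ^ 2 ≤ 5 * (n ^ 2 * 1 ^ 2 + 1) := by
            zify
            nlinarith [sq_nonneg (2 * (n : ℤ) - 1)]
          gcongr
          omega
      _ ≤ (n ^ 2 * 1 ^ 2 + 1) * m * (1 * (a + 1) + 1) ^ 2 := by
          have h2 : 5 * a + 1 ≤ (1 * (a + 1) + 1) ^ 2 := by nlinarith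
          calc (5 * (n ^ 2 * 1 ^ 2 + 1)) * (m * a) + m * 1
              ≤ (5 * (n ^ 2 * 1 ^ 2 + 1)) * (m * a) + m * (n ^ 2 * 1 ^ 2 + 1) := by
                gcongr
                omega
            _ = (n ^ 2 * 1 ^ 2 + 1) * m * (5 * a + 1) := by ring
            _ ≤ _ := by gcongr
      _ ≤ (n ^ 2 * m ^ 2 + 1) * m * (m * (a + 1) + 1) ^ 2 := by gcongr <;> exact hm
  have h2 := (Nat.cast_le (α := ℝ)).2 h1
  refine h2.trans (le_of_eq ?_)
  rw [zero_mul, add_zero]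
  push_cast
  ring

section Final

variable [Fintype F] (hd : ∀ i, 2 * ((A i).card - 1) ≤ d i) {L : Fin m → List F}
  (hnodup : ∀ i, (L i).Nodup) (hL : ∀ i x, x ∈ L i ↔ x ∈ A i)

/-- A bound for all the parameters. -/
def budget (F : Type u) [Fintype F] (d : Fin m → ℕ) (n : ℕ) : ℕ :=
  (Nat.log 2 (Fintype.card F) + 1) ^ 2 + m + Finset.univ.sup d + n + 16

-- The degree condition gives `|A_i| ≤ d_i + 1`, so the degrees control the sizes of the sets.
omit [Field F] in
include hd hnodup hL in
theorem length_le_budget (i : Fin m) (n : ℕ) : (L i).length ≤ budget F d n := by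
  classical
  have h1 : (L i).toFinset = A i := by ext x; simp [hL]
  have h2 : (L i).length = (A i).card := by rw [← h1, List.toFinset_card_of_nodup (hnodup i)]
  have h3 := Finset.le_sup (f := d) (Finset.mem_univ i)
  have h4 := hd i
  rw [budget]
  omega

/-- The input of the simulator. -/
noncomputable def simulatorInput (f : messages A) (T : Fin n → PartialPoint F m × F) (α : PartialPoint F m) :
    PolyComp.Input.{u} where
  S :=
    { F := F
      O := messageOracle (encodeMessagePos A) f.1
      B := budget F d n
      le_B := by simp [budget]
      bits_le := by
        rw [budget, Prog.fieldBits]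
        omega }
  m := m
  n := n
  L := L
  d := d
  T := fun i => (List.ofFn (T i).1.2, (T i).2)
  α := List.ofFn α.2
  m_le := by dsimp only [budget]; omega
  n_le := by dsimp only [budget]; omega
  L_le := fun i => length_le_budget hd hnodup hL i n
  d_le := fun i => by
    have := Finset.le_sup (f := d) (Finset.mem_univ i)
    dsimp only [budget]
    omega

variable (f : messages A) (T : Fin n → PartialPoint F m × F) (α : PartialPoint F m)

theorem simulatorInput_z : (simulatorInput hd hnodup hL f T α).z = lists (points T α) :=
  (lists_points T α).symm

theorem enc_simulatorInput_raw :
    (enc (simulatorInput hd hnodup hL f T α).raw : Data (simulatorInput hd hnodup hL f T α).S.F) =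
    simInput (encodeParams L d) encodePartialPoint T α := by
  simp only [Input.raw, simulatorInput, enc, simInput, encodeParams, encodePartialPoint,
    List.map_ofFn, Data.ofElts, Function.comp_def]

end Final

/-- The program, run on the input of a simulator. -/
theorem exists_program_simInput : ∃ (P : Prog) (k : ℕ),
    ∀ (F : Type u) [Field F] [Fintype F] (m : ℕ) (A : Fin m → Finset F) (d : Fin m → ℕ)
      (_ : ∀ i, 2 * ((A i).card - 1) ≤ d i) (L : Fin m → List F) (_ : ∀ i, (L i).Nodup)
      (_ : ∀ i x, x ∈ L i ↔ x ∈ A i) (f : messages A) (n : ℕ) (T : Fin n → PartialPoint F m × F)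
      (α : PartialPoint F m),
    (usefulRelations (lists (points T α)) L d = [] → ∃ t ≤ budget F d n ^ k,
      P.run (messageOracle (encodeMessagePos A) f.1)
        (simInput (encodeParams L d) encodePartialPoint T α) =
          (PMF.uniformOfFintype F).map fun a => ⟨Data.elt a, t, 0⟩) ∧
    (usefulRelations (lists (points T α)) L d ≠ [] → ∀ val : List F → F,
      (∀ q ∈ plan (lists (points T α)) L d,
        messageOracle (encodeMessagePos A) f.1 (Data.ofElts q.1) = Data.elt (val q.1) ∧
          q.1.length ≤ m) →
      (plan (lists (points T α)) L d).length ≤ searchBound (n + 2) L + 1 →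
      ∃ t ≤ budget F d n ^ k, P.run (messageOracle (encodeMessagePos A) f.1)
        (simInput (encodeParams L d) encodePartialPoint T α) =
          PMF.pure ⟨Data.elt (- ∑ i, PolyComp.coeffs (lists (points T α)) L d i *
              (Fin.cons 0 (Fin.cons 0 fun i => (T i).2) : Fin (n + 2) → F) i +
            ((plan (lists (points T α)) L d).map fun q => q.2 * val q.1).sum), t,
            (plan (lists (points T α)) L d).length⟩) := by
  obtain ⟨P, k, hP⟩ := exists_program.{u}
  refine ⟨P, k, fun F _ _ m A d hd L hnodup hL f n T α => ?_⟩
  have h := hP (simulatorInput hd hnodup hL f T α)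
  rw [Input.useful, Input.known, enc_simulatorInput_raw, simulatorInput_z] at h
  exact h

/-- There are one program and one exponent that serve all parameters. -/
theorem exists_isLocalSimulator : ∃ (P : Prog) (k : ℕ),
    ∀ (F : Type u) [Field F] [Fintype F] (m : ℕ) (_ : 0 < m) (A : Fin m → Finset F)
      (_ : ∀ i, (A i).Nonempty) (_ : ∀ i, A i.rev = A i) (d : Fin m → ℕ)
      (hd : ∀ i, 2 * ((A i).card - 1) ≤ d i) (L : Fin m → List F) (_ : ∀ i, (L i).Nodup)
      (_ : ∀ i x, x ∈ L i ↔ x ∈ A i),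
      IsLocalSimulator P (encodeParams L d) (encodeMessagePos A) encodePartialPoint
        (messages A) (encPCP A d hd) (fun n => budget F d n ^ k)
        (fun n => ellSigmaRM A (ellAntiSym 0 A n)) := by
  classical
  obtain ⟨P, k, hP⟩ := exists_program_simInput.{u}
  refine ⟨P, k, fun F _ _ m hm A hne hsymm d hd L hnodup hL f n T α => ?_⟩
  obtain ⟨hfree, hdet⟩ := hP F m A d hd L hnodup hL f n T α
  have hq := queries_le hm hne n
  -- Without a useful relation the conditioned symbol is uniform and no question is asked; otherwise
  -- it is constant and equals the value of the plan.
  by_cases h : usefulRelations (lists (points T α)) L d = []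
  · obtain ⟨t, ht, hrun⟩ := hfree h
    rw [hrun]
    refine ⟨fun r hr => ?_, fun hE β => ?_⟩
    · obtain ⟨a, _, rfl⟩ := (PMF.mem_support_map_iff _ _ _).1 hr
      exact ⟨ht, by simpa using (Nat.cast_nonneg _).trans hq⟩
    · rw [map_filter_eq_uniform_of_useful_eq_nil hsymm hne hd hnodup hL f T α h hE, PMF.map_comp]
      exact PMF.map_apply_of_injective _ (f := Data.elt) (fun _ _ h => by injection h) β
  · obtain ⟨hlen, hmem, hsum⟩ := plan_spec hnodup hL hm hsymm hne hd (Z := points T α) rfl h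
    have hpos : ∀ a (ha : a ∈ Fintype.piFinset A),
        encodeMessagePos A (some ⟨a, ha⟩) = Data.ofElts (List.ofFn a) := fun a ha => rfl
    have hval : ∀ a, a ∈ Fintype.piFinset A → messageValue f.1 (List.ofFn a) =
        if h : a ∈ Fintype.piFinset A then f.1 (some ⟨a, h⟩) else 0 := fun a ha => by
      rw [messageValue_eq hm f.1 (hpos a ha), dif_pos ha]
    obtain ⟨t, ht, hrun⟩ := hdet h (messageValue f.1) (fun q hq => by
      rcases hmem q hq with hq | ⟨a, ha, hq⟩
      · rw [hq]
        exact ⟨messageOracle_eq hm f.1 (s := none) rfl, Nat.zero_le _⟩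
      · rw [hq]
        exact ⟨messageOracle_eq hm f.1 (hpos a ha), (List.length_ofFn).le⟩) hlen
    rw [hrun]
    refine ⟨fun r hr => ?_, fun hE β => ?_⟩
    · obtain rfl := (PMF.mem_support_pure_iff _ _).1 hr
      refine ⟨ht, le_trans (Nat.cast_le.2 ?_) hq⟩
      rw [← searchBound_eq hnodup hL]
      exact hlen
    · have htotal : messageValue f.1 [] =
          ∑ a ∈ Fintype.piFinset A, messageValue f.1 (List.ofFn a) := by
        rw [messageValue_eq hm f.1 (s := none) rfl, ← Finset.sum_coe_sort (Fintype.piFinset A)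
          fun a => messageValue f.1 (List.ofFn a)]
        exact Eq.trans f.2 (Finset.sum_congr rfl fun a _ =>
          (messageValue_eq hm f.1 (hpos a.1 a.2)).symm)
      rw [PMF.pure_map, PMF.map_eq_pure (α := PartialPoint F m → F) _ fun c hc => (by
        rw [PMF.mem_support_filter_iff] at hc
        rw [hsum _ htotal]
        refine (eq_of_mem_support hsymm hne hd hnodup hL f T α h hc.1 hc.2).trans ?_
        congr 1
        exact Finset.sum_congr rfl fun a ha => by rw [hval a ha] :
        c α = - ∑ i, PolyComp.coeffs (lists (points T α)) L d i *
            (Fin.cons 0 (Fin.cons 0 fun i => (T i).2) : Fin (n + 2) → F) i +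
          ((plan (lists (points T α)) L d).map fun q => q.2 * messageValue f.1 q.1).sum)]
      simp only [PMF.pure_apply, Data.elt.injEq]

end LowDeg

/-- One program, one polynomial and one constant serve all parameters. -/
theorem mainTheorem7 :
    ∃ (P : Prog) (τ : MvPolynomial (Fin 4) ℕ) (C : ℝ),
      ∀ (F : Type*) [Field F] [Fintype F] (m : ℕ) (_hm : 0 < m)
        (A : Fin m → Finset F) (_hne : ∀ i, (A i).Nonempty) (_hsymm : ∀ i, A i.rev = A i)
        (d : Fin m → ℕ) (hd : ∀ i, 2 * ((A i).card - 1) ≤ d i)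
        (L : Fin m → List F) (_hnodup : ∀ i, (L i).Nodup) (_hL : ∀ i x, x ∈ L i ↔ x ∈ A i),
        IsLocalSimulator P (encodeParams L d) (encodeMessagePos A) encodePartialPoint
          (messages A) (encPCP A d hd)
          (fun n => MvPolynomial.eval
            ![Nat.log 2 (Fintype.card F), m, Finset.univ.sup d, n] τ)
          (fun n => ellSigmaRM A (ellAntiSym C A n)) := by
  obtain ⟨P, k, hP⟩ := LowDeg.exists_isLocalSimulator
  -- The polynomial is the `k`-th power of `budget`, and the constant in the `O(·)` is `0`.
  refine ⟨P, ((MvPolynomial.X 0 + 1) ^ 2 + MvPolynomial.X 1 + MvPolynomial.X 2 +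
    MvPolynomial.X 3 + 16) ^ k, 0, fun F _ _ m hm A hne hsymm d hd L hnodup hL => ?_⟩
  convert hP F m hm A hne hsymm d hd L hnodup hL using 2 with n
  simp [LowDeg.budget]
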